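/- Let $M=\mathbb{H}^3/\Gamma$ be a complete hyperbolic 3-manifold without cusps; that is, $\Gamma$ is a group of isometries of $\mathbb{H}^3$ (possibly orientation-reversing) that acts freely and properly discontinuously and contains no parabolic element. Let $S$ be a closed (compact, without boundary), connected, orientable smooth surface, and let $f\colon S\to M$ be a smooth immersion all of whose principal curvatures, at every point of $S$, lie in $[-1,1]$. Let $p\colon S'\to S$ be a covering with $S'$ connected (for instance the universal covering), and let $\tilde f\colon S'\to\mathbb{H}^3$ be a lift of $f$, that is, a continuous map with $\pi\circ\tilde f=f\circ p$, where $\pi\colon\mathbb{H}^3\to M$ is the quotient map. Then the limit set of $\tilde f(S')$, that is, the set of its accumulation points on the sphere at infinity $\partial\mathbb{H}^3$, is a proper subset of $\partial\mathbb{H}^3$. -/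

import Mathlib

open scoped Manifold ContDiff

noncomputable section

namespace Hyp3

/-- Euclidean 3-space. -/
abbrev E3 : Type := EuclideanSpace ℝ (Fin 3)

/-- The model space of surfaces. -/
abbrev E2 : Type := EuclideanSpace ℝ (Fin 2)

/-- Minkowski space `ℝ^{3,1}`: a space part and a time part. -/
abbrev Mink : Type := E3 × ℝ

/-- The Lorentzian inner product `⟨x, y⟩ = x₁y₁ + x₂y₂ + x₃y₃ - x₄y₄`. -/
def lor (x y : Mink) : ℝ := inner ℝ x.1 y.1 - x.2 * y.2

/-- The future sheet of the hyperboloid `⟨x, x⟩ = -1`. -/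
def hyperboloid : Set Mink := {x | lor x x = -1 ∧ 0 < x.2}

/-- Hyperbolic 3-space in the hyperboloid model; its Riemannian metric is the restriction of `lor`
to the tangent spaces of the hyperboloid. -/
abbrev H3 : Type := hyperboloid

/-- The isometry group of hyperbolic 3-space (orientation-reversing isometries included), as the
group `O⁺(3,1)` of the linear automorphisms of Minkowski space that preserve the Lorentzian inner
product and the future sheet. -/
def isomH3 : Subgroup (Mink ≃L[ℝ] Mink) where
  carrier := {g | (∀ x y, lor (g x) (g y) = lor x y) ∧ ∀ x, g x ∈ hyperboloid ↔ x ∈ hyperboloid}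
  mul_mem' {a b} ha hb :=
    ⟨fun x y => (ha.1 (b x) (b y)).trans (hb.1 x y), fun x => (ha.2 (b x)).trans (hb.2 x)⟩
  one_mem' := ⟨fun _ _ => rfl, fun _ => Iff.rfl⟩
  inv_mem' {a} ha := by
    have key : ∀ x, a (a⁻¹ x) = x := fun x => a.apply_symm_apply x
    refine ⟨fun x y => ?_, fun x => ?_⟩
    · rw [← ha.1 (a⁻¹ x) (a⁻¹ y), key, key]
    · rw [← ha.2 (a⁻¹ x), key]

/-- The action of the isometry group on hyperbolic 3-space. -/
instance : MulAction isomH3 H3 where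
  smul g x := ⟨(g : Mink ≃L[ℝ] Mink) x, (g.2.2 x).2 x.2⟩
  one_smul _ := rfl
  mul_smul _ _ _ := rfl

/-- The sphere at infinity `∂H³`: the point `u` stands for the null line spanned by `(u, 1)`. -/
abbrev SphereAtInfinity : Type := Metric.sphere (0 : E3) 1

/-- The isometry `g` fixes the point `u` of the sphere at infinity. -/
def FixesAtInfinity (g : isomH3) (u : SphereAtInfinity) : Prop :=
  ∃ c : ℝ, (g : Mink ≃L[ℝ] Mink) ((u : E3), (1 : ℝ)) = c • ((u : E3), (1 : ℝ))

/-- An isometry is parabolic if it has no fixed point in `H³` and exactly one fixed point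
at infinity. -/
def IsParabolic (g : isomH3) : Prop :=
  (∀ x : H3, g • x ≠ x) ∧ ∃! u : SphereAtInfinity, FixesAtInfinity g u

/-- The radial projection of `H³` onto the open unit ball (projective model), whose boundary sphere
is the sphere at infinity. -/
def toBall (x : H3) : E3 := (x : Mink).2⁻¹ • (x : Mink).1

/-- The limit set of a subset of `H³`: its accumulation points on the sphere at infinity. -/
def limitSet (A : Set H3) : Set SphereAtInfinity := {u | (u : E3) ∈ closure (toBall '' A)}

/-- The quotient `H³/Γ`, with the quotient topology. -/
abbrev HypQuotient (Γ : Subgroup isomH3) : Type := MulAction.orbitRel.Quotient Γ H3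

/-- The projection `H³ → H³/Γ`. -/
def proj (Γ : Subgroup isomH3) (x : H3) : HypQuotient Γ := Quotient.mk _ x

/-- A smooth surface is orientable: it has a smooth atlas whose transition maps all have positive
Jacobian determinant. -/
def IsOrientable (S : Type*) [TopologicalSpace S] [ChartedSpace E2 S] : Prop :=
  ∃ A ⊆ IsManifold.maximalAtlas (𝓡 2) ∞ S, (∀ x : S, ∃ e ∈ A, x ∈ e.source) ∧
    ∀ e ∈ A, ∀ e' ∈ A, ∀ x ∈ e.source ∩ e'.source,
      0 < (fderiv ℝ (fun z : E2 => e' (e.symm z)) (e x)).det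

section Surface

variable {S : Type*} [TopologicalSpace S] [ChartedSpace E2 S]

/-- The differential at `s` of a map from a surface to Minkowski space. -/
def diff (F : S → Mink) (s : S) : TangentSpace (𝓡 2) s →L[ℝ] Mink := mfderiv (𝓡 2) 𝓘(ℝ, Mink) F s

/-- On the open set `U`, the map `F` into `H³` is a smooth immersion that lifts `f`. -/
structure IsImmersedLiftOn {Γ : Subgroup isomH3} (f : S → HypQuotient Γ) (U : Set S)
    (F : S → H3) : Prop where
  isOpen : IsOpen U
  lift : ∀ y ∈ U, proj Γ (F y) = f y
  smooth : ContMDiffOn (𝓡 2) 𝓘(ℝ, Mink) ∞ (fun y => (F y : Mink)) U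
  immersion : ∀ y ∈ U, Function.Injective (diff (fun y => (F y : Mink)) y)

/-- `f : S → H³/Γ` is a smooth immersion. The smooth structure of `H³/Γ` (`Γ` acting freely and
properly discontinuously) is the one that makes the covering `H³ → H³/Γ` a local diffeomorphism, so
this means that `f` lifts, near every point, to a smooth immersion into `H³`. -/
def IsSmoothImmersion {Γ : Subgroup isomH3} (f : S → HypQuotient Γ) : Prop :=
  ∀ s : S, ∃ (U : Set S) (F : S → H3), s ∈ U ∧ IsImmersedLiftOn f U F

/-- `ν` is, on `U`, a smooth unit normal vector field of `F`: it is tangent to `H³`, has length one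
and is orthogonal to the image of the differential of `F`. -/
structure IsUnitNormalOn (F : S → H3) (U : Set S) (ν : S → Mink) : Prop where
  smooth : ContMDiffOn (𝓡 2) 𝓘(ℝ, Mink) ∞ ν U
  tangent : ∀ y ∈ U, lor (ν y) (F y) = 0
  unit : ∀ y ∈ U, lor (ν y) (ν y) = 1
  normal : ∀ y ∈ U, ∀ v : TangentSpace (𝓡 2) y, lor (ν y) (diff (fun y => (F y : Mink)) y v) = 0

/-- `k` is a principal curvature at `s` of the immersion `f : S → H³/Γ`, with respect to one of the
two local unit normals: an eigenvalue of the shape operator `A`, where `dF (A v) = -∇_v ν` for a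
local lift `F` with unit normal `ν`. The Levi-Civita derivative `∇_v ν` in `H³` is the tangential
part of the derivative of `ν` in Minkowski space, and that derivative is already tangent to `H³`
because `⟨ν, F⟩ = 0` and `⟨ν, dF⟩ = 0`. -/
def IsPrincipalCurvature {Γ : Subgroup isomH3} (f : S → HypQuotient Γ) (s : S) (k : ℝ) : Prop :=
  ∃ (U : Set S) (F : S → H3) (ν : S → Mink), s ∈ U ∧ IsImmersedLiftOn f U F ∧
    IsUnitNormalOn F U ν ∧ ∃ v : TangentSpace (𝓡 2) s, v ≠ 0 ∧
      diff ν s v = -(k • diff (fun y => (F y : Mink)) s v)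

end Surface

end Hyp3

end

/-!
Points of the surface and of hyperbolic space are compared through the squared chordal distance
`chord v w = ⟨v - w, v - w⟩` of Minkowski space. The curvature hypothesis says that the surface lies
between the two horospheres tangent to it at each point, up to second order. So for a null vector
`ξ` the horospherical height `u = -⟨x, ξ⟩`, the exponential of a Busemann function, is convex along
the surface, and the flow of `-grad u` does not increase distances along the surface
(`CurvSurface.lor_grad_sub_le` is the infinitesimal statement).

At some point `p`, on some side, all principal curvatures are smaller than `1`: otherwise `-1` and
`1` would be principal curvatures at every point of an open set, so that both `x + ν` and `x - ν`
would degenerate along a line field, and third derivatives of these maps show that this is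
impossible in hyperbolic space (`IsParam.not_curvature_one`, `IsCurvParam.exists_strict`). The
normal geodesic from `p` on that side ends at a null vector `ξ = x p ± ν p`, the gradient of its
height `u` vanishes at `p`, and `p` attracts the nearby trajectories of `-grad u`
(`exists_isAttractor`). Since trajectories contract, the basin of attraction is open and closed, so
it is the whole connected surface (`IsAttractor.basin_eq_univ`).

Along a trajectory `c` the quantity `|grad u|² / u` is nonincreasing in time, because `√u` is convex
as well. Hence `|grad u|² ≥ k² u` before the trajectory enters a fixed small neighbourhood of `p`,
so `u` decreases fast, and integrating backwards from that neighbourhood bounds `-⟨x, x p⟩ / u` on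
the whole surface (`IsAttractor.exists_bound`). But `-⟨x, x p⟩ / u` tends to infinity when `x`
converges to the point at infinity of `ξ`, which is therefore not a limit point
(`exists_notMem_limitSet`).

The covering surface need not be compact; compactness of the base and the isometries in `Γ` give
embedded discs of uniform size around all of its points (`exists_isDisc`), which makes the
trajectories complete (`CurvSurface.isComplete_of_isDisc`).
-/

namespace Hyp3

/-! ### Lorentzian linear algebra -/

section Lorentz

lemma lor_comm (v w : Mink) : lor v w = lor w v := by
  simp only [lor, real_inner_comm, mul_comm]

lemma lor_add_left (a b c : Mink) : lor (a + b) c = lor a c + lor b c := by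
  simp only [lor, Prod.fst_add, Prod.snd_add, inner_add_left]; ring

lemma lor_sub_left (a b c : Mink) : lor (a - b) c = lor a c - lor b c := by
  simp only [lor, Prod.fst_sub, Prod.snd_sub, inner_sub_left]; ring

lemma lor_neg_left (a c : Mink) : lor (-a) c = -lor a c := by
  simp only [lor, Prod.fst_neg, Prod.snd_neg, inner_neg_left]; ring

lemma lor_smul_left (r : ℝ) (a c : Mink) : lor (r • a) c = r * lor a c := by
  simp only [lor, Prod.smul_fst, Prod.smul_snd, real_inner_smul_left, smul_eq_mul]; ring

lemma lor_zero_left (c : Mink) : lor 0 c = 0 := by simp [lor]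

lemma lor_add_right (a b c : Mink) : lor c (a + b) = lor c a + lor c b := by
  simp only [lor_comm c, lor_add_left]

lemma lor_sub_right (a b c : Mink) : lor c (a - b) = lor c a - lor c b := by
  simp only [lor_comm c, lor_sub_left]

lemma lor_neg_right (a c : Mink) : lor c (-a) = -lor c a := by
  simp only [lor_comm c, lor_neg_left]

lemma lor_smul_right (r : ℝ) (a c : Mink) : lor c (r • a) = r * lor c a := by
  simp only [lor_comm c, lor_smul_left]

lemma lor_zero_right (c : Mink) : lor c 0 = 0 := by rw [lor_comm, lor_zero_left]

/-- The Lorentzian inner product as a continuous bilinear map. -/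
noncomputable def lorL : Mink →L[ℝ] Mink →L[ℝ] ℝ :=
  LinearMap.toContinuousBilinearMap (LinearMap.mk₂ ℝ lor lor_add_left lor_smul_left
    (fun c a b => lor_add_right a b c) (fun r c a => lor_smul_right r a c))

lemma lorL_apply (v w : Mink) : lorL v w = lor v w := rfl

lemma continuous_lor : Continuous fun q : Mink × Mink => lor q.1 q.2 := by
  simp only [lor]; fun_prop

lemma _root_.Continuous.lor {Y : Type*} [TopologicalSpace Y] {f g : Y → Mink}
    (hf : Continuous f) (hg : Continuous g) : Continuous fun y => lor (f y) (g y) :=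
  continuous_lor.comp (hf.prodMk hg)

lemma _root_.ContinuousOn.lor {Y : Type*} [TopologicalSpace Y] {f g : Y → Mink} {s : Set Y}
    (hf : ContinuousOn f s) (hg : ContinuousOn g s) : ContinuousOn (fun y => lor (f y) (g y)) s :=
  Continuous.comp_continuousOn (f := fun y => (f y, g y)) continuous_lor (hf.prodMk hg)

lemma _root_.ContDiffOn.lor {E : Type*} [NormedAddCommGroup E] [NormedSpace ℝ E] {f g : E → Mink}
    {s : Set E} {n : WithTop ℕ∞} (hf : ContDiffOn ℝ n f s) (hg : ContDiffOn ℝ n g s) :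
    ContDiffOn ℝ n (fun y => lor (f y) (g y)) s := by
  have h := (lorL.contDiff.comp_contDiffOn hf).clm_apply hg
  exact h

lemma _root_.HasFDerivAt.lor {E : Type*} [NormedAddCommGroup E] [NormedSpace ℝ E]
    {f g : E → Mink} {f' g' : E →L[ℝ] Mink} {x : E}
    (hf : HasFDerivAt f f' x) (hg : HasFDerivAt g g' x) :
    HasFDerivAt (fun y => lor (f y) (g y))
      (lorL.precompR E (f x) g' + lorL.precompL E f' (g x)) x :=
  lorL.hasFDerivAt_of_bilinear hf hg

lemma _root_.HasDerivWithinAt.lor {f g : ℝ → Mink} {f' g' : Mink} {s : Set ℝ} {x : ℝ}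
    (hf : HasDerivWithinAt f f' s x) (hg : HasDerivWithinAt g g' s x) :
    HasDerivWithinAt (fun y => lor (f y) (g y)) (lor (f x) g' + lor f' (g x)) s x := by
  have h := (lorL.hasFDerivAt_of_bilinear (x := (f x, g x)) (hasFDerivAt_fst) hasFDerivAt_snd)
  have h2 := h.comp_hasDerivWithinAt x (hf.prodMk hg)
  simpa [lorL_apply, Function.comp_def] using h2

/-- A vector orthogonal to a point of the hyperboloid is spacelike, quantitatively. -/
lemma norm_fst_sq_le {x v : Mink} (hx : x ∈ hyperboloid) (hv : lor v x = 0) :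
    ‖v.1‖ ^ 2 ≤ lor v v * x.2 ^ 2 := by
  have h1 : inner ℝ x.1 x.1 - x.2 * x.2 = -1 := hx.1
  have h2 : inner ℝ v.1 x.1 - v.2 * x.2 = 0 := hv
  have h3 : |inner ℝ v.1 x.1| ≤ ‖v.1‖ * ‖x.1‖ := abs_real_inner_le_norm _ _
  have h4 : lor v v = ‖v.1‖ ^ 2 - v.2 * v.2 := by rw [lor, real_inner_self_eq_norm_sq]
  rw [real_inner_self_eq_norm_sq] at h1
  have h5 : (v.2 * x.2) ^ 2 ≤ (‖v.1‖ * ‖x.1‖) ^ 2 := by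
    rw [← sq_abs (v.2 * x.2), ← sub_eq_zero.1 h2]
    exact pow_le_pow_left₀ (abs_nonneg _) h3 2
  have h6 : (‖v.1‖ * ‖x.1‖) ^ 2 = ‖v.1‖ ^ 2 * (x.2 ^ 2 - 1) := by
    rw [mul_pow]; congr 1; linarith
  rw [h4]; nlinarith

lemma lor_self_nonneg {x v : Mink} (hx : x ∈ hyperboloid) (hv : lor v x = 0) : 0 ≤ lor v v := by
  have h := norm_fst_sq_le hx hv
  have h2 : 0 < x.2 ^ 2 := pow_pos hx.2 2
  by_contra hc
  nlinarith [sq_nonneg ‖v.1‖]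

lemma eq_zero_of_lor_self {x v : Mink} (hx : x ∈ hyperboloid) (hv : lor v x = 0)
    (h0 : lor v v = 0) : v = 0 := by
  have h := norm_fst_sq_le hx hv
  rw [h0, zero_mul] at h
  have h1 : v.1 = 0 := by
    have : ‖v.1‖ ^ 2 = 0 := le_antisymm h (sq_nonneg _)
    simpa using this
  have h2 : v.2 = 0 := by
    have : lor v x = 0 := hv
    simp only [lor, h1, inner_zero_left, zero_sub, neg_eq_zero, mul_eq_zero] at this
    exact this.resolve_right hx.2.ne'
  exact Prod.ext h1 h2

/-- The Cauchy–Schwarz inequality on the tangent space of the hyperboloid at `x`. -/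
lemma lor_sq_le {x v w : Mink} (hx : x ∈ hyperboloid) (hv : lor v x = 0) (hw : lor w x = 0) :
    lor v w ^ 2 ≤ lor v v * lor w w := by
  rcases eq_or_ne (lor w w) 0 with h | h
  · have := eq_zero_of_lor_self hx hw h
    simp [this, lor_zero_right]
  · have hpos : 0 < lor w w := lt_of_le_of_ne (lor_self_nonneg hx hw) h.symm
    have hz : lor (lor w w • v - lor v w • w) x = 0 := by
      rw [lor_sub_left, lor_smul_left, lor_smul_left, hv, hw]; ring
    have h2 := lor_self_nonneg hx hz
    have h3 : lor (lor w w • v - lor v w • w) (lor w w • v - lor v w • w)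
        = lor w w * (lor v v * lor w w - lor v w ^ 2) := by
      simp only [lor_sub_left, lor_smul_left, lor_sub_right, lor_smul_right, lor_comm w v]; ring
    rw [h3] at h2
    have := nonneg_of_mul_nonneg_right h2 hpos
    linarith

lemma abs_lor_le {x v w : Mink} (hx : x ∈ hyperboloid) (hv : lor v x = 0) (hw : lor w x = 0) :
    |lor v w| ≤ √(lor v v) * √(lor w w) := by
  rw [← Real.sqrt_mul (lor_self_nonneg hx hv)]
  exact Real.abs_le_sqrt (lor_sq_le hx hv hw)

lemma lor_le_neg_one {x y : Mink} (hx : x ∈ hyperboloid) (hy : y ∈ hyperboloid) :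
    lor x y ≤ -1 := by
  have h1 : inner ℝ x.1 x.1 - x.2 * x.2 = -1 := hx.1
  have h2 : inner ℝ y.1 y.1 - y.2 * y.2 = -1 := hy.1
  have hx2 := hx.2
  have hy2 := hy.2
  have h3 : inner ℝ x.1 y.1 ≤ ‖x.1‖ * ‖y.1‖ := real_inner_le_norm _ _
  rw [real_inner_self_eq_norm_sq] at h1 h2
  have h4 : (‖x.1‖ * ‖y.1‖ + 1) ^ 2 ≤ (x.2 * y.2) ^ 2 := by
    have : (x.2 * y.2) ^ 2 = (‖x.1‖ ^ 2 + 1) * (‖y.1‖ ^ 2 + 1) := by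
      rw [mul_pow]; congr 1 <;> linarith
    rw [this]; nlinarith [sq_nonneg (‖x.1‖ - ‖y.1‖)]
  have h5 := (abs_le_of_sq_le_sq' h4 (mul_pos hx2 hy2).le).2
  simp only [lor]; linarith

/-- The chordal squared distance of Minkowski space; for two points of the hyperboloid at hyperbolic
distance `d` it equals `2 (cosh d - 1)`. -/
noncomputable def chord (v w : Mink) : ℝ := lor (v - w) (v - w)

lemma chord_comm (v w : Mink) : chord v w = chord w v := by
  simp only [chord, lor_sub_left, lor_sub_right, lor_comm v w]; ring

lemma chord_self (v : Mink) : chord v v = 0 := by simp [chord, lor_zero_left]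

lemma chord_eq {x y : Mink} (hx : x ∈ hyperboloid) (hy : y ∈ hyperboloid) :
    chord x y = -2 - 2 * lor x y := by
  simp only [chord, lor_sub_left, lor_sub_right, lor_comm y x, hx.1, hy.1]; ring

lemma chord_nonneg {x y : Mink} (hx : x ∈ hyperboloid) (hy : y ∈ hyperboloid) :
    0 ≤ chord x y := by
  rw [chord_eq hx hy]; linarith [lor_le_neg_one hx hy]

lemma eq_of_chord_eq_zero {x y : Mink} (hx : x ∈ hyperboloid) (hy : y ∈ hyperboloid)
    (h : chord x y = 0) : x = y := by
  rw [chord_eq hx hy] at h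
  have hxy : lor x y = -1 := by linarith
  have h1 : lor (y - x) x = 0 := by rw [lor_sub_left, lor_comm y, hxy, hx.1]; ring
  have h2 : lor (y - x) (y - x) = 0 := by
    simp only [lor_sub_left, lor_sub_right, lor_comm y x, hxy, hx.1, hy.1]; ring
  exact (sub_eq_zero.1 (eq_zero_of_lor_self hx h1 h2)).symm

lemma _root_.Continuous.chord {Y : Type*} [TopologicalSpace Y] {f g : Y → Mink}
    (hf : Continuous f) (hg : Continuous g) : Continuous fun y => chord (f y) (g y) :=
  (hf.sub hg).lor (hf.sub hg)

/-- Pairing a tangent vector at `x` with another point `y` of the hyperboloid. -/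
lemma abs_lor_le_chord {x y v : Mink} (hx : x ∈ hyperboloid) (hy : y ∈ hyperboloid)
    (hv : lor v x = 0) : |lor v y| ≤ √(lor v v) * √(chord x y + chord x y ^ 2 / 4) := by
  have h1 : lor (y + lor x y • x) x = 0 := by
    rw [lor_add_left, lor_smul_left, hx.1, lor_comm]; ring
  have h2 : lor (y + lor x y • x) (y + lor x y • x) = chord x y + chord x y ^ 2 / 4 := by
    rw [chord_eq hx hy]
    simp only [lor_add_left, lor_add_right, lor_smul_left, lor_smul_right, lor_comm y x, hx.1, hy.1]
    ring
  have h3 : lor v (y + lor x y • x) = lor v y := by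
    rw [lor_add_right, lor_smul_right, hv]; ring
  rw [← h3, ← h2]
  exact abs_lor_le hx hv h1

lemma lor_neg_of_null {x ξ : Mink} (hx : x ∈ hyperboloid) (h0 : lor ξ ξ = 0) (hξ : 0 < ξ.2) :
    lor x ξ < 0 := by
  have h1 : inner ℝ x.1 x.1 - x.2 * x.2 = -1 := hx.1
  have h2 : inner ℝ ξ.1 ξ.1 - ξ.2 * ξ.2 = 0 := h0
  have hx2 := hx.2
  have h3 : inner ℝ x.1 ξ.1 ≤ ‖x.1‖ * ‖ξ.1‖ := real_inner_le_norm _ _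
  rw [real_inner_self_eq_norm_sq] at h1 h2
  have h4 : ‖ξ.1‖ = ξ.2 := by
    have : ‖ξ.1‖ ^ 2 = ξ.2 ^ 2 := by linarith
    exact (pow_left_inj₀ (norm_nonneg _) hξ.le two_ne_zero).1 this
  have h5 : ‖x.1‖ < x.2 := lt_of_pow_lt_pow_left₀ 2 hx2.le (by linarith)
  simp only [lor]; rw [h4] at h3; nlinarith

lemma null_snd_pos {x ξ : Mink} (hx : x ∈ hyperboloid) (h0 : lor ξ ξ = 0) (hξ : lor x ξ < 0) :
    0 < ξ.2 := by
  by_contra hc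
  push Not at hc
  rcases hc.eq_or_lt with h | h
  · have h2 : inner ℝ ξ.1 ξ.1 - ξ.2 * ξ.2 = 0 := h0
    rw [real_inner_self_eq_norm_sq, h] at h2
    have : ξ.1 = 0 := by simpa using h2
    simp [lor, this, h] at hξ
  · have := lor_neg_of_null (ξ := -ξ) hx (by rw [lor_neg_left, lor_neg_right, h0]; simp)
      (by simpa using h)
    rw [lor_neg_right] at this; linarith

/-- A point of the hyperboloid, a unit normal and a spacelike plane orthogonal to both span
Minkowski space. -/
lemma exists_decomp {x ν : Mink} {L : E2 →L[ℝ] Mink} (hx : lor x x = -1) (hν : lor ν ν = 1)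
    (hνx : lor ν x = 0) (hL : Function.Injective L) (hLx : ∀ v, lor (L v) x = 0)
    (hLν : ∀ v, lor ν (L v) = 0) (w : Mink) : ∃ c d : ℝ, ∃ v, w = c • x + d • ν + L v := by
  let T : (ℝ × ℝ) × E2 →ₗ[ℝ] Mink :=
    LinearMap.coprod (LinearMap.coprod (LinearMap.toSpanSingleton ℝ Mink x)
      (LinearMap.toSpanSingleton ℝ Mink ν)) L.toLinearMap
  have hT : ∀ c d v, T ((c, d), v) = c • x + d • ν + L v := fun c d v => by simp [T]
  have hinj : Function.Injective T := by
    rw [← LinearMap.ker_eq_bot, LinearMap.ker_eq_bot']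
    rintro ⟨⟨c, d⟩, v⟩ h
    rw [hT] at h
    have hc := congrArg (fun y => lor y x) h
    have hd := congrArg (fun y => lor ν y) h
    simp only [lor_add_left, lor_add_right, lor_smul_left, lor_smul_right, hx, hν, hνx, hLx, hLν,
      lor_zero_left, lor_zero_right] at hc hd
    have hc0 : c = 0 := by linarith
    have hd0 : d = 0 := by linarith
    subst hc0 hd0
    simp only [zero_smul, zero_add] at h
    have : v = 0 := hL (by simpa using h)
    simp [this]
  have hsurj : Function.Surjective T := by
    refine (LinearMap.injective_iff_surjective_of_finrank_eq_finrank ?_).1 hinj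
    simp
  obtain ⟨⟨⟨c, d⟩, v⟩, h⟩ := hsurj w
  exact ⟨c, d, v, by rw [← h, hT]⟩

lemma mem_range_of_orthogonal {x ν : Mink} {L : E2 →L[ℝ] Mink} (hx : lor x x = -1)
    (hν : lor ν ν = 1) (hνx : lor ν x = 0) (hL : Function.Injective L)
    (hLx : ∀ v, lor (L v) x = 0) (hLν : ∀ v, lor ν (L v) = 0) {w : Mink} (hwx : lor w x = 0)
    (hwν : lor w ν = 0) : ∃ v, L v = w := by
  obtain ⟨c, d, v, rfl⟩ := exists_decomp hx hν hνx hL hLx hLν w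
  rw [lor_add_left, lor_add_left, lor_smul_left, lor_smul_left, hx, hνx, hLx] at hwx
  rw [lor_add_left, lor_add_left, lor_smul_left, lor_smul_left, lor_comm x ν, hνx, hν,
    lor_comm, hLν] at hwν
  have hc : c = 0 := by linarith
  have hd : d = 0 := by linarith
  exact ⟨v, by simp [hc, hd]⟩

end Lorentz
end Hyp3

namespace Hyp3
open Set Filter Topology

/-! ### Gradient trajectories of a horospherical height function -/

/-- A surface in hyperbolic space whose principal curvatures lie in `[-1, 1]`, in terms that need
no smooth structure: a continuous map `x` into the hyperboloid with a unit normal `ν`, defined up to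
sign (so `ν` itself need not be continuous), such that the distance of nearby points to the tangent
plane is at most that of a surface with principal curvatures in `[-1, 1]`. -/
structure CurvSurface (X : Type*) [TopologicalSpace X] where
  /-- the position -/
  x : X → Mink
  /-- the unit normal, up to sign -/
  ν : X → Mink
  continuous_x : Continuous x
  mem : ∀ a, x a ∈ hyperboloid
  unit : ∀ a, lor (ν a) (ν a) = 1
  orth : ∀ a, lor (ν a) (x a) = 0
  continuous_sq : ∀ w, Continuous fun a => lor (ν a) w ^ 2
  two_point : ∀ y, ∀ ε > 0, ∀ᶠ q : X × X in 𝓝 (y, y),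
    |lor (x q.2 - x q.1) (ν q.1)| ≤ (1 + ε) / 2 * chord (x q.1) (x q.2)

/-- A future-directed null vector; it stands for a point at infinity with a choice of horosphere. -/
structure IsNull (ξ : Mink) : Prop where
  null : lor ξ ξ = 0
  pos : 0 < ξ.2

namespace CurvSurface

variable {X : Type*} [TopologicalSpace X] (S : CurvSurface X) (ξ : Mink)

/-- The exponential of the Busemann function of the null vector `ξ`. -/
noncomputable def u (a : X) : ℝ := -lor (S.x a) ξ

/-- The normal component of `-ξ`. -/
noncomputable def n (a : X) : ℝ := -lor (S.ν a) ξ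

/-- The gradient of `u` along the surface, the tangential part of `-ξ`. -/
noncomputable def grad (a : X) : Mink := -ξ + S.u ξ a • S.x a - S.n ξ a • S.ν a

/-- The squared length of the gradient of `u`. -/
noncomputable def gsq (a : X) : ℝ := S.u ξ a ^ 2 - S.n ξ a ^ 2

variable {S ξ}

lemma continuous_u : Continuous (S.u ξ) := (S.continuous_x.lor continuous_const).neg

lemma continuous_gsq : Continuous (S.gsq ξ) := by
  have h := S.continuous_sq ξ
  have h2 := continuous_u (S := S) (ξ := ξ)
  have : S.gsq ξ = fun a => S.u ξ a ^ 2 - lor (S.ν a) ξ ^ 2 := by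
    funext a; simp only [gsq, n, neg_sq]
  rw [this]
  exact (h2.pow 2).sub h

lemma u_pos (hξ : IsNull ξ) (a : X) : 0 < S.u ξ a :=
  neg_pos.2 (lor_neg_of_null (S.mem a) hξ.null hξ.pos)

lemma lor_x_null (a : X) : lor (S.x a) ξ = -S.u ξ a := (neg_neg _).symm

lemma lor_ν_null (a : X) : lor (S.ν a) ξ = -S.n ξ a := (neg_neg _).symm

lemma lor_grad_left (a : X) (w : Mink) : lor (S.grad ξ a) w =
    -lor ξ w + S.u ξ a * lor (S.x a) w - S.n ξ a * lor (S.ν a) w := by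
  simp only [grad, lor_sub_left, lor_add_left, lor_neg_left, lor_smul_left]

lemma lor_grad_x (a : X) : lor (S.grad ξ a) (S.x a) = 0 := by
  rw [lor_grad_left, (S.mem a).1, S.orth a, lor_comm ξ, lor_x_null]; ring

lemma lor_grad_ν (a : X) : lor (S.grad ξ a) (S.ν a) = 0 := by
  rw [lor_grad_left, S.unit a, lor_comm (S.x a) (S.ν a), S.orth a, lor_comm ξ (S.ν a),
    lor_ν_null]
  ring

lemma lor_grad_null (hξ : IsNull ξ) (a : X) : lor (S.grad ξ a) ξ = -S.gsq ξ a := by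
  rw [lor_grad_left, hξ.null, lor_x_null, lor_ν_null, gsq]; ring

lemma lor_grad_grad (hξ : IsNull ξ) (a : X) : lor (S.grad ξ a) (S.grad ξ a) = S.gsq ξ a := by
  rw [lor_grad_left, lor_comm ξ, lor_grad_null hξ, lor_comm (S.x a), lor_grad_x,
    lor_comm (S.ν a), lor_grad_ν]
  ring

lemma gsq_nonneg (hξ : IsNull ξ) (a : X) : 0 ≤ S.gsq ξ a := by
  rw [← lor_grad_grad hξ]; exact lor_self_nonneg (S.mem a) (lor_grad_x a)

lemma abs_n_le (hξ : IsNull ξ) (a : X) : |S.n ξ a| ≤ S.u ξ a :=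
  abs_le_of_sq_le_sq (sub_nonneg.1 (gsq_nonneg hξ a)) (u_pos hξ a).le

lemma sqrt_gsq_le (hξ : IsNull ξ) (a : X) : √(S.gsq ξ a) ≤ S.u ξ a := by
  rw [Real.sqrt_le_left (u_pos hξ a).le, gsq]; nlinarith [sq_nonneg (S.n ξ a)]

/-- The exact expansion of `u` between two points of the surface. -/
lemma lor_grad_sub (a b : X) : lor (S.grad ξ a) (S.x b - S.x a) =
    S.u ξ b - S.u ξ a - S.u ξ a * chord (S.x a) (S.x b) / 2
      - S.n ξ a * lor (S.x b - S.x a) (S.ν a) := by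
  rw [lor_grad_left, chord_eq (S.mem a) (S.mem b)]
  simp only [lor_sub_left, lor_sub_right, (S.mem a).1, lor_comm ξ, lor_x_null, lor_comm (S.ν a)]
  ring

/-- Almost convexity of `u`: the first-order expansion at `a` is a lower bound at `b`, up to
`ε` times the squared distance. -/
lemma lor_grad_sub_le (hξ : IsNull ξ) {a b : X} {ε : ℝ}
    (h : |lor (S.x b - S.x a) (S.ν a)| ≤ (1 + ε) / 2 * chord (S.x a) (S.x b)) :
    lor (S.grad ξ a) (S.x b - S.x a) ≤
      S.u ξ b - S.u ξ a + ε / 2 * S.u ξ a * chord (S.x a) (S.x b) := by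
  rw [lor_grad_sub]
  have h1 : |S.n ξ a * lor (S.x b - S.x a) (S.ν a)| ≤
      S.u ξ a * ((1 + ε) / 2 * chord (S.x a) (S.x b)) := by
    rw [abs_mul]
    exact mul_le_mul (abs_n_le hξ a) h (abs_nonneg _) (u_pos hξ a).le
  have h2 := neg_le_of_abs_le h1
  nlinarith

variable (S ξ) in
/-- A trajectory of `-grad u` on `[0, T]`, with right derivatives. The last condition is the
derivative of `gsq` along a trajectory, estimated by the curvature bound. -/
structure IsTraj (T : ℝ) (c : ℝ → X) : Prop where
  cont : ContinuousOn c (Icc 0 T)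
  deriv : ∀ t ∈ Ico 0 T, HasDerivWithinAt (fun s => S.x (c s)) (-S.grad ξ (c t)) (Ici t) t
  gderiv : ∀ t ∈ Ico 0 T, ∃ g' ≤ -2 * S.gsq ξ (c t) * (S.u ξ (c t) - |S.n ξ (c t)|),
    HasDerivWithinAt (fun s => S.gsq ξ (c s)) g' (Ici t) t

namespace IsTraj

variable {T T₁ T₂ : ℝ} {c c₁ c₂ : ℝ → X}

lemma restrict (h : S.IsTraj ξ T c) {s : ℝ} (hs : s ≤ T) : S.IsTraj ξ s c where
  cont := h.cont.mono (Icc_subset_Icc_right hs)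
  deriv t ht := h.deriv t ⟨ht.1, ht.2.trans_le hs⟩
  gderiv t ht := h.gderiv t ⟨ht.1, ht.2.trans_le hs⟩

lemma _root_.HasDerivWithinAt.comp_add_const_Ici {E : Type*} [NormedAddCommGroup E]
    [NormedSpace ℝ E] {f : ℝ → E} {f' : E} {t s : ℝ}
    (h : HasDerivWithinAt f f' (Ici (t + s)) (t + s)) :
    HasDerivWithinAt (fun r => f (r + s)) f' (Ici t) t := by
  have h1 : HasDerivWithinAt (fun r : ℝ => r + s) 1 (Ici t) t :=
    ((hasDerivAt_id t).add_const s).hasDerivWithinAt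
  have := h.scomp t h1 (fun r hr => by simpa using hr)
  simpa [Function.comp_def] using this

lemma shift (h : S.IsTraj ξ T c) {s : ℝ} (hs : 0 ≤ s) :
    S.IsTraj ξ (T - s) (fun t => c (t + s)) where
  cont := h.cont.comp (by fun_prop) (fun t ht => ⟨by linarith [ht.1], by linarith [ht.2]⟩)
  deriv t ht := (h.deriv (t + s) ⟨by linarith [ht.1], by linarith [ht.2]⟩).comp_add_const_Ici
  gderiv t ht := by
    obtain ⟨g', h1, h2⟩ := h.gderiv (t + s) ⟨by linarith [ht.1], by linarith [ht.2]⟩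
    exact ⟨g', h1, h2.comp_add_const_Ici⟩

omit [TopologicalSpace X] in
lemma congr_right {E : Type*} [NormedAddCommGroup E] [NormedSpace ℝ E] {F : X → E} {f' : E}
    {t : ℝ} (h : HasDerivWithinAt (fun s => F (c s)) f' (Ici t) t)
    (he : ∀ᶠ s in 𝓝[≥] t, c₁ s = c s) : HasDerivWithinAt (fun s => F (c₁ s)) f' (Ici t) t :=
  h.congr_of_eventuallyEq (he.mono fun s hs => by simp only [hs])
    (by rw [he.self_of_nhdsWithin self_mem_Ici])

lemma of_eventuallyEq (hc : ContinuousOn c (Icc 0 T))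
    (h : ∀ t ∈ Ico 0 T, ∃ T' c', ∃ s ∈ Ico 0 T', S.IsTraj ξ T' c' ∧
      ∀ᶠ r in 𝓝[≥] t, c r = c' (r + (s - t))) : S.IsTraj ξ T c where
  cont := hc
  deriv t ht := by
    obtain ⟨T', c', s, hs, hc', he⟩ := h t ht
    have h0 : c t = c' s := by simpa using he.self_of_nhdsWithin self_mem_Ici
    have h1 := hc'.deriv s hs
    rw [← h0] at h1
    refine congr_right (F := S.x) (c := fun r => c' (r + (s - t))) ?_ he
    refine HasDerivWithinAt.comp_add_const_Ici (f := fun r => S.x (c' r)) ?_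
    simpa using h1
  gderiv t ht := by
    obtain ⟨T', c', s, hs, hc', he⟩ := h t ht
    have h0 : c t = c' s := by simpa using he.self_of_nhdsWithin self_mem_Ici
    obtain ⟨g', hg, h1⟩ := hc'.gderiv s hs
    rw [← h0] at hg
    refine ⟨g', hg, congr_right (F := S.gsq ξ) (c := fun r => c' (r + (s - t))) ?_ he⟩
    refine HasDerivWithinAt.comp_add_const_Ici (f := fun r => S.gsq ξ (c' r)) ?_
    simpa using h1

/-- Concatenation of trajectories. -/
lemma append (h₁ : S.IsTraj ξ T₁ c₁) (h₂ : S.IsTraj ξ T₂ c₂) (hT₁ : 0 ≤ T₁) (hT₂ : 0 ≤ T₂)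
    (h : c₂ 0 = c₁ T₁) :
    S.IsTraj ξ (T₁ + T₂) (fun t => if t ≤ T₁ then c₁ t else c₂ (t - T₁)) := by
  have h2 : ∀ r, T₁ ≤ r → (if r ≤ T₁ then c₁ r else c₂ (r - T₁)) = c₂ (r - T₁) := fun r hr => by
    rcases hr.eq_or_lt with rfl | hr
    · simp [h]
    · simp [not_le.2 hr]
  refine of_eventuallyEq ?_ fun t ht => ?_
  · rw [← Icc_union_Icc_eq_Icc hT₁ (le_add_of_nonneg_right hT₂)]
    refine ContinuousOn.union_of_isClosed ?_ ?_ isClosed_Icc isClosed_Icc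
    · exact h₁.cont.congr fun r hr => by simp [hr.2]
    · refine ContinuousOn.congr (f := fun r => c₂ (r - T₁)) ?_ fun r hr => h2 r hr.1
      exact h₂.cont.comp (by fun_prop) fun r hr => ⟨by linarith [hr.1], by linarith [hr.2]⟩
  · rcases lt_or_ge t T₁ with h3 | h3
    · refine ⟨T₁, c₁, t, ⟨ht.1, h3⟩, h₁, ?_⟩
      filter_upwards [mem_nhdsWithin_of_mem_nhds (Iio_mem_nhds h3)] with r hr
      simp [(mem_Iio.1 hr).le]
    · refine ⟨T₂, c₂, t - T₁, ⟨by linarith, by linarith [ht.2]⟩, h₂, ?_⟩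
      filter_upwards [self_mem_nhdsWithin] with r hr
      rw [h2 r (h3.trans hr)]
      congr 1; ring

lemma continuousOn_x (h : S.IsTraj ξ T c) : ContinuousOn (fun t => S.x (c t)) (Icc 0 T) :=
  S.continuous_x.comp_continuousOn h.cont

lemma deriv_u (hξ : IsNull ξ) (h : S.IsTraj ξ T c) {t : ℝ} (ht : t ∈ Ico 0 T) :
    HasDerivWithinAt (fun s => S.u ξ (c s)) (-S.gsq ξ (c t)) (Ici t) t := by
  have h1 := ((h.deriv t ht).lor (hasDerivWithinAt_const t _ ξ)).neg
  exact h1.congr_deriv (by rw [lor_zero_right, lor_neg_left, lor_grad_null hξ]; ring)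

lemma u_antitone (hξ : IsNull ξ) (h : S.IsTraj ξ T c) {t : ℝ} (ht : t ∈ Icc 0 T) :
    S.u ξ (c t) ≤ S.u ξ (c 0) :=
  image_le_of_deriv_right_le_deriv_boundary (f := fun s => S.u ξ (c s))
    (B := fun _ => S.u ξ (c 0)) (B' := fun _ => 0)
    (continuous_u.comp_continuousOn h.cont) (fun _ ht => h.deriv_u hξ ht) le_rfl
    continuousOn_const (fun t _ => hasDerivWithinAt_const t _ _)
    (fun _ _ => neg_nonpos.2 (gsq_nonneg hξ _)) ht

lemma deriv_chord_const (h : S.IsTraj ξ T c) {t : ℝ} (ht : t ∈ Ico 0 T) {y : Mink} :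
    HasDerivWithinAt (fun s => chord (S.x (c s)) y) (2 * lor (S.grad ξ (c t)) y) (Ici t) t := by
  have h1 := (h.deriv t ht).sub_const y
  refine (h1.lor h1).congr_deriv ?_
  rw [lor_comm, ← two_mul, lor_neg_left, lor_sub_right, lor_grad_x]; ring

/-- A trajectory moves at speed at most `U` where `u ≤ U`. -/
lemma chord_le (hξ : IsNull ξ) (h : S.IsTraj ξ T c) {U : ℝ} (hU : 0 < U) (hu : S.u ξ (c 0) ≤ U)
    {y : Mink} (hy : y ∈ hyperboloid) (hb : chord (S.x (c 0)) y + 7 * U * T ≤ 4) {t : ℝ}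
    (ht : t ∈ Icc 0 T) : chord (S.x (c t)) y ≤ chord (S.x (c 0)) y + 7 * U * t := by
  -- The constant `7` is at least `2 √(F + F² / 4)` as long as the distance `F` is at most `4`.
  refine image_le_of_deriv_right_lt_deriv_boundary (f := fun s => chord (S.x (c s)) y)
    (B := fun s => chord (S.x (c 0)) y + 7 * U * s) (B' := fun _ => 7 * U) ?_
    (fun s hs => h.deriv_chord_const hs) (by simp)
    (fun s => ?_) (fun s hs hB => ?_) ht
  · have := h.continuousOn_x
    exact ((this.sub continuousOn_const).lor (this.sub continuousOn_const))
  · simpa using ((hasDerivAt_id s).const_mul (7 * U)).const_add (chord (S.x (c 0)) y)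
  · have h4 : chord (S.x (c s)) y ≤ 4 := by
      rw [hB]
      nlinarith [hs.2, mul_pos (show (0 : ℝ) < 7 by norm_num) hU]
    have h0 := chord_nonneg (S.mem (c s)) hy
    have h1 := (le_abs_self _).trans (abs_lor_le_chord (S.mem (c s)) hy (lor_grad_x (ξ := ξ) (c s)))
    have h5 : √(chord (S.x (c s)) y + chord (S.x (c s)) y ^ 2 / 4) < 7 / 2 := by
      rw [Real.sqrt_lt' (by norm_num)]; nlinarith
    have h6 : √(lor (S.grad ξ (c s)) (S.grad ξ (c s))) ≤ U := by
      rw [lor_grad_grad hξ]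
      exact (sqrt_gsq_le hξ _).trans ((h.u_antitone hξ ⟨hs.1, hs.2.le⟩).trans hu)
    have h7 := mul_le_mul_of_nonneg_right h6 (Real.sqrt_nonneg
      (chord (S.x (c s)) y + chord (S.x (c s)) y ^ 2 / 4))
    nlinarith

end IsTraj

end CurvSurface
end Hyp3

namespace Hyp3
open Set Filter Topology

/-! ### Contraction of nearby trajectories -/

namespace CurvSurface

variable {X : Type*} [TopologicalSpace X] {S : CurvSurface X} {ξ : Mink}

lemma _root_.IsPreconnected.subset_interior {K C : Set X} (hK : IsPreconnected K)
    (h : (K ∩ interior C).Nonempty) (hf : ∀ k ∈ K, k ∉ frontier C) : K ⊆ interior C := by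
  refine hK.subset_left_of_subset_union isOpen_interior isClosed_closure.isOpen_compl
    (disjoint_compl_right.mono_left (interior_subset.trans subset_closure)) (fun k hk => ?_) h
  by_contra hc
  simp only [mem_union, mem_compl_iff, not_or, not_not] at hc
  exact hf k hk ⟨hc.2, hc.1⟩

variable (S) in
/-- A compact embedded neighbourhood of `y` whose boundary is at chordal squared distance at least
`ρ` from `y`. -/
structure IsPatch (ρ : ℝ) (y : X) (C : Set X) : Prop where
  compact : IsCompact C
  mem_nhds : C ∈ 𝓝 y
  inj : InjOn S.x C
  frontier : ∀ k ∈ frontier C, ρ ≤ chord (S.x y) (S.x k)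

namespace IsPatch

variable {ρ : ℝ} {y : X} {C : Set X}

lemma mem_interior (hC : S.IsPatch ρ y C) : y ∈ interior C :=
  mem_interior_iff_mem_nhds.2 hC.mem_nhds

lemma subset (hC : S.IsPatch ρ y C) {K : Set X} (hK : IsPreconnected K)
    (h : (K ∩ interior C).Nonempty) (hlt : ∀ k ∈ K, chord (S.x k) (S.x y) < ρ) : K ⊆ interior C :=
  hK.subset_interior h fun k hk hf =>
    absurd (hlt k hk) (not_lt.2 (by rw [chord_comm]; exact hC.frontier k hf))

/-- On a patch, points at small chordal distance are close to each other in the surface. -/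
lemma exists_chord_lt (hC : S.IsPatch ρ y C) {P : X × X → Prop}
    (hP : ∀ a ∈ C, ∀ᶠ q in 𝓝 (a, a), P q) :
    ∃ η > 0, ∀ a ∈ C, ∀ b ∈ C, chord (S.x a) (S.x b) < η → P (a, b) := by
  let K : Set (X × X) := (C ×ˢ C) \ interior {q | P q}
  have hK : IsCompact K := (hC.compact.prod hC.compact).diff isOpen_interior
  have hcont : Continuous fun q : X × X => chord (S.x q.1) (S.x q.2) :=
    (S.continuous_x.comp continuous_fst).chord (S.continuous_x.comp continuous_snd)
  have hin : ∀ {a b}, a ∈ C → b ∈ C → ¬ P (a, b) → (a, b) ∈ K := fun ha hb h =>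
    ⟨⟨ha, hb⟩, fun h' => h (interior_subset h')⟩
  rcases K.eq_empty_or_nonempty with h | h
  · refine ⟨1, one_pos, fun a ha b hb _ => ?_⟩
    by_contra hc
    have := hin ha hb hc
    rw [h] at this
    exact this
  · obtain ⟨⟨a, b⟩, hab, hmin⟩ := hK.exists_isMinOn h hcont.continuousOn
    refine ⟨chord (S.x a) (S.x b), ?_, fun a' ha' b' hb' hlt => ?_⟩
    · refine lt_of_le_of_ne (chord_nonneg (S.mem a) (S.mem b)) fun h0 => ?_
      have hx := hC.inj hab.1.1 hab.1.2 (eq_of_chord_eq_zero (S.mem a) (S.mem b) h0.symm)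
      have hx : a = b := hx
      subst hx
      exact hab.2 (mem_interior_iff_mem_nhds.2 (hP a hab.1.1))
    · by_contra hc
      have := hmin (hin ha' hb' hc)
      exact absurd hlt (not_lt.2 this)

lemma exists_mem_of_chord_lt [T1Space X] (hC : S.IsPatch ρ y C) {a : X} {W : Set X} (hW : W ∈ 𝓝 a) :
    ∃ η > 0, a ∈ C → ∀ b ∈ C, chord (S.x a) (S.x b) < η → b ∈ W := by
  obtain ⟨η, hη, h⟩ := hC.exists_chord_lt (P := fun q => q.1 = a → q.2 ∈ W) fun b _ => by
    by_cases hb : b = a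
    · subst hb
      filter_upwards [prod_mem_nhds univ_mem hW] with q hq _ using hq.2
    · filter_upwards [prod_mem_nhds (isOpen_ne.mem_nhds hb) univ_mem] with q hq h0
      exact absurd h0 hq.1
  exact ⟨η, hη, fun ha b hb hlt => h a ha b hb hlt rfl⟩

end IsPatch

namespace IsTraj

variable {T ρ U ε : ℝ} {c c' : ℝ → X}

lemma mapsTo_patch (hξ : IsNull ξ) (h : S.IsTraj ξ T c) (hU : 0 < U) (hu : S.u ξ (c 0) ≤ U)
    {y : X} {C : Set X} (hC : S.IsPatch ρ y C) (h0 : c 0 ∈ interior C)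
    (h4 : chord (S.x (c 0)) (S.x y) + 7 * U * T ≤ 4)
    (hρ : chord (S.x (c 0)) (S.x y) + 7 * U * T < ρ) {t : ℝ} (ht : t ∈ Icc 0 T) :
    c t ∈ interior C := by
  have h0T : (0 : ℝ) ∈ Icc 0 T := ⟨le_rfl, ht.1.trans ht.2⟩
  refine hC.subset (K := c '' Icc 0 T) (isPreconnected_Icc.image c h.cont)
    ⟨c 0, mem_image_of_mem c h0T, h0⟩ ?_ (mem_image_of_mem c ht)
  rintro _ ⟨s, hs, rfl⟩
  refine (h.chord_le hξ hU hu (S.mem y) h4 hs).trans_lt (lt_of_le_of_lt ?_ hρ)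
  gcongr; exact hs.2

lemma deriv_chord (h : S.IsTraj ξ T c) (h' : S.IsTraj ξ T c') {t : ℝ} (ht : t ∈ Ico 0 T) :
    HasDerivWithinAt (fun s => chord (S.x (c s)) (S.x (c' s)))
      (2 * lor (S.grad ξ (c t)) (S.x (c' t) - S.x (c t)) +
        2 * lor (S.grad ξ (c' t)) (S.x (c t) - S.x (c' t))) (Ici t) t := by
  have h1 := (h.deriv t ht).sub (h'.deriv t ht)
  refine (h1.lor h1).congr_deriv ?_
  simp only [Pi.sub_apply, lor_sub_left, lor_sub_right, lor_neg_left, lor_neg_right,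
    lor_comm (S.x (c t)), lor_comm (S.x (c' t))]
  ring

/-- The distance of two trajectories grows at most at the exponential rate `3 ε U` as long as the
two-point estimate with error `ε` applies to them. -/
lemma chord_le_exp (hξ : IsNull ξ) (hε : 0 < ε) (h : S.IsTraj ξ T c) (h' : S.IsTraj ξ T c')
    {U η : ℝ} (hu : S.u ξ (c 0) ≤ U) (hu' : S.u ξ (c' 0) ≤ U)
    (hlt : chord (S.x (c 0)) (S.x (c' 0)) * Real.exp (3 * ε * U * T) < η)
    (hest : ∀ t ∈ Icc 0 T, chord (S.x (c t)) (S.x (c' t)) < η →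
      |lor (S.x (c' t) - S.x (c t)) (S.ν (c t))| ≤
        (1 + ε) / 2 * chord (S.x (c t)) (S.x (c' t)) ∧
      |lor (S.x (c t) - S.x (c' t)) (S.ν (c' t))| ≤
        (1 + ε) / 2 * chord (S.x (c' t)) (S.x (c t))) {t : ℝ} (ht : t ∈ Icc 0 T) :
    chord (S.x (c t)) (S.x (c' t)) ≤
      chord (S.x (c 0)) (S.x (c' 0)) * Real.exp (3 * ε * U * t) := by
  have hU : 0 < U := (u_pos hξ _).trans_le hu
  set F₀ := chord (S.x (c 0)) (S.x (c' 0)) with hF₀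
  have hF₀0 : 0 ≤ F₀ := chord_nonneg (S.mem _) (S.mem _)
  -- The barrier `K * exp (3 ε U s)` with `K > F₀` is crossed with a strict inequality of slopes.
  have main : ∀ K > F₀, K * Real.exp (3 * ε * U * T) < η →
      chord (S.x (c t)) (S.x (c' t)) ≤ K * Real.exp (3 * ε * U * t) := by
    intro K hK hKη
    have hK0 : 0 < K := hF₀0.trans_lt hK
    refine image_le_of_deriv_right_lt_deriv_boundary
      (f := fun s => chord (S.x (c s)) (S.x (c' s)))
      (B := fun s => K * Real.exp (3 * ε * U * s))
      (B' := fun s => K * (Real.exp (3 * ε * U * s) * (3 * ε * U))) ?_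
      (fun s hs => h.deriv_chord h' hs) (by simpa using hK.le) (fun s => ?_) (fun s hs hB => ?_) ht
    · exact (h.continuousOn_x.sub h'.continuousOn_x).lor (h.continuousOn_x.sub h'.continuousOn_x)
    · have := ((hasDerivAt_id s).const_mul (3 * ε * U)).exp.const_mul K
      simpa using this
    · have hs' : s ∈ Icc 0 T := ⟨hs.1, hs.2.le⟩
      have hpos : 0 < chord (S.x (c s)) (S.x (c' s)) := by rw [hB]; positivity
      have hη' : chord (S.x (c s)) (S.x (c' s)) < η := by
        rw [hB]
        refine lt_of_le_of_lt ?_ hKη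
        gcongr; exact hs'.2
      obtain ⟨e1, e2⟩ := hest s hs' hη'
      have g1 := lor_grad_sub_le hξ e1
      have g2 := lor_grad_sub_le hξ e2
      rw [chord_comm (S.x (c' s))] at g2
      have u1 := (h.u_antitone hξ hs').trans hu
      have u2 := (h'.u_antitone hξ hs').trans hu'
      rw [← mul_assoc, ← hB]
      have h5 : ε * (S.u ξ (c s) + S.u ξ (c' s)) * chord (S.x (c s)) (S.x (c' s)) ≤
          ε * (U + U) * chord (S.x (c s)) (S.x (c' s)) := by gcongr
      have h6 : 0 < ε * U * chord (S.x (c s)) (S.x (c' s)) := by positivity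
      nlinarith
  have hc1 : Tendsto (fun K : ℝ => K * Real.exp (3 * ε * U * T)) (𝓝[>] F₀)
      (𝓝 (F₀ * Real.exp (3 * ε * U * T))) :=
    tendsto_nhdsWithin_of_tendsto_nhds (by fun_prop : Continuous fun K : ℝ =>
      K * Real.exp (3 * ε * U * T)).continuousAt
  have hc2 : Tendsto (fun K : ℝ => K * Real.exp (3 * ε * U * t)) (𝓝[>] F₀)
      (𝓝 (F₀ * Real.exp (3 * ε * U * t))) :=
    tendsto_nhdsWithin_of_tendsto_nhds (by fun_prop : Continuous fun K : ℝ =>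
      K * Real.exp (3 * ε * U * t)).continuousAt
  refine ge_of_tendsto hc2 ?_
  filter_upwards [self_mem_nhdsWithin, hc1.eventually_lt_const hlt] with K hK hK2
  exact main K hK hK2

/-- Over a short time, trajectories starting near the start of `c` end near its end, and the
distance hardly grows. -/
lemma contraction_step [T1Space X] (hP : ∀ y, ∃ C, S.IsPatch ρ y C) (hξ : IsNull ξ)
    (hU : 0 < U) (hε : 0 < ε) (hT : 0 ≤ T) (hT4 : 7 * U * T < min ρ 4) (h : S.IsTraj ξ T c)
    (hu : S.u ξ (c 0) ≤ U) {W : Set X} (hW : W ∈ 𝓝 (c T)) :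
    ∀ᶠ y' in 𝓝 (c 0), ∀ c', S.IsTraj ξ T c' → c' 0 = y' → S.u ξ y' ≤ U → c' T ∈ W ∧
      chord (S.x (c T)) (S.x (c' T)) ≤
        chord (S.x (c 0)) (S.x y') * Real.exp (3 * ε * U * T) := by
  obtain ⟨C, hC⟩ := hP (c 0)
  obtain ⟨η, hη, hest⟩ := hC.exists_chord_lt fun a _ => S.two_point a ε hε
  obtain ⟨η', hη', hest'⟩ := hC.exists_mem_of_chord_lt hW
  have hchord : Continuous fun y => chord (S.x (c 0)) (S.x y) :=
    continuous_const.chord S.continuous_x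
  have hchord0 : Tendsto (fun y => chord (S.x (c 0)) (S.x y)) (𝓝 (c 0)) (𝓝 0) := by
    have := hchord.tendsto (c 0)
    rwa [chord_self] at this
  have hexp : Tendsto (fun y => chord (S.x (c 0)) (S.x y) * Real.exp (3 * ε * U * T)) (𝓝 (c 0))
      (𝓝 0) := by simpa using hchord0.mul_const (Real.exp (3 * ε * U * T))
  have hpos : 0 < min ρ 4 - 7 * U * T := sub_pos.2 hT4
  filter_upwards [interior_mem_nhds.2 hC.mem_nhds, hexp.eventually_lt_const hη,
    hexp.eventually_lt_const hη', hchord0.eventually_lt_const hpos]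
    with y' h1 h2 h3 h4 c' hc' h0 hu'
  subst h0
  have hm4 : chord (S.x (c' 0)) (S.x (c 0)) + 7 * U * T ≤ 4 := by
    rw [chord_comm]; linarith [min_le_right ρ 4]
  have hmρ : chord (S.x (c' 0)) (S.x (c 0)) + 7 * U * T < ρ := by
    rw [chord_comm]; linarith [min_le_left ρ 4]
  have hm : ∀ t ∈ Icc 0 T, c t ∈ C ∧ c' t ∈ C := fun t ht =>
    ⟨interior_subset (h.mapsTo_patch hξ hU hu hC hC.mem_interior
      (by rw [chord_self]; linarith [min_le_right ρ 4])
      (by rw [chord_self]; linarith [min_le_left ρ 4]) ht),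
    interior_subset (hc'.mapsTo_patch hξ hU hu' hC h1 hm4 hmρ ht)⟩
  have hTT : T ∈ Icc 0 T := ⟨hT, le_rfl⟩
  have key := h.chord_le_exp hξ hε hc' hu hu' h2 (fun t ht hlt =>
    ⟨hest _ (hm t ht).1 _ (hm t ht).2 hlt,
      hest _ (hm t ht).2 _ (hm t ht).1 (by rwa [chord_comm])⟩) hTT
  exact ⟨hest' (hm T hTT).1 _ (hm T hTT).2 (key.trans_lt h3), key⟩

/-- The flow of `-grad u` depends continuously on the initial point and hardly expands distances
of nearby points. -/
lemma contraction [T1Space X] (hρ : 0 < ρ) (hP : ∀ y, ∃ C, S.IsPatch ρ y C) (hξ : IsNull ξ)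
    (hε : 0 < ε) (hT : 0 ≤ T) (h : S.IsTraj ξ T c) (hu : S.u ξ (c 0) ≤ U) {W : Set X}
    (hW : W ∈ 𝓝 (c T)) :
    ∀ᶠ y' in 𝓝 (c 0), ∀ c', S.IsTraj ξ T c' → c' 0 = y' → S.u ξ y' ≤ U → c' T ∈ W ∧
      chord (S.x (c T)) (S.x (c' T)) ≤
        chord (S.x (c 0)) (S.x y') * Real.exp (3 * ε * U * T) := by
  have hU : 0 < U := (u_pos hξ _).trans_le hu
  obtain ⟨τ, hτ, hτ4⟩ : ∃ τ > 0, 7 * U * τ < min ρ 4 := by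
    have h4 : 0 < min ρ 4 := lt_min hρ (by norm_num)
    refine ⟨min ρ 4 / (14 * U), by positivity, ?_⟩
    rw [show 7 * U * (min ρ 4 / (14 * U)) = min ρ 4 / 2 by field_simp; ring]
    linarith
  obtain ⟨N, hN⟩ : ∃ N : ℕ, T ≤ N * τ := by
    obtain ⟨N, hN⟩ := exists_nat_ge (T / τ)
    exact ⟨N, (div_le_iff₀ hτ).1 hN⟩
  induction N generalizing T W with
  | zero =>
    have hT0 : T = 0 := le_antisymm (by simpa using hN) hT
    subst hT0
    filter_upwards [hW] with y' hy' c' _ h0 _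
    subst h0
    exact ⟨hy', by simp⟩
  | succ N ih =>
    have hN1 : (0 : ℝ) < N + 1 := by positivity
    set s := T / (N + 1) with hs
    have hs0 : 0 ≤ s := by positivity
    have hTs : T = (N + 1) * s := by rw [hs]; field_simp
    have hsτ : s ≤ τ := by
      rw [hs, div_le_iff₀ hN1]; push_cast at hN; linarith
    have hsT : 0 ≤ T - s := by rw [hTs]; nlinarith [(Nat.cast_nonneg N : (0 : ℝ) ≤ N)]
    have hsub : T - s ≤ T := by linarith
    have h1 := h.shift hsT
    have e1 : T - (T - s) = s := by ring
    rw [e1] at h1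
    have hend : s + (T - s) = T := by ring
    have hu1 : S.u ξ (c (T - s)) ≤ U := (h.u_antitone hξ ⟨hsT, hsub⟩).trans hu
    have step := contraction_step (T := s) hP hξ hU hε hs0
      ((by gcongr : 7 * U * s ≤ 7 * U * τ).trans_lt hτ4) h1 (by simpa using hu1) (W := W)
      (by simpa [hend] using hW)
    simp only [zero_add, hend] at step
    have hNT : T - s ≤ N * τ := by
      rw [hTs]; nlinarith [(Nat.cast_nonneg N : (0 : ℝ) ≤ N)]
    filter_upwards [ih hsT (h.restrict hsub) step hNT] with y' hy' c' hc' h0 hu'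
    obtain ⟨g1, g2⟩ := hy' c' (hc'.restrict hsub) h0 hu'
    have h3 := hc'.shift hsT
    rw [e1] at h3
    have hu3 : S.u ξ (c' (T - s)) ≤ U :=
      (hc'.u_antitone hξ ⟨hsT, hsub⟩).trans (by rw [h0]; exact hu')
    obtain ⟨g3, g4⟩ := g1 _ h3 (by simp) hu3
    simp only [hend] at g3 g4
    refine ⟨g3, g4.trans ?_⟩
    have hE : Real.exp (3 * ε * U * T) =
        Real.exp (3 * ε * U * (T - s)) * Real.exp (3 * ε * U * s) := by
      rw [← Real.exp_add]; congr 1; ring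
    rw [hE, ← mul_assoc]
    gcongr

end IsTraj
end CurvSurface
end Hyp3

namespace Hyp3
open Set Filter Topology

/-! ### The basin of attraction of a strictly curved point -/

namespace CurvSurface

variable {X : Type*} [TopologicalSpace X] {S : CurvSurface X} {ξ : Mink}

variable (S) in
/-- Completeness of a surface, in the form in which it is used: embedded patches of uniform size,
gradient trajectories that exist for a uniform time where `u` is bounded, and short paths between
nearby points. -/
structure IsComplete : Prop where
  patch : ∃ ρ > 0, ∀ y, ∃ C, S.IsPatch ρ y C
  flow : ∀ ξ, IsNull ξ → ∀ U > 0, ∃ τ > 0, ∀ y, S.u ξ y ≤ U → ∃ c, S.IsTraj ξ τ c ∧ c 0 = y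
  segment : ∀ y, ∀ L > 0, ∃ O ∈ 𝓝 y, ∀ a ∈ O, ∀ b ∈ O, ∃ σ : ℝ → X, ContinuousOn σ (Icc 0 1) ∧
    σ 0 = a ∧ σ 1 = b ∧
    ∀ s ∈ Icc (0 : ℝ) 1, ∀ s' ∈ Icc (0 : ℝ) 1, chord (S.x (σ s)) (S.x (σ s')) ≤ L ^ 2 * (s' - s) ^ 2

lemma IsComplete.exists_traj (hS : S.IsComplete) (hξ : IsNull ξ) (y : X) (T : ℝ) :
    ∃ c, S.IsTraj ξ T c ∧ c 0 = y := by
  obtain ⟨τ, hτ, h⟩ := hS.flow ξ hξ (S.u ξ y) (u_pos hξ y)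
  have main : ∀ N : ℕ, ∃ c, S.IsTraj ξ (N * τ) c ∧ c 0 = y := by
    intro N
    induction N with
    | zero =>
      obtain ⟨c, hc, h0⟩ := h y le_rfl
      exact ⟨c, hc.restrict (by simpa using hτ.le), h0⟩
    | succ N ih =>
      obtain ⟨c, hc, h0⟩ := ih
      have hN : 0 ≤ N * τ := by positivity
      have hu := hc.u_antitone hξ ⟨hN, le_rfl⟩
      rw [h0] at hu
      obtain ⟨c₂, hc₂, h2⟩ := h _ hu
      have h3 := hc.append hc₂ hN hτ.le h2
      rw [show N * τ + τ = (N + 1 : ℕ) * τ by push_cast; ring] at h3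
      exact ⟨_, h3, by simpa [hN] using h0⟩
  obtain ⟨N, hN⟩ := exists_nat_ge (T / τ)
  obtain ⟨c, hc, h0⟩ := main N
  exact ⟨c, hc.restrict ((div_le_iff₀ hτ).1 hN), h0⟩

/-- A path that leaves an open set has a first point outside. -/
lemma exists_first_exit {c : ℝ → X} {T : ℝ} (hc : ContinuousOn c (Icc 0 T)) {O : Set X}
    (hO : IsOpen O) (h : ∃ t ∈ Icc 0 T, c t ∉ O) :
    ∃ t ∈ Icc 0 T, c t ∉ O ∧ ∀ s ∈ Ico 0 t, c s ∈ O := by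
  have hcl : IsClosed (Icc 0 T ∩ c ⁻¹' Oᶜ) := hc.preimage_isClosed_of_isClosed isClosed_Icc
    hO.isClosed_compl
  obtain ⟨t, ht⟩ := (isCompact_Icc.of_isClosed_subset hcl inter_subset_left).exists_isLeast
    (by obtain ⟨t, h1, h2⟩ := h; exact ⟨t, h1, h2⟩)
  refine ⟨t, ht.1.1, ht.1.2, fun s hs => ?_⟩
  by_contra hc'
  exact absurd hs.2 (not_lt.2 (ht.2 ⟨⟨hs.1, hs.2.le.trans ht.1.1.2⟩, hc'⟩))

/-- Moving one of two points of the hyperboloid changes their chordal distance in a Lipschitz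
manner. -/
lemma _root_.Hyp3.chord_sub_le {y y' p : Mink} (hy : y ∈ hyperboloid) (hy' : y' ∈ hyperboloid)
    (hp : p ∈ hyperboloid) {d : ℝ} (hd : chord y y' ≤ d) :
    chord y' p - chord y p ≤
      2 * (√(d + d ^ 2 / 4) * √(chord y p + chord y p ^ 2 / 4)) + d * (1 + chord y p / 2) := by
  have h0 := chord_nonneg hy hy'
  have hF := chord_nonneg hy hp
  have e1 : lor (y' - y) y = -chord y y' / 2 := by
    rw [chord_eq hy hy', lor_sub_left, hy.1, lor_comm]; ring
  have e2 : lor (y' - y) (y' - y) = chord y y' := by rw [chord_comm]; rfl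
  set D := chord y y' with hD
  set m := y' - y - (D / 2) • y with hm
  have hmy : lor m y = 0 := by rw [hm, lor_sub_left, lor_smul_left, e1, hy.1]; ring
  have hmm : lor m m = D + D ^ 2 / 4 := by
    rw [hm, lor_sub_left, lor_smul_left, lor_sub_right, lor_smul_right, e2, e1, lor_sub_right,
      lor_smul_right, hy.1, lor_comm y, e1]
    ring
  have h1 := abs_lor_le_chord hy hp hmy
  rw [hmm] at h1
  have h2 : chord y' p - chord y p = -2 * lor m p + D * (1 + chord y p / 2) := by
    rw [chord_eq hy' hp, chord_eq hy hp, hm]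
    simp only [lor_sub_left, lor_smul_left]; ring
  have h3 : √(D + D ^ 2 / 4) ≤ √(d + d ^ 2 / 4) := by gcongr
  have h4 : √(D + D ^ 2 / 4) * √(chord y p + chord y p ^ 2 / 4) ≤
      √(d + d ^ 2 / 4) * √(chord y p + chord y p ^ 2 / 4) := by gcongr
  have h5 : D * (1 + chord y p / 2) ≤ d * (1 + chord y p / 2) := by gcongr
  have := neg_le_of_abs_le h1
  rw [h2]; linarith

variable (S ξ) in
/-- The set `C ∩ {chord p < η}` attracts trajectories to the point `p`. -/
structure IsAttractor (ρ : ℝ) (p : X) (C : Set X) (δ η : ℝ) : Prop where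
  patch : S.IsPatch ρ p C
  pos : 0 < δ
  η_pos : 0 < η
  η_le : η ≤ ρ
  η_le_one : η ≤ 1
  u_eq : lor (S.x p) ξ = -1
  one_le : ∀ a ∈ C, chord (S.x a) (S.x p) < η → 1 ≤ S.u ξ a
  le_two : ∀ a ∈ C, chord (S.x a) (S.x p) < η → S.u ξ a ≤ 2
  attract : ∀ a ∈ C, chord (S.x a) (S.x p) < η →
    lor (S.grad ξ a) (S.x p) ≤ -δ * chord (S.x a) (S.x p)

namespace IsAttractor

variable {ρ δ η T : ℝ} {p : X} {C : Set X} {c : ℝ → X}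

/-- Near the attracting point, trajectories converge to it exponentially. -/
lemma traj_mem (hA : S.IsAttractor ξ ρ p C δ η) (h : S.IsTraj ξ T c)
    (h0 : c 0 ∈ interior C) (hη : chord (S.x (c 0)) (S.x p) < η) {t : ℝ} (ht : t ∈ Icc 0 T) :
    c t ∈ interior C ∧ chord (S.x (c t)) (S.x p) ≤ η * Real.exp (-δ * t) := by
  have hη0 := hA.η_pos
  have hδ := hA.pos
  obtain ⟨η₀, hη₀, hη₀η⟩ := exists_between hη
  have hη₀0 : 0 < η₀ := (chord_nonneg (S.mem _) (S.mem _)).trans_lt hη₀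
  have hB : ∀ s, 0 ≤ s → η₀ * Real.exp (-δ * s) ≤ η₀ := fun s hs =>
    mul_le_of_le_one_right hη₀0.le (Real.exp_le_one_iff.2 (by nlinarith))
  have key : ∀ t₁ ∈ Icc 0 T, (∀ s ∈ Ico 0 t₁, c s ∈ interior C) → ∀ s ∈ Icc 0 t₁,
      chord (S.x (c s)) (S.x p) ≤ η₀ * Real.exp (-δ * s) := by
    intro t₁ ht₁ hC s hs
    refine image_le_of_deriv_right_lt_deriv_boundary
      (f := fun s => chord (S.x (c s)) (S.x p)) (f' := fun s => 2 * lor (S.grad ξ (c s)) (S.x p))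
      (B := fun s => η₀ * Real.exp (-δ * s))
      (B' := fun s => η₀ * (Real.exp (-δ * s) * -δ)) ?_
      (fun r hr => h.deriv_chord_const ⟨hr.1, hr.2.trans_le ht₁.2⟩) (by simpa using hη₀.le)
      (fun r => ?_) (fun r hr hFB => ?_) hs
    · have := h.continuousOn_x.mono (Icc_subset_Icc_right ht₁.2)
      exact (this.sub continuousOn_const).lor (this.sub continuousOn_const)
    · simpa using ((hasDerivAt_id r).const_mul (-δ)).exp.const_mul η₀
    · have hpos : 0 < chord (S.x (c r)) (S.x p) := by rw [hFB]; positivity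
      have h1 := hA.attract (c r) (interior_subset (hC r hr))
        ((hFB.trans_le (hB r hr.1)).trans_lt hη₀η)
      rw [← mul_assoc, ← hFB]
      nlinarith [mul_pos hδ hpos]
  have hall : ∀ s ∈ Icc 0 T, c s ∈ interior C := by
    by_contra! hc
    obtain ⟨t₁, ht₁, hn, hlt⟩ := exists_first_exit h.cont isOpen_interior hc
    refine hn (hA.patch.subset (isPreconnected_Icc.image c
      (h.cont.mono (Icc_subset_Icc_right ht₁.2)))
      ⟨c 0, mem_image_of_mem c ⟨le_rfl, ht₁.1⟩, h0⟩ ?_ (mem_image_of_mem c ⟨ht₁.1, le_rfl⟩))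
    rintro _ ⟨s, hs, rfl⟩
    exact (((key t₁ ht₁ hlt s hs).trans (hB s hs.1)).trans_lt hη₀η).trans_le hA.η_le
  refine ⟨hall t ht, ?_⟩
  refine (key T ⟨ht.1.trans ht.2, le_rfl⟩ (fun s hs => hall s ⟨hs.1, hs.2.le⟩) t ht).trans ?_
  gcongr

/-- Along a path that moves slowly, the distance to the attracting point grows slowly, so the
path stays in the basin. -/
lemma path_mem (hA : S.IsAttractor ξ ρ p C δ η) {P : ℝ → X} (hP : ContinuousOn P (Icc 0 1))
    (h0 : P 0 ∈ interior C) (hη : chord (S.x (P 0)) (S.x p) ≤ η / 4) {M : ℝ}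
    (hM0 : 0 < M) (hM : 12 * M ≤ η)
    (hlip : ∀ s ∈ Icc (0 : ℝ) 1, ∀ᶠ s' in 𝓝[Icc 0 1] s,
      chord (S.x (P s)) (S.x (P s')) ≤ M ^ 2 * (s' - s) ^ 2) :
    P 1 ∈ interior C ∧ chord (S.x (P 1)) (S.x p) ≤ η / 2 := by
  have hη0 := hA.η_pos
  have hη1 := hA.η_le_one
  set F : ℝ → ℝ := fun s => chord (S.x (P s)) (S.x p) with hF
  have hF0 : ∀ s, 0 ≤ F s := fun s => chord_nonneg (S.mem _) (S.mem _)
  have hPx : ContinuousOn (fun s => S.x (P s)) (Icc 0 1) := S.continuous_x.comp_continuousOn hP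
  have key : ∀ s ∈ Icc (0 : ℝ) 1, F s ≤ η / 4 + 3 * M * s := by
    intro s hs
    refine image_le_of_liminf_slope_right_lt_deriv_boundary (f := F)
      (f' := fun s => 2 * (M * √(F s + F s ^ 2 / 4)))
      (B := fun s => η / 4 + 3 * M * s) (B' := fun _ => 3 * M) ?_ ?_ (by simpa using hη)
      (fun r => by simpa using ((hasDerivAt_id r).const_mul (3 * M)).const_add (η / 4)) ?_ hs
    · exact (hPx.sub continuousOn_const).lor (hPx.sub continuousOn_const)
    · intro r hr K hK
      -- The slope is at most `g (z - r)`, where `g` is continuous and `g 0` is the bound wanted.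
      set g : ℝ → ℝ := fun h => 2 * (M * √(1 + M ^ 2 * h ^ 2 / 4) * √(F r + F r ^ 2 / 4)) +
        M ^ 2 * h * (1 + F r / 2) with hg
      have hgc : Tendsto (fun z => g (z - r)) (𝓝[>] r) (𝓝 (2 * (M * √(F r + F r ^ 2 / 4)))) := by
        have : Continuous fun z => g (z - r) := by rw [hg]; fun_prop
        have h1 := this.tendsto r
        simp only [hg, sub_self] at h1
        refine tendsto_nhdsWithin_of_tendsto_nhds ?_
        simpa using h1
      have hev : ∀ᶠ z in 𝓝[>] r, chord (S.x (P r)) (S.x (P z)) ≤ M ^ 2 * (z - r) ^ 2 := by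
        have h1 := hlip r ⟨hr.1, hr.2.le⟩
        have h2 : 𝓝[>] r ≤ 𝓝[Icc 0 1] r := by
          rw [← nhdsWithin_Ioo_eq_nhdsGT hr.2]
          exact nhdsWithin_mono _ fun z hz => ⟨hr.1.trans hz.1.le, hz.2.le⟩
        exact h2 h1
      refine Eventually.frequently ?_
      filter_upwards [hgc.eventually_lt_const hK, hev, self_mem_nhdsWithin] with z hz1 hz2 hz3
      have hz : 0 < z - r := sub_pos.2 hz3
      refine lt_of_le_of_lt ?_ hz1
      rw [slope_def_field, div_le_iff₀ hz]
      refine (chord_sub_le (S.mem (P r)) (S.mem (P z)) (S.mem p) hz2).trans (le_of_eq ?_)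
      have e : √(M ^ 2 * (z - r) ^ 2 + (M ^ 2 * (z - r) ^ 2) ^ 2 / 4) =
          M * (z - r) * √(1 + M ^ 2 * (z - r) ^ 2 / 4) := by
        rw [show M ^ 2 * (z - r) ^ 2 + (M ^ 2 * (z - r) ^ 2) ^ 2 / 4 =
          (M * (z - r)) ^ 2 * (1 + M ^ 2 * (z - r) ^ 2 / 4) by ring,
          Real.sqrt_mul (sq_nonneg _), Real.sqrt_sq (by positivity)]
      rw [e]
      simp only [hg, hF]
      ring
    · intro r hr hB
      have h1 : F r ≤ 1 := by rw [hB]; nlinarith [hr.2]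
      have h2 : √(F r + F r ^ 2 / 4) < 3 / 2 := by
        rw [Real.sqrt_lt' (by norm_num)]; nlinarith [hF0 r]
      nlinarith
  have hle : ∀ s ∈ Icc (0 : ℝ) 1, F s ≤ η / 2 := fun s hs => by
    have := key s hs
    nlinarith [hs.2]
  have h1 : (1 : ℝ) ∈ Icc (0 : ℝ) 1 := ⟨zero_le_one, le_rfl⟩
  refine ⟨hA.patch.subset (isPreconnected_Icc.image P hP)
      ⟨P 0, mem_image_of_mem P ⟨le_rfl, zero_le_one⟩, h0⟩ ?_ (mem_image_of_mem P h1), hle 1 h1⟩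
  rintro _ ⟨s, hs, rfl⟩
  exact ((hle s hs).trans_lt (by linarith)).trans_le hA.η_le

/-- The points whose trajectory comes close to the attracting point. -/
def basin (S : CurvSurface X) (ξ : Mink) (p : X) (C : Set X) (η : ℝ) : Set X :=
  {y | ∃ T ≥ 0, ∃ c, S.IsTraj ξ T c ∧ c 0 = y ∧ c T ∈ interior C ∧
    chord (S.x (c T)) (S.x p) ≤ η / 2}

lemma exists_traj_quarter (hA : S.IsAttractor ξ ρ p C δ η) (hS : S.IsComplete) (hξ : IsNull ξ)
    {y : X} (hy : y ∈ basin S ξ p C η) : ∃ T ≥ 0, ∃ c, S.IsTraj ξ T c ∧ c 0 = y ∧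
      c T ∈ interior C ∧ chord (S.x (c T)) (S.x p) ≤ η / 4 := by
  have hη0 := hA.η_pos
  have hδ := hA.pos
  obtain ⟨T, hT, c, hc, h0, h1, h2⟩ := hy
  set T₂ := Real.log 4 / δ with hT₂
  have hT₂0 : 0 ≤ T₂ := div_nonneg (Real.log_nonneg (by norm_num)) hδ.le
  obtain ⟨c₂, hc₂, h3⟩ := hS.exists_traj hξ (c T) T₂
  have h4 := hA.traj_mem hc₂ (by rwa [h3]) (by rw [h3]; linarith) (t := T₂) ⟨hT₂0, le_rfl⟩
  have he : Real.exp (-δ * T₂) = 1 / 4 := by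
    rw [hT₂, show -δ * (Real.log 4 / δ) = -Real.log 4 by field_simp, Real.exp_neg,
      Real.exp_log (by norm_num)]
    norm_num
  rw [he] at h4
  have hend : (if T + T₂ ≤ T then c (T + T₂) else c₂ (T + T₂ - T)) = c₂ T₂ := by
    split_ifs with h
    · have : T₂ = 0 := le_antisymm (by linarith) hT₂0
      rw [this, add_zero, h3]
    · congr 1; ring
  refine ⟨T + T₂, by positivity, _, hc.append hc₂ hT hT₂0 h3, by simpa [hT] using h0, ?_, ?_⟩
  · simp only [hend]; exact h4.1
  · simp only [hend]; linarith [h4.2]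

/-- Every trajectory comes close to the attracting point. -/
lemma basin_eq_univ [T1Space X] [PreconnectedSpace X] (hA : S.IsAttractor ξ ρ p C δ η)
    (hS : S.IsComplete) (hξ : IsNull ξ) : basin S ξ p C η = univ := by
  have hη0 := hA.η_pos
  obtain ⟨ρ', hρ', hP⟩ := hS.patch
  set L := η / 24 with hL
  have hL0 : 0 < L := by positivity
  have main : ∀ y, ∃ O ∈ 𝓝 y, ∀ a ∈ O, ∀ b ∈ O, a ∈ basin S ξ p C η → b ∈ basin S ξ p C η := by
    intro y
    obtain ⟨O, hO, hseg⟩ := hS.segment y L hL0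
    refine ⟨O, hO, fun a ha b hb hab => ?_⟩
    obtain ⟨σ, hσ, hσ0, hσ1, hlip⟩ := hseg a ha b hb
    obtain ⟨T, hT, c, hc, h0, h1, h2⟩ := hA.exists_traj_quarter hS hξ hab
    choose tr htr htr0 using fun y => hS.exists_traj hξ y T
    obtain ⟨U, hU⟩ : ∃ U, ∀ s ∈ Icc (0 : ℝ) 1, S.u ξ (σ s) ≤ U := by
      obtain ⟨U, hU⟩ := (isCompact_Icc.bddAbove_image (continuous_u (S := S) (ξ := ξ)
        |>.comp_continuousOn hσ))
      exact ⟨U, fun s hs => hU (mem_image_of_mem _ hs)⟩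
    have h01 : (0 : ℝ) ∈ Icc (0 : ℝ) 1 := ⟨le_rfl, zero_le_one⟩
    have h11 : (1 : ℝ) ∈ Icc (0 : ℝ) 1 := ⟨zero_le_one, le_rfl⟩
    have hU0 : 0 < U := (u_pos hξ _).trans_le (hU 0 h01)
    classical
    -- `tr' s` is the trajectory from `σ s`, and it is `c` for `s = 0`.
    let tr' : ℝ → ℝ → X := fun s => if s = 0 then c else tr (σ s)
    have htr' : ∀ s, S.IsTraj ξ T (tr' s) ∧ tr' s 0 = σ s := by
      intro s
      by_cases hs : s = 0
      · simp only [tr', hs, if_true]; exact ⟨hc, by rw [h0, hσ0]⟩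
      · simp only [tr', hs, if_false]; exact ⟨htr _, htr0 _⟩
    obtain ⟨ε, hε, hε2⟩ : ∃ ε > 0, Real.exp (3 * ε * U * T) ≤ 4 := by
      refine ⟨1 / (3 * U * (T + 1)), by positivity, ?_⟩
      have : 3 * (1 / (3 * U * (T + 1))) * U * T ≤ 1 := by
        rw [show 3 * (1 / (3 * U * (T + 1))) * U * T = T / (T + 1) by field_simp]
        rw [div_le_one (by positivity)]; linarith
      calc Real.exp _ ≤ Real.exp 1 := Real.exp_le_exp.2 this
        _ ≤ 4 := by linarith [Real.exp_one_lt_d9]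
    have hcontr : ∀ s ∈ Icc (0 : ℝ) 1, ∀ W ∈ 𝓝 (tr' s T), ∀ᶠ s' in 𝓝[Icc 0 1] s,
        tr' s' T ∈ W ∧ chord (S.x (tr' s T)) (S.x (tr' s' T)) ≤ (2 * L) ^ 2 * (s' - s) ^ 2 := by
      intro s hs W hW
      have h3 := IsTraj.contraction hρ' hP hξ hε hT (htr' s).1
        (U := U) (by rw [(htr' s).2]; exact hU s hs) hW
      rw [(htr' s).2] at h3
      filter_upwards [(hσ s hs).eventually h3, self_mem_nhdsWithin] with s' hs' hs'1
      obtain ⟨g1, g2⟩ := hs' _ (htr' s').1 (htr' s').2 (hU s' hs'1)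
      refine ⟨g1, g2.trans ?_⟩
      have g3 := hlip s hs s' hs'1
      have g4 := chord_nonneg (S.mem (σ s)) (S.mem (σ s'))
      calc _ ≤ (L ^ 2 * (s' - s) ^ 2) * 4 := by gcongr
        _ = _ := by ring
    have hfin := hA.path_mem (P := fun s => tr' s T) (M := 2 * L)
      (fun s hs W hW => (hcontr s hs W hW).mono fun _ h => h.1) (by simpa [tr'] using h1)
      (by simpa [tr'] using h2) (by positivity) (by rw [hL]; linarith)
      (fun s hs => (hcontr s hs univ univ_mem).mono fun _ h => h.2)
    exact ⟨T, hT, tr' 1, (htr' 1).1, (htr' 1).2.trans hσ1, hfin.1, hfin.2⟩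
  refine IsClopen.eq_univ ⟨?_, ?_⟩ ⟨p, ?_⟩
  · rw [← isOpen_compl_iff, isOpen_iff_mem_nhds]
    intro y hy
    obtain ⟨O, hO, h⟩ := main y
    filter_upwards [hO] with b hb hb'
    exact hy (h b hb y (mem_of_mem_nhds hO) hb')
  · rw [isOpen_iff_mem_nhds]
    intro y hy
    obtain ⟨O, hO, h⟩ := main y
    filter_upwards [hO] with b hb
    exact h y (mem_of_mem_nhds hO) b hb hy
  · obtain ⟨c, hc, h0⟩ := hS.exists_traj hξ p 0
    refine ⟨0, le_rfl, c, hc, h0, ?_, ?_⟩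
    · rw [h0]; exact hA.patch.mem_interior
    · rw [h0, chord_self]; linarith

end IsAttractor
end CurvSurface
end Hyp3

namespace Hyp3
open Set Filter Topology

/-! ### Surfaces avoid the centre of a strictly supporting horosphere -/

lemma le_of_deriv_right_nonpos {f f' : ℝ → ℝ} {a b : ℝ} (hab : a ≤ b)
    (hf : ContinuousOn f (Icc a b))
    (hf' : ∀ t ∈ Ico a b, HasDerivWithinAt f (f' t) (Ici t) t) (h : ∀ t ∈ Ico a b, f' t ≤ 0) :
    f b ≤ f a :=
  image_le_of_deriv_right_le_deriv_boundary (B := fun _ => f a) (B' := fun _ => 0) hf hf' le_rfl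
    continuousOn_const (fun t _ => hasDerivWithinAt_const t _ _) h ⟨hab, le_rfl⟩

namespace CurvSurface

variable {X : Type*} [TopologicalSpace X] {S : CurvSurface X} {ξ : Mink}

namespace IsTraj

variable {T : ℝ} {c : ℝ → X}

lemma continuousOn_u (h : S.IsTraj ξ T c) : ContinuousOn (fun t => S.u ξ (c t)) (Icc 0 T) :=
  continuous_u.comp_continuousOn h.cont

/-- The convexity of `√u`: the squared length `gsq / u` of `2 grad √u` decreases along
trajectories. -/
lemma gsq_div_u_antitone (hξ : IsNull ξ) (h : S.IsTraj ξ T c) {t : ℝ} (ht : t ∈ Icc 0 T) :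
    S.gsq ξ (c T) / S.u ξ (c T) ≤ S.gsq ξ (c t) / S.u ξ (c t) := by
  have hsub : Icc t T ⊆ Icc 0 T := Icc_subset_Icc_left ht.1
  choose! g' hg' hgd using h.gderiv
  refine le_of_deriv_right_nonpos (f := fun s => S.gsq ξ (c s) / S.u ξ (c s)) ht.2
    (((continuous_gsq.comp_continuousOn h.cont).mono hsub).div (h.continuousOn_u.mono hsub)
      fun s _ => (u_pos hξ _).ne')
    (fun s hs => (hgd s ⟨ht.1.trans hs.1, hs.2⟩).div (h.deriv_u hξ ⟨ht.1.trans hs.1, hs.2⟩)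
      (u_pos hξ _).ne') fun s hs => ?_
  have hu := u_pos (S := S) hξ (c s)
  have hg := gsq_nonneg (S := S) hξ (c s)
  refine div_nonpos_of_nonpos_of_nonneg ?_ (sq_nonneg _)
  have h1 := mul_le_mul_of_nonneg_right (hg' s ⟨ht.1.trans hs.1, hs.2⟩) hu.le
  have h2 : S.gsq ξ (c s) = S.u ξ (c s) ^ 2 - |S.n ξ (c s)| ^ 2 := by rw [sq_abs]; rfl
  have h3 : -2 * S.gsq ξ (c s) * (S.u ξ (c s) - |S.n ξ (c s)|) * S.u ξ (c s) +
      S.gsq ξ (c s) * S.gsq ξ (c s) =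
      -(S.gsq ξ (c s) * (S.u ξ (c s) - |S.n ξ (c s)|) ^ 2) := by
    conv_lhs => enter [2, 2]; rw [h2]
    ring
  have h4 := mul_nonneg hg (sq_nonneg (S.u ξ (c s) - |S.n ξ (c s)|))
  linarith

/-- The ratio `-lor x e / u` controls the Euclidean distance from `e` in the upper half-space in
which `ξ` is the point at infinity. As `√u` grows at a definite rate in backward time, its
variation along a trajectory is bounded. -/
lemma sqrt_ratio_le (hξ : IsNull ξ) (h : S.IsTraj ξ T c) (hT : 0 ≤ T) {e : Mink}
    (he : e ∈ hyperboloid) (heξ : lor e ξ = -1) {k : ℝ} (hk : 0 < k)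
    (hg : k ^ 2 ≤ S.gsq ξ (c T) / S.u ξ (c T)) :
    √(-2 * lor (S.x (c 0)) e / S.u ξ (c 0)) ≤
      √(-2 * lor (S.x (c T)) e / S.u ξ (c T)) + 2 / k / √(S.u ξ (c T)) := by
  have hv : ∀ t, 0 < -2 * lor (S.x (c t)) e / S.u ξ (c t) := fun t =>
    div_pos (by linarith [lor_le_neg_one (S.mem (c t)) he]) (u_pos hξ _)
  have hdv : ∀ t ∈ Ico 0 T, HasDerivWithinAt (fun s => -2 * lor (S.x (c s)) e / S.u ξ (c s))
      (2 / S.u ξ (c t) * lor (S.grad ξ (c t)) (e + (lor (S.x (c t)) e / S.u ξ (c t)) • ξ))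
      (Ici t) t := fun t ht => by
    have h1 := (((h.deriv t ht).lor (hasDerivWithinAt_const t _ e)).const_mul (-2)).div
      (h.deriv_u hξ ht) (u_pos hξ _).ne'
    refine h1.congr_deriv ?_
    have := (u_pos (S := S) hξ (c t)).ne'
    rw [lor_zero_right, lor_neg_left, lor_add_right, lor_smul_right, lor_grad_null hξ]
    field_simp
    ring
  have hcont : ContinuousOn (fun s => -2 * lor (S.x (c s)) e / S.u ξ (c s)) (Icc 0 T) :=
    ((h.continuousOn_x.lor continuousOn_const).const_smul (-2 : ℝ)).div h.continuousOn_u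
      fun s _ => (u_pos hξ _).ne'
  have hsu : ∀ t, 0 < √(S.u ξ (c t)) := fun t => Real.sqrt_pos.2 (u_pos hξ _)
  have key := le_of_deriv_right_nonpos
    (f := fun s => -√(-2 * lor (S.x (c s)) e / S.u ξ (c s)) - 2 / k * (√(S.u ξ (c s)))⁻¹) hT ?_
    (fun t ht => ((hdv t ht).sqrt (hv t).ne').neg.sub
      ((((h.deriv_u hξ ht).sqrt (u_pos hξ _).ne').inv (hsu t).ne').const_mul (2 / k))) ?_
  · have hp : 0 ≤ 2 / k * (√(S.u ξ (c 0)))⁻¹ := by have := hsu 0; positivity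
    rw [div_eq_mul_inv (2 / k)]
    linarith
  · refine hcont.sqrt.neg.sub (ContinuousOn.mul continuousOn_const ?_)
    exact h.continuousOn_u.sqrt.inv₀ fun t _ => (hsu t).ne'
  · intro t ht
    set u := S.u ξ (c t) with hu
    set g := S.gsq ξ (c t) with hgdef
    set m := e + (lor (S.x (c t)) e / u) • ξ with hm
    set v := -2 * lor (S.x (c t)) e / u with hvdef
    have hu0 : 0 < u := u_pos hξ _
    have hv0 : 0 < v := hv t
    have hmx : lor m (S.x (c t)) = 0 := by
      rw [hm, lor_add_left, lor_smul_left, lor_comm ξ, lor_x_null (ξ := ξ), lor_comm e, ← hu]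
      field_simp; ring
    have hmm : lor m m = v - 1 := by
      rw [hm]
      simp only [lor_add_left, lor_add_right, lor_smul_left, lor_smul_right, hξ.null, heξ,
        lor_comm ξ e, he.1, hvdef]
      ring
    have h1 := abs_lor_le (S.mem (c t)) (lor_grad_x (ξ := ξ) (c t)) hmx
    rw [lor_grad_grad hξ, ← hgdef, hmm] at h1
    have h2 : √(v - 1) ≤ √v := Real.sqrt_le_sqrt (by linarith)
    have h3 : |lor (S.grad ξ (c t)) m| ≤ √g * √v :=
      h1.trans (mul_le_mul_of_nonneg_left h2 (Real.sqrt_nonneg _))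
    have hge : k ^ 2 * u ≤ g := by
      have h4 := (h.gsq_div_u_antitone hξ ⟨ht.1, ht.2.le⟩).trans' hg
      rwa [← hu, ← hgdef, le_div_iff₀ hu0] at h4
    have hge' : k * √u ≤ √g := by
      rw [← Real.sqrt_sq hk.le, ← Real.sqrt_mul (sq_nonneg k)]
      exact Real.sqrt_le_sqrt hge
    have hg0 : 0 ≤ g := gsq_nonneg hξ _
    have hsu0 : 0 < √u := Real.sqrt_pos.2 hu0
    have hsv0 : 0 < √v := Real.sqrt_pos.2 hv0
    have hsg : √g ^ 2 = g := Real.sq_sqrt hg0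
    have hsq : √u ^ 2 = u := Real.sq_sqrt hu0.le
    -- Both terms of the derivative are of size `√g / u`.
    have e1 : -(2 / u * lor (S.grad ξ (c t)) m / (2 * √v)) ≤ √g / u := by
      have h5 := neg_le_of_abs_le h3
      rw [show -(2 / u * lor (S.grad ξ (c t)) m / (2 * √v)) = (-lor (S.grad ξ (c t)) m / √v) / u by
        field_simp]
      gcongr
      rw [div_le_iff₀ hsv0]; linarith
    have e2 : √g / u ≤ 2 / k * (-(-g / (2 * √u)) / √u ^ 2) := by
      rw [hsq, show 2 / k * (-(-g / (2 * √u)) / u) = (g / (k * √u)) / u by field_simp]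
      gcongr
      rw [le_div_iff₀ (by positivity)]
      calc √g * (k * √u) ≤ √g * √g := by gcongr
        _ = g := by rw [← sq, hsg]
    linarith

end IsTraj

namespace IsAttractor

variable {ρ δ η : ℝ} {p : X} {C : Set X}

/-- The surface stays in a bounded part of the upper half-space in which `ξ` is the point at
infinity. -/
lemma exists_bound [T2Space X] [PreconnectedSpace X] (hA : S.IsAttractor ξ ρ p C δ η)
    (hS : S.IsComplete) (hξ : IsNull ξ) :
    ∃ K, ∀ y, -lor (S.x y) (S.x p) ≤ K * S.u ξ y := by
  have hη0 := hA.η_pos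
  have hη1 := hA.η_le_one
  have hδ := hA.pos
  set K₀ : Set X := {a ∈ C | chord (S.x a) (S.x p) ≤ η / 2} with hK₀
  have hK₀c : IsClosed K₀ := hA.patch.compact.isClosed.inter
    (isClosed_le (S.continuous_x.chord continuous_const) continuous_const)
  have hnear : ∀ a ∈ K₀, -2 * lor (S.x a) (S.x p) / S.u ξ a ≤ 4 := fun a ha => by
    have h1 := hA.one_le a ha.1 (ha.2.trans_lt (by linarith))
    have h2 := ha.2
    rw [chord_eq (S.mem a) (S.mem p)] at h2
    rw [div_le_iff₀ (u_pos hξ a)]; linarith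
  set k : ℝ := δ * η / 4 with hk
  have hk0 : 0 < k := by positivity
  -- On the boundary of `K₀` the gradient of `u` is bounded below, by the attraction towards `p`.
  have hbd : ∀ a ∈ C, chord (S.x a) (S.x p) = η / 2 → k ^ 2 ≤ S.gsq ξ a / S.u ξ a := by
    intro a ha he
    have hlt : chord (S.x a) (S.x p) < η := by rw [he]; linarith
    have h2 := hA.le_two a ha hlt
    have h3 := hA.attract a ha hlt
    have h4 := abs_lor_le_chord (S.mem a) (S.mem p) (lor_grad_x (ξ := ξ) a)
    rw [lor_grad_grad hξ, he] at h4
    rw [he] at h3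
    have h5 : √(η / 2 + (η / 2) ^ 2 / 4) ≤ 1 := by
      rw [Real.sqrt_le_one]; nlinarith
    have h6 := neg_le_of_abs_le h4
    have h7 : √(S.gsq ξ a) * √(η / 2 + (η / 2) ^ 2 / 4) ≤ √(S.gsq ξ a) * 1 := by gcongr
    have h8 : 2 * k ≤ √(S.gsq ξ a) := by rw [hk]; nlinarith
    have h9 : (2 * k) ^ 2 ≤ S.gsq ξ a := by
      have := pow_le_pow_left₀ (by positivity) h8 2
      rwa [Real.sq_sqrt (gsq_nonneg hξ a)] at this
    rw [le_div_iff₀ (u_pos hξ a)]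
    nlinarith [sq_nonneg k]
  have hmain : ∀ y, √(-2 * lor (S.x y) (S.x p) / S.u ξ y) ≤ 2 + 2 / k := by
    intro y
    have h4 : √(4 : ℝ) = 2 := by rw [show (4 : ℝ) = 2 ^ 2 by norm_num]; simp
    by_cases hy : y ∈ K₀
    · have := Real.sqrt_le_sqrt (hnear y hy)
      rw [h4] at this
      have : 0 < 2 / k := by positivity
      linarith
    obtain ⟨T, hT, c, hc, h0, h1, h2⟩ : y ∈ basin S ξ p C η := by
      rw [hA.basin_eq_univ hS hξ]; trivial
    -- `t` is the time at which the trajectory from `y` enters `K₀`.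
    obtain ⟨t, ht, hmem, hlt⟩ := exists_first_exit hc.cont hK₀c.isOpen_compl
      ⟨T, ⟨hT, le_rfl⟩, not_not.2 ⟨interior_subset h1, h2⟩⟩
    have hmem : c t ∈ K₀ := not_not.1 hmem
    have ht0 : 0 < t := by
      refine lt_of_le_of_ne ht.1 fun h => hy ?_
      rw [← h0, h]; exact hmem
    have heq : chord (S.x (c t)) (S.x p) = η / 2 := by
      refine le_antisymm hmem.2 (not_lt.1 fun hl => ?_)
      have hint : c t ∈ interior C := by
        by_contra hn
        have hf : c t ∈ frontier C := ⟨subset_closure hmem.1, hn⟩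
        have := hA.patch.frontier _ hf
        rw [chord_comm] at this
        linarith [hA.η_le]
      have hnhds : K₀ ∈ 𝓝 (c t) := by
        filter_upwards [mem_interior_iff_mem_nhds.1 hint,
          (isOpen_lt (S.continuous_x.chord continuous_const) continuous_const).mem_nhds hl]
          with a ha hl using ⟨ha, le_of_lt hl⟩
      have hw := (hc.cont t ht).eventually hnhds
      have h5 : 𝓝[Ico 0 t] t ≤ 𝓝[Icc 0 T] t :=
        nhdsWithin_mono _ fun s hs => ⟨hs.1, hs.2.le.trans ht.2⟩
      have hne : (𝓝[Ico 0 t] t).NeBot := by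
        rw [← mem_closure_iff_nhdsWithin_neBot, closure_Ico ht0.ne]
        exact ⟨ht0.le, le_rfl⟩
      obtain ⟨s, hs1, hs2⟩ := ((hw.filter_mono h5).and self_mem_nhdsWithin).exists
      exact hlt s hs2 hs1
    have h6 := (hc.restrict ht.2).sqrt_ratio_le hξ ht0.le (S.mem p) hA.u_eq hk0
      (hbd _ hmem.1 heq)
    rw [h0] at h6
    have h7 := Real.sqrt_le_sqrt (hnear _ hmem)
    rw [h4] at h7
    have h8 : 2 / k / √(S.u ξ (c t)) ≤ 2 / k := by
      refine div_le_self (by positivity) ?_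
      rw [Real.one_le_sqrt]
      exact hA.one_le _ hmem.1 (by rw [heq]; linarith)
    linarith
  refine ⟨(2 + 2 / k) ^ 2 / 2, fun y => ?_⟩
  have h1 := hmain y
  rw [Real.sqrt_le_left (by positivity), div_le_iff₀ (u_pos hξ y)] at h1
  linarith

end IsAttractor

/-- The null vector of a horosphere tangent to the surface at `p`. -/
lemma isNull_tangent (p : X) {σ : ℝ} (hσ : σ ^ 2 = 1) : IsNull (S.x p + σ • S.ν p) := by
  have h0 : lor (S.x p + σ • S.ν p) (S.x p + σ • S.ν p) = 0 := by
    simp only [lor_add_left, lor_add_right, lor_smul_left, lor_smul_right, (S.mem p).1, S.unit p,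
      S.orth p, lor_comm (S.x p) (S.ν p)]
    linarith
  refine ⟨h0, null_snd_pos (S.mem p) h0 ?_⟩
  rw [lor_add_right, lor_smul_right, lor_comm _ (S.ν p), S.orth p, (S.mem p).1]; norm_num

/-- A point where the principal curvatures are smaller than `1` with respect to the side `σ`
attracts nearby trajectories for the horosphere tangent on that side. -/
lemma exists_isAttractor [T1Space X] (hS : S.IsComplete) (p : X) {σ κ : ℝ} (hσ : σ ^ 2 = 1)
    (hκ : κ < 1)
    (h : ∀ᶠ a in 𝓝 p, σ * lor (S.x a - S.x p) (S.ν p) ≤ κ / 2 * chord (S.x p) (S.x a)) :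
    ∃ ρ C δ η, S.IsAttractor (S.x p + σ • S.ν p) ρ p C δ η := by
  obtain ⟨ρ, hρ, hP⟩ := hS.patch
  obtain ⟨C, hC⟩ := hP p
  set ξ := S.x p + σ • S.ν p with hξdef
  have hξ : IsNull ξ := isNull_tangent p hσ
  have hup : lor (S.x p) ξ = -1 := by
    rw [hξdef, lor_add_right, lor_smul_right, lor_comm _ (S.ν p), S.orth p, (S.mem p).1]; norm_num
  have hu : ∀ a, S.u ξ a =
      1 + chord (S.x p) (S.x a) / 2 - σ * lor (S.x a - S.x p) (S.ν p) := fun a => by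
    rw [chord_eq (S.mem p) (S.mem a), u, hξdef, lor_add_right, lor_smul_right, lor_sub_left,
      lor_comm (S.x p) (S.ν p), S.orth p, lor_comm (S.x a) (S.x p)]
    ring
  have hup1 : S.u ξ p = 1 := by rw [u, hup]; norm_num
  set δ := (1 - κ) / 4 with hδdef
  have hδ : 0 < δ := by rw [hδdef]; linarith
  have h2p := S.two_point p δ hδ
  have hev : ∀ᶠ a in 𝓝 p, 1 ≤ S.u ξ a ∧ S.u ξ a ≤ 2 ∧
      lor (S.grad ξ a) (S.x p) ≤ -δ * chord (S.x a) (S.x p) := by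
    have hlt := (continuous_u (S := S) (ξ := ξ)).tendsto p
    rw [hup1] at hlt
    have h2p' : ∀ᶠ a in 𝓝 p, |lor (S.x p - S.x a) (S.ν a)| ≤
        (1 + δ) / 2 * chord (S.x a) (S.x p) :=
      (Continuous.prodMk_left p).tendsto p |>.eventually h2p
    filter_upwards [h, h2p', hlt.eventually_lt_const one_lt_two] with a ha h2a hu2
    have hch := chord_nonneg (S.mem a) (S.mem p)
    rw [chord_comm (S.x p)] at ha
    have hua := hu a
    rw [chord_comm (S.x p)] at hua
    have h1 : 1 + 2 * δ * chord (S.x a) (S.x p) ≤ S.u ξ a := by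
      rw [hua, hδdef]; linarith
    refine ⟨by nlinarith, hu2.le, ?_⟩
    have h3 := lor_grad_sub_le hξ h2a
    rw [lor_sub_right, lor_grad_x, hup1] at h3
    have h4 : δ / 2 * S.u ξ a * chord (S.x a) (S.x p) ≤ δ / 2 * 2 * chord (S.x a) (S.x p) := by
      gcongr
    linarith
  obtain ⟨η, hη, hηC'⟩ := hC.exists_mem_of_chord_lt hev
  have hηC := fun a ha hlt => hηC' (mem_of_mem_nhds hC.mem_nhds) a ha (by rwa [chord_comm])
  refine ⟨ρ, C, δ, min η (min ρ 1), hC, hδ, by positivity,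
    (min_le_right _ _).trans (min_le_left _ _),
    (min_le_right _ _).trans (min_le_right _ _), hup, ?_, ?_, ?_⟩
  · exact fun a ha hlt => (hηC a ha (hlt.trans_le (min_le_left _ _))).1
  · exact fun a ha hlt => (hηC a ha (hlt.trans_le (min_le_left _ _))).2.1
  · exact fun a ha hlt => (hηC a ha (hlt.trans_le (min_le_left _ _))).2.2

end CurvSurface
end Hyp3

namespace Hyp3
open Set Filter Topology

/-! ### Parametrized surfaces in the hyperboloid -/

section Calculus

variable {E F : Type*} [NormedAddCommGroup E] [NormedSpace ℝ E] [NormedAddCommGroup F]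
  [NormedSpace ℝ F] {A : E → F} {z : E}

lemma fderiv_fderiv_symm (hA : ContDiffAt ℝ ∞ A z) (v w : E) :
    fderiv ℝ (fderiv ℝ A) z v w = fderiv ℝ (fderiv ℝ A) z w v :=
  (hA.isSymmSndFDerivAt (by
    rw [minSmoothness_of_isRCLikeNormedField]; exact WithTop.coe_le_coe.2 le_top)).eq v w

lemma _root_.ContDiffAt.differentiableAt_fderiv (hA : ContDiffAt ℝ ∞ A z) :
    DifferentiableAt ℝ (fderiv ℝ A) z :=
  (hA.fderiv_right (m := ∞) (by simp)).differentiableAt (by simp)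

lemma _root_.ContDiffAt.differentiableAt_fderiv_apply (hA : ContDiffAt ℝ ∞ A z) (w : E) :
    DifferentiableAt ℝ (fun y => fderiv ℝ A y w) z :=
  hA.differentiableAt_fderiv.clm_apply (differentiableAt_const w)

lemma fderiv_fderiv_apply (hA : ContDiffAt ℝ ∞ A z) (v w : E) :
    fderiv ℝ (fun y => fderiv ℝ A y w) z v = fderiv ℝ (fderiv ℝ A) z v w := by
  rw [fderiv_clm_apply hA.differentiableAt_fderiv (differentiableAt_const w)]
  simp

lemma _root_.ContDiffAt.differentiableAt_fderiv_fderiv_apply (hA : ContDiffAt ℝ ∞ A z) (v w : E) :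
    DifferentiableAt ℝ (fun y => fderiv ℝ (fderiv ℝ A) y v w) z :=
  ((hA.fderiv_right (m := ∞) (by simp)).differentiableAt_fderiv_apply v).clm_apply
    (differentiableAt_const w)

lemma fderiv_fderiv_fderiv_apply (hA : ContDiffAt ℝ ∞ A z) (u v w : E) :
    fderiv ℝ (fun y => fderiv ℝ (fderiv ℝ A) y v w) z u =
      fderiv ℝ (fderiv ℝ (fderiv ℝ A)) z u v w := by
  have h1 := hA.fderiv_right (m := ∞) (by simp)
  rw [fderiv_clm_apply (h1.differentiableAt_fderiv_apply v) (differentiableAt_const w)]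
  simp [fderiv_fderiv_apply h1]

end Calculus

/-- A smooth parametrization `G` of a surface in the hyperboloid over the open set `W`, with smooth
unit normal `N`. -/
structure IsParam (W : Set E2) (G N : E2 → Mink) : Prop where
  isOpen : IsOpen W
  smooth : ContDiffOn ℝ ∞ G W
  smooth_normal : ContDiffOn ℝ ∞ N W
  mem : ∀ z ∈ W, G z ∈ hyperboloid
  unit : ∀ z ∈ W, lor (N z) (N z) = 1
  orth : ∀ z ∈ W, lor (N z) (G z) = 0
  normal : ∀ z ∈ W, ∀ v, lor (N z) (fderiv ℝ G z v) = 0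
  inj : ∀ z ∈ W, Function.Injective (fderiv ℝ G z)

/-- A parametrized surface with principal curvatures in `[-1, 1]`: the second fundamental form is
bounded by the first. -/
structure IsCurvParam (W : Set E2) (G N : E2 → Mink) : Prop extends IsParam W G N where
  curv : ∀ z ∈ W, ∀ v, |lor (fderiv ℝ N z v) (fderiv ℝ G z v)| ≤
    lor (fderiv ℝ G z v) (fderiv ℝ G z v)

/-- The product rule for a Lorentzian product that is locally constant. -/
lemma lor_fderiv_of_eventuallyEq {E : Type*} [NormedAddCommGroup E] [NormedSpace ℝ E]
    {A B : E → Mink} {z : E} {c : ℝ} (hA : DifferentiableAt ℝ A z) (hB : DifferentiableAt ℝ B z)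
    (h : ∀ᶠ y in 𝓝 z, lor (A y) (B y) = c) (v : E) :
    lor (A z) (fderiv ℝ B z v) + lor (fderiv ℝ A z v) (B z) = 0 := by
  have h1 := hA.hasFDerivAt.lor hB.hasFDerivAt
  have h2 : HasFDerivAt (fun y => lor (A y) (B y)) (0 : E →L[ℝ] ℝ) z :=
    (hasFDerivAt_const c z).congr_of_eventuallyEq h
  have h3 := congrArg (fun L : E →L[ℝ] ℝ => L v) (h1.unique h2)
  simpa [lorL_apply] using h3

/-- A quadratic form that is positive on the unit sphere, uniformly near a parameter. -/
lemma eventually_forall_quadratic_nonneg {Y : Type*} [TopologicalSpace Y] {y₀ : Y}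
    {Q : Y → E2 →L[ℝ] E2 →L[ℝ] ℝ} (hQ : ContinuousAt Q y₀) (h : ∀ v ≠ 0, 0 < Q y₀ v v) :
    ∀ᶠ y in 𝓝 y₀, ∀ v, 0 ≤ Q y v v := by
  have h1 : ∀ v ∈ Metric.sphere (0 : E2) 1, ∀ᶠ q : E2 × Y in 𝓝 (v, y₀), 0 < Q q.2 q.1 q.1 := by
    intro v hv
    have hv0 : v ≠ 0 := by
      rintro rfl
      simp at hv
    have hc : ContinuousAt (fun q : E2 × Y => Q q.2 q.1 q.1) (v, y₀) := by
      have h2 : ContinuousAt (fun q : E2 × Y => Q q.2) (v, y₀) :=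
        ContinuousAt.comp (f := Prod.snd) (g := Q) hQ continuousAt_snd
      exact (h2.clm_apply continuousAt_fst).clm_apply continuousAt_fst
    exact hc.eventually_const_lt (h v hv0)
  have h2 := (isCompact_sphere (0 : E2) 1).eventually_forall_of_forall_eventually
    (x₀ := y₀) (P := fun y v => 0 < Q y v v) (fun v hv => by
      have := h1 v hv
      rw [nhds_prod_eq] at this ⊢
      exact (Filter.prod_comm ▸ this : _))
  filter_upwards [h2] with y hy v
  rcases eq_or_ne v 0 with rfl | hv
  · simp
  · have hn : 0 < ‖v‖ := norm_pos_iff.2 hv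
    have h3 := hy (‖v‖⁻¹ • v) (by simp [norm_smul, hn.ne'])
    have h4 : Q y v v = ‖v‖ ^ 2 * Q y (‖v‖⁻¹ • v) (‖v‖⁻¹ • v) := by
      simp only [map_smul, _root_.smul_apply, smul_eq_mul]
      field_simp
    rw [h4]; positivity

namespace IsParam

variable {W : Set E2} {G N : E2 → Mink} {z : E2}

lemma mem_nhds (h : IsParam W G N) (hz : z ∈ W) : W ∈ 𝓝 z := h.isOpen.mem_nhds hz

lemma contDiffAt (h : IsParam W G N) (hz : z ∈ W) : ContDiffAt ℝ ∞ G z :=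
  h.smooth.contDiffAt (h.mem_nhds hz)

lemma contDiffAt_normal (h : IsParam W G N) (hz : z ∈ W) : ContDiffAt ℝ ∞ N z :=
  h.smooth_normal.contDiffAt (h.mem_nhds hz)

lemma differentiableAt (h : IsParam W G N) (hz : z ∈ W) : DifferentiableAt ℝ G z :=
  (h.contDiffAt hz).differentiableAt (by simp)

lemma differentiableAt_normal (h : IsParam W G N) (hz : z ∈ W) : DifferentiableAt ℝ N z :=
  (h.contDiffAt_normal hz).differentiableAt (by simp)

lemma contDiffOn_fderiv (h : IsParam W G N) : ContDiffOn ℝ ∞ (fderiv ℝ G) W :=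
  h.smooth.fderiv_of_isOpen h.isOpen (by simp)

lemma contDiffOn_fderiv_fderiv (h : IsParam W G N) : ContDiffOn ℝ ∞ (fderiv ℝ (fderiv ℝ G)) W :=
  h.contDiffOn_fderiv.fderiv_of_isOpen h.isOpen (by simp)

lemma lor_fderiv_self (h : IsParam W G N) (hz : z ∈ W) (v : E2) :
    lor (fderiv ℝ G z v) (G z) = 0 := by
  have := lor_fderiv_of_eventuallyEq (h.differentiableAt hz) (h.differentiableAt hz) (c := -1)
    (by filter_upwards [h.mem_nhds hz] with y hy using (h.mem y hy).1) v
  rw [lor_comm] at this; linarith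

lemma lor_fderiv_normal_self (h : IsParam W G N) (hz : z ∈ W) (v : E2) :
    lor (fderiv ℝ N z v) (N z) = 0 := by
  have := lor_fderiv_of_eventuallyEq (h.differentiableAt_normal hz) (h.differentiableAt_normal hz)
    (c := 1) (by filter_upwards [h.mem_nhds hz] with y hy using h.unit y hy) v
  rw [lor_comm] at this; linarith

lemma lor_fderiv_normal (h : IsParam W G N) (hz : z ∈ W) (v : E2) :
    lor (fderiv ℝ N z v) (G z) = 0 := by
  have := lor_fderiv_of_eventuallyEq (h.differentiableAt_normal hz) (h.differentiableAt hz)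
    (c := 0) (by filter_upwards [h.mem_nhds hz] with y hy using h.orth y hy) v
  rw [h.normal z hz] at this; linarith

lemma fderiv_pos (h : IsParam W G N) (hz : z ∈ W) {v : E2} (hv : v ≠ 0) :
    0 < lor (fderiv ℝ G z v) (fderiv ℝ G z v) := by
  refine lt_of_le_of_ne (lor_self_nonneg (h.mem z hz) (h.lor_fderiv_self hz v)) fun h0 => hv ?_
  exact h.inj z hz (by
    rw [map_zero]; exact eq_zero_of_lor_self (h.mem z hz) (h.lor_fderiv_self hz v) h0.symm)

lemma lor_fderiv_fderiv_self (h : IsParam W G N) (hz : z ∈ W) (v w : E2) :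
    lor (fderiv ℝ (fderiv ℝ G) z v w) (G z) = -lor (fderiv ℝ G z v) (fderiv ℝ G z w) := by
  have := lor_fderiv_of_eventuallyEq ((h.contDiffAt hz).differentiableAt_fderiv_apply w)
    (h.differentiableAt hz)
    (c := 0) (by filter_upwards [h.mem_nhds hz] with y hy using h.lor_fderiv_self hy w) v
  rw [fderiv_fderiv_apply (h.contDiffAt hz), lor_comm] at this; linarith

lemma lor_fderiv_fderiv_normal (h : IsParam W G N) (hz : z ∈ W) (v w : E2) :
    lor (fderiv ℝ (fderiv ℝ G) z v w) (N z) = -lor (fderiv ℝ N z v) (fderiv ℝ G z w) := by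
  have := lor_fderiv_of_eventuallyEq ((h.contDiffAt hz).differentiableAt_fderiv_apply w)
    (h.differentiableAt_normal hz)
    (c := 0) (by filter_upwards [h.mem_nhds hz] with y hy using
      (lor_comm _ _).trans (h.normal y hy w)) v
  rw [fderiv_fderiv_apply (h.contDiffAt hz), lor_comm] at this; linarith

/-- The distance of nearby points to the tangent plane is governed by the second fundamental
form. -/
lemma eventually_two_point (h : IsParam W G N) (hz : z ∈ W) {κ σ : ℝ}
    (hpos : ∀ v ≠ 0, 0 < κ * lor (fderiv ℝ G z v) (fderiv ℝ G z v) +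
      σ * lor (fderiv ℝ N z v) (fderiv ℝ G z v)) :
    ∀ᶠ q : E2 × E2 in 𝓝 (z, z),
      σ * lor (G q.2 - G q.1) (N q.1) ≤ κ / 2 * chord (G q.1) (G q.2) := by
  -- `Q (a', a)` is half the second derivative at `a'` of the difference of the two sides.
  let Q : E2 × E2 → E2 →L[ℝ] E2 →L[ℝ] ℝ := fun q =>
    (ContinuousLinearMap.compL ℝ E2 Mink ℝ (lorL (-(κ • G q.2) - σ • N q.2))).comp
      (fderiv ℝ (fderiv ℝ G) q.1)
  have hQ : ∀ q v w, Q q v w =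
      lor (-(κ • G q.2) - σ • N q.2) (fderiv ℝ (fderiv ℝ G) q.1 v w) := fun q v w => rfl
  have hcont : ContinuousAt Q (z, z) := by
    have c1 : ContinuousAt (fun q : E2 × E2 => fderiv ℝ (fderiv ℝ G) q.1) (z, z) :=
      ContinuousAt.comp (f := Prod.fst) (g := fderiv ℝ (fderiv ℝ G))
        (h.contDiffOn_fderiv_fderiv.continuousOn.continuousAt (h.mem_nhds hz)) continuousAt_fst
    have c2 : ContinuousAt (fun q : E2 × E2 => G q.2) (z, z) :=
      ContinuousAt.comp (f := Prod.snd) (g := G) (h.contDiffAt hz).continuousAt continuousAt_snd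
    have c3 : ContinuousAt (fun q : E2 × E2 => N q.2) (z, z) :=
      ContinuousAt.comp (f := Prod.snd) (g := N) (h.contDiffAt_normal hz).continuousAt
        continuousAt_snd
    have c4 : ContinuousAt (fun q : E2 × E2 => -(κ • G q.2) - σ • N q.2) (z, z) :=
      (c2.const_smul κ).neg.sub (c3.const_smul σ)
    have c5 : ContinuousAt (fun q : E2 × E2 =>
        ContinuousLinearMap.compL ℝ E2 Mink ℝ (lorL (-(κ • G q.2) - σ • N q.2))) (z, z) :=
      ((ContinuousLinearMap.compL ℝ E2 Mink ℝ).continuous.comp lorL.continuous).continuousAt.comp c4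
    exact c5.clm_comp c1
  have hev := eventually_forall_quadratic_nonneg hcont fun v hv => by
    have := hpos v hv
    rw [hQ, lor_sub_left, lor_neg_left, lor_smul_left, lor_smul_left, lor_comm (G z),
      lor_comm (N z), h.lor_fderiv_fderiv_self hz, h.lor_fderiv_fderiv_normal hz]
    linarith
  obtain ⟨r, hr, hball⟩ := Metric.eventually_nhds_iff_ball.1
    (hev.and (prod_mem_nhds (h.mem_nhds hz) (h.mem_nhds hz)))
  have hball' : ∀ a ∈ Metric.ball z r, ∀ b ∈ Metric.ball z r, ∀ v, 0 ≤ Q (a, b) v v :=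
    fun a ha b hb => (hball (a, b) (by rw [← ball_prod_same]; exact ⟨ha, hb⟩)).1
  have hW : ∀ a ∈ Metric.ball z r, a ∈ W := fun a ha =>
    (hball (a, a) (by rw [← ball_prod_same]; exact ⟨ha, ha⟩)).2.1
  have hnb := prod_mem_nhds (Metric.ball_mem_nhds z hr) (Metric.ball_mem_nhds z hr)
  filter_upwards [hnb] with ⟨a, b⟩ ⟨ha, hb⟩
  simp only at ha hb ⊢
  set w := b - a with hw
  set ζ := -(κ • G a) - σ • N a with hζ
  have hseg : ∀ t ∈ Icc (0 : ℝ) 1, a + t • w ∈ Metric.ball z r := fun t ht =>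
    (convex_ball z r).add_smul_sub_mem ha hb ht
  have hline : ∀ t : ℝ, HasDerivAt (fun t : ℝ => a + t • w) w t := fun t => by
    simpa using ((hasDerivAt_id t).smul_const w).const_add a
  have hd1 : ∀ t ∈ Icc (0 : ℝ) 1, HasDerivAt (fun t : ℝ => lor ζ (G (a + t • w)))
      (lor ζ (fderiv ℝ G (a + t • w) w)) t := fun t ht => by
    have h1 := (h.differentiableAt (hW _ (hseg t ht))).hasFDerivAt.comp_hasDerivAt t (hline t)
    exact (lorL ζ).hasFDerivAt.comp_hasDerivAt t h1
  have hd2 : ∀ t ∈ Icc (0 : ℝ) 1, HasDerivAt (fun t : ℝ => lor ζ (fderiv ℝ G (a + t • w) w))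
      (Q (a + t • w, a) w w) t := fun t ht => by
    have h0 := (h.contDiffAt (hW _ (hseg t ht))).differentiableAt_fderiv_apply w
    have h1 := h0.hasFDerivAt.comp_hasDerivAt t (hline t)
    rw [fderiv_fderiv_apply (h.contDiffAt (hW _ (hseg t ht)))] at h1
    exact (lorL ζ).hasFDerivAt.comp_hasDerivAt t h1
  have hmono1 : ∀ t ∈ Icc (0 : ℝ) 1, 0 ≤ lor ζ (fderiv ℝ G (a + t • w) w) := fun t ht => by
    have hsub : ∀ s ∈ Icc 0 t, s ∈ Icc (0 : ℝ) 1 := fun s hs => ⟨hs.1, hs.2.trans ht.2⟩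
    have h1 := le_of_deriv_right_nonpos (f := fun t => -lor ζ (fderiv ℝ G (a + t • w) w)) ht.1
      (fun s hs => (hd2 s (hsub s hs)).neg.continuousAt.continuousWithinAt)
      (fun s hs => (hd2 s (hsub s ⟨hs.1, hs.2.le⟩)).neg.hasDerivWithinAt)
      (fun s hs => neg_nonpos.2 (hball' _ (hseg s (hsub s ⟨hs.1, hs.2.le⟩)) _ ha w))
    have h2 : lor ζ (fderiv ℝ G a w) = 0 := by
      rw [hζ, lor_sub_left, lor_neg_left, lor_smul_left, lor_smul_left, h.normal a (hW a ha),
        lor_comm (G a), h.lor_fderiv_self (hW a ha)]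
      ring
    simp only [zero_smul, add_zero, h2] at h1
    linarith
  have h1 := le_of_deriv_right_nonpos (f := fun t => -lor ζ (G (a + t • w))) zero_le_one
      (fun s hs => (hd1 s hs).neg.continuousAt.continuousWithinAt)
      (fun s hs => (hd1 s ⟨hs.1, hs.2.le⟩).neg.hasDerivWithinAt)
      (fun s hs => neg_nonpos.2 (hmono1 s ⟨hs.1, hs.2.le⟩))
  have hGa := h.mem a (hW a ha)
  have e1 : a + (1 : ℝ) • w = b := by rw [hw]; simp
  rw [e1] at h1
  simp only [zero_smul, add_zero, hζ, lor_sub_left, lor_neg_left, lor_smul_left, hGa.1,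
    h.orth a (hW a ha)] at h1
  rw [chord_eq hGa (h.mem b (hW b hb)), lor_sub_left, lor_comm (G b), lor_comm (G a) (N a),
    h.orth a (hW a ha)]
  linarith

lemma fderiv_normal_symm (h : IsParam W G N) (hz : z ∈ W) (v w : E2) :
    lor (fderiv ℝ N z v) (fderiv ℝ G z w) = lor (fderiv ℝ N z w) (fderiv ℝ G z v) := by
  have h1 := h.lor_fderiv_fderiv_normal hz v w
  have h2 := h.lor_fderiv_fderiv_normal hz w v
  rw [fderiv_fderiv_symm (h.contDiffAt hz)] at h1
  linarith

lemma _root_.Hyp3.IsCurvParam.eventually_abs_two_point (h : IsCurvParam W G N)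
    (hz : z ∈ W) {ε : ℝ} (hε : 0 < ε) :
    ∀ᶠ q : E2 × E2 in 𝓝 (z, z),
      |lor (G q.2 - G q.1) (N q.1)| ≤ (1 + ε) / 2 * chord (G q.1) (G q.2) := by
  have h1 := h.eventually_two_point hz (κ := 1 + ε) (σ := 1) fun v hv => by
    have := neg_le_of_abs_le (h.curv z hz v)
    nlinarith [h.fderiv_pos hz hv]
  have h2 := h.eventually_two_point hz (κ := 1 + ε) (σ := -1) fun v hv => by
    have := le_of_abs_le (h.curv z hz v)
    nlinarith [h.fderiv_pos hz hv]
  filter_upwards [h1, h2] with q h1 h2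
  rw [abs_le]; constructor <;> linarith

/-- The unit normal is determined up to sign by the two-point estimate. -/
lemma eq_or_eq_neg (h : IsParam W G N) (hz : z ∈ W) {w : Mink} (hw : lor w w = 1)
    (hwx : lor w (G z) = 0) (h2 : ∀ᶠ b in 𝓝 z, |lor (G b - G z) w| ≤ chord (G z) (G b)) :
    w = N z ∨ w = -N z := by
  have horth : ∀ v, lor w (fderiv ℝ G z v) = 0 := by
    intro v
    have hline : HasDerivAt (fun t : ℝ => z + t • v) v 0 := by
      simpa using ((hasDerivAt_id (0 : ℝ)).smul_const v).const_add z
    have hG : HasDerivAt (fun t : ℝ => G (z + t • v) - G z) (fderiv ℝ G z v) 0 := by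
      have h3 : HasFDerivAt G (fderiv ℝ G z) (z + (0 : ℝ) • v) := by
        simpa using (h.differentiableAt hz).hasFDerivAt
      exact (h3.comp_hasDerivAt 0 hline).sub_const _
    have hG' := hG.hasDerivWithinAt (s := univ)
    have hd1 := (hG'.lor hG').hasDerivAt univ_mem
    have hd2 := (hG'.lor (hasDerivWithinAt_const (0 : ℝ) univ w)).hasDerivAt univ_mem
    have hd := hd1.sub hd2
    have hmin : IsLocalMin (fun t : ℝ => lor (G (z + t • v) - G z) (G (z + t • v) - G z) -
        lor (G (z + t • v) - G z) w) 0 := by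
      have ht : Tendsto (fun t : ℝ => z + t • v) (𝓝 0) (𝓝 z) := by
        simpa using hline.continuousAt.tendsto
      filter_upwards [ht.eventually h2] with t ht
      rw [chord_comm] at ht
      have := le_of_abs_le ht
      simp only [zero_smul, add_zero, sub_self, lor_zero_left]
      simp only [chord] at this
      linarith
    have h0 := hmin.hasDerivAt_eq_zero hd
    simp only [zero_smul, add_zero, sub_self, lor_zero_left, lor_zero_right] at h0
    rw [lor_comm]; linarith
  have hx := h.mem z hz
  obtain ⟨c, d, v, hdec⟩ := exists_decomp hx.1 (h.unit z hz) (h.orth z hz) (h.inj z hz)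
    (h.lor_fderiv_self hz) (h.normal z hz) w
  have hc : c = 0 := by
    rw [hdec, lor_add_left, lor_add_left, lor_smul_left, lor_smul_left, hx.1, h.orth z hz,
      h.lor_fderiv_self hz] at hwx
    linarith
  have hv : fderiv ℝ G z v = 0 := by
    refine eq_zero_of_lor_self hx (h.lor_fderiv_self hz v) ?_
    have := horth v
    rw [hdec, lor_add_left, lor_add_left, lor_smul_left, lor_smul_left, h.normal z hz,
      lor_comm (G z), h.lor_fderiv_self hz] at this
    linarith
  rw [hc, hv, zero_smul, zero_add, add_zero] at hdec
  rw [hdec, lor_smul_left, lor_smul_right, h.unit z hz, mul_one] at hw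
  rcases mul_self_eq_one_iff.1 hw with hd | hd
  · left; rw [hdec, hd, one_smul]
  · right; rw [hdec, hd, neg_smul, one_smul]

end IsParam
end Hyp3

namespace Hyp3
open Set Filter Topology

/-! ### Principal curvatures -/

/-- The largest principal curvature is an eigenvalue of the shape operator: here `L` and `A` are
the differentials of the position and of the unit normal at a point. -/
lemma exists_max_principal {x ν : Mink} {L A : E2 →L[ℝ] Mink} (hx : x ∈ hyperboloid)
    (hν : lor ν ν = 1) (hνx : lor ν x = 0) (hL : Function.Injective L)
    (hLx : ∀ v, lor (L v) x = 0) (hLν : ∀ v, lor ν (L v) = 0) (hAx : ∀ v, lor (A v) x = 0)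
    (hAν : ∀ v, lor (A v) ν = 0) (hsymm : ∀ v w, lor (A v) (L w) = lor (A w) (L v)) :
    ∃ k v, v ≠ 0 ∧ A v = -(k • L v) ∧ ∀ w, -lor (A w) (L w) ≤ k * lor (L w) (L w) := by
  have hpos : ∀ v, v ≠ 0 → 0 < lor (L v) (L v) := fun v hv => by
    refine lt_of_le_of_ne (lor_self_nonneg hx (hLx v)) fun h0 => hv ?_
    exact hL (by rw [map_zero]; exact eq_zero_of_lor_self hx (hLx v) h0.symm)
  have hne : ∀ v ∈ Metric.sphere (0 : E2) 1, v ≠ 0 := by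
    rintro v hv rfl
    simp at hv
  obtain ⟨v, hv, hmax⟩ := (isCompact_sphere (0 : E2) 1).exists_isMaxOn
    (NormedSpace.sphere_nonempty.2 zero_le_one)
    (f := fun v => -lor (A v) (L v) / lor (L v) (L v))
    ((A.continuous.lor L.continuous).neg.continuousOn.div
      (L.continuous.lor L.continuous).continuousOn
      fun v hv => (hpos v (hne v hv)).ne')
  have hv0 := hne v hv
  set k := -lor (A v) (L v) / lor (L v) (L v) with hk
  have hB : ∀ w, -lor (A w) (L w) ≤ k * lor (L w) (L w) := by
    intro w
    rcases eq_or_ne w 0 with rfl | hw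
    · simp [lor_zero_left]
    have hn : 0 < ‖w‖ := norm_pos_iff.2 hw
    have h1 := hmax (show ‖w‖⁻¹ • w ∈ Metric.sphere (0 : E2) 1 by simp [norm_smul, hn.ne'])
    have h2 : -lor (A (‖w‖⁻¹ • w)) (L (‖w‖⁻¹ • w)) / lor (L (‖w‖⁻¹ • w)) (L (‖w‖⁻¹ • w)) =
        -lor (A w) (L w) / lor (L w) (L w) := by
      have := (hpos w hw).ne'
      simp only [map_smul, lor_smul_left, lor_smul_right]
      field_simp
    have h3 : -lor (A w) (L w) / lor (L w) (L w) ≤ k := by rw [← h2]; exact h1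
    rwa [div_le_iff₀ (hpos w hw)] at h3
  have hBv : -lor (A v) (L v) = k * lor (L v) (L v) := by
    rw [hk, div_mul_cancel₀ _ (hpos v hv0).ne']
  refine ⟨k, v, hv0, ?_, hB⟩
  -- The positive semidefinite form `k ⟨L w, L w⟩ + ⟨A w, L w⟩` vanishes at `v`, so `v` is in its
  -- kernel.
  have hker : ∀ w, lor (A v + k • L v) (L w) = 0 := by
    intro w
    rw [lor_add_left, lor_smul_left]
    set β := lor (A v) (L w) + k * lor (L v) (L w) with hβ
    set γ := lor (A w) (L w) + k * lor (L w) (L w) with hγ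
    have hγ0 : 0 ≤ γ := by have := hB w; linarith
    have hq : ∀ t : ℝ, 0 ≤ 2 * t * β + t ^ 2 * γ := fun t => by
      have h1 := hB (v + t • w)
      simp only [map_add, map_smul, lor_add_left, lor_add_right, lor_smul_left, lor_smul_right,
        hsymm w v, lor_comm (L w) (L v)] at h1
      rw [hβ, hγ]; linarith
    by_contra hβ0
    have h1 := hq (-β / (γ + 1))
    have h2 : 2 * (-β / (γ + 1)) * β + (-β / (γ + 1)) ^ 2 * γ =
        -(β ^ 2 * (γ + 2)) / (γ + 1) ^ 2 := by
      field_simp; ring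
    rw [h2] at h1
    have h3 : -(β ^ 2 * (γ + 2)) / (γ + 1) ^ 2 < 0 := by
      apply div_neg_of_neg_of_pos
      · have : 0 < β ^ 2 := by positivity
        nlinarith
      · positivity
    linarith
  obtain ⟨v', hv'⟩ := mem_range_of_orthogonal hx.1 hν hνx hL hLx hLν (w := A v + k • L v)
    (by rw [lor_add_left, lor_smul_left, hAx, hLx]; ring)
    (by rw [lor_add_left, lor_smul_left, hAν, lor_comm, hLν]; ring)
  have h0 : A v + k • L v = 0 := by
    rw [← hv']
    refine eq_zero_of_lor_self hx (hLx v') ?_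
    conv_lhs => enter [1]; rw [hv']
    exact hker v'
  exact eq_neg_of_add_eq_zero_left h0

/-- The Lorentzian product in an orthogonal frame adapted to a surface. -/
lemma IsParam.lor_eq {W : Set E2} {G N : E2 → Mink} {z : E2} (h : IsParam W G N) (hz : z ∈ W)
    {e₁ e₂ : E2} (h₁ : e₁ ≠ 0) (h₂ : e₂ ≠ 0)
    (h₁₂ : lor (fderiv ℝ G z e₁) (fderiv ℝ G z e₂) = 0)
    (hspan : ∀ v, ∃ a b : ℝ, v = a • e₁ + b • e₂)
    (Y Y' : Mink) : lor Y Y' = -(lor Y (G z) * lor Y' (G z)) + lor Y (N z) * lor Y' (N z) +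
      lor Y (fderiv ℝ G z e₁) * lor Y' (fderiv ℝ G z e₁) /
        lor (fderiv ℝ G z e₁) (fderiv ℝ G z e₁) +
      lor Y (fderiv ℝ G z e₂) * lor Y' (fderiv ℝ G z e₂) /
        lor (fderiv ℝ G z e₂) (fderiv ℝ G z e₂) := by
  obtain ⟨c, d, v, rfl⟩ := exists_decomp (h.mem z hz).1 (h.unit z hz) (h.orth z hz) (h.inj z hz)
    (h.lor_fderiv_self hz) (h.normal z hz) Y'
  obtain ⟨a, b, rfl⟩ := hspan v
  have p₁ := (h.fderiv_pos hz h₁).ne'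
  have p₂ := (h.fderiv_pos hz h₂).ne'
  simp only [map_add, map_smul, lor_add_left, lor_add_right, lor_smul_left, lor_smul_right,
    (h.mem z hz).1, h.unit z hz, h.orth z hz, lor_comm (G z) (N z), h.normal z hz,
    h.lor_fderiv_self hz, lor_comm (G z) (fderiv ℝ G z _), lor_comm (fderiv ℝ G z _) (N z), h₁₂,
    lor_comm (fderiv ℝ G z e₂) (fderiv ℝ G z e₁)]
  field_simp
  ring

/-- No surface in hyperbolic space has principal curvatures `1` and `-1` everywhere: by the Codazzi
equations, distinct constant principal curvatures `k₁`, `k₂` satisfy `k₁ k₂ = 1`. In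
the proof, `G + N` and `G - N` are maps into the null cone whose differentials are degenerate, with
kernels spanned by `e₁` and `e₂`. -/
lemma IsParam.not_curvature_one {W : Set E2} {G N : E2 → Mink} {z : E2} (h : IsParam W G N)
    (hz : z ∈ W)
    (hker : ∀ y ∈ W, ∃ e₁ e₂ : E2, e₁ ≠ 0 ∧ e₂ ≠ 0 ∧ fderiv ℝ N y e₁ = -fderiv ℝ G y e₁ ∧
      fderiv ℝ N y e₂ = fderiv ℝ G y e₂) : False := by
  have horth : ∀ y ∈ W, ∀ e₁ e₂, fderiv ℝ N y e₁ = -fderiv ℝ G y e₁ →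
      fderiv ℝ N y e₂ = fderiv ℝ G y e₂ → lor (fderiv ℝ G y e₁) (fderiv ℝ G y e₂) = 0 := by
    intro y hy e₁ e₂ k₁ k₂
    have := h.fderiv_normal_symm hy e₁ e₂
    rw [k₁, k₂, lor_neg_left, lor_comm (fderiv ℝ G y e₂)] at this
    linarith
  have hspan : ∀ y ∈ W, ∀ e₁ e₂ : E2, e₁ ≠ 0 → e₂ ≠ 0 →
      lor (fderiv ℝ G y e₁) (fderiv ℝ G y e₂) = 0 → ∀ v, ∃ a b : ℝ, v = a • e₁ + b • e₂ := by
    intro y hy e₁ e₂ h₁ h₂ h₁₂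
    let T : ℝ × ℝ →ₗ[ℝ] E2 := LinearMap.coprod (LinearMap.toSpanSingleton ℝ E2 e₁)
      (LinearMap.toSpanSingleton ℝ E2 e₂)
    have hT : ∀ a b, T (a, b) = a • e₁ + b • e₂ := fun a b => by simp [T]
    have hinj : Function.Injective T := by
      rw [← LinearMap.ker_eq_bot, LinearMap.ker_eq_bot']
      rintro ⟨a, b⟩ hab
      rw [hT] at hab
      have k := congrArg (fderiv ℝ G y) hab
      have k₁ := congrArg (fun Y => lor Y (fderiv ℝ G y e₁)) k
      have k₂ := congrArg (fun Y => lor Y (fderiv ℝ G y e₂)) k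
      simp only [map_add, map_smul, lor_add_left, lor_smul_left, h₁₂, map_zero, lor_zero_left,
        lor_comm (fderiv ℝ G y e₂) (fderiv ℝ G y e₁), mul_zero, add_zero, zero_add,
        mul_eq_zero, (h.fderiv_pos hy h₁).ne', (h.fderiv_pos hy h₂).ne', or_false] at k₁ k₂
      simp [k₁, k₂]
    have hsurj := (LinearMap.injective_iff_surjective_of_finrank_eq_finrank (by simp)).1 hinj
    intro v
    obtain ⟨⟨a, b⟩, hab⟩ := hsurj v
    exact ⟨a, b, by rw [← hab, hT]⟩
  set P : E2 → Mink := fun y => G y + N y with hP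
  set Q : E2 → Mink := fun y => G y - N y with hQ
  have sP : ∀ y ∈ W, ContDiffAt ℝ ∞ P y := fun y hy =>
    (h.contDiffAt hy).add (h.contDiffAt_normal hy)
  have sQ : ∀ y ∈ W, ContDiffAt ℝ ∞ Q y := fun y hy =>
    (h.contDiffAt hy).sub (h.contDiffAt_normal hy)
  have dP : ∀ y ∈ W, ∀ v, fderiv ℝ P y v = fderiv ℝ G y v + fderiv ℝ N y v := fun y hy v => by
    rw [hP, fderiv_fun_add (h.differentiableAt hy) (h.differentiableAt_normal hy)]; rfl
  have dQ : ∀ y ∈ W, ∀ v, fderiv ℝ Q y v = fderiv ℝ G y v - fderiv ℝ N y v := fun y hy v => by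
    rw [hQ, fderiv_fun_sub (h.differentiableAt hy) (h.differentiableAt_normal hy)]; rfl
  have ev : ∀ {y}, y ∈ W → ∀ {p : E2 → Prop}, (∀ y ∈ W, p y) → ∀ᶠ y' in 𝓝 y, p y' :=
    fun hy _ hp => by filter_upwards [h.mem_nhds hy] with y' hy' using hp y' hy'
  -- First-order identities.
  have f1 : ∀ y ∈ W, ∀ v, lor (fderiv ℝ P y v) (P y) = 0 := fun y hy v => by
    rw [dP y hy]
    simp only [hP, lor_add_left, lor_add_right, h.lor_fderiv_self hy, h.lor_fderiv_normal hy,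
      h.lor_fderiv_normal_self hy, lor_comm (fderiv ℝ G y v) (N y), h.normal y hy]
    ring
  have f2 : ∀ y ∈ W, ∀ v, lor (fderiv ℝ P y v) (Q y) = 0 := fun y hy v => by
    rw [dP y hy]
    simp only [hQ, lor_add_left, lor_sub_right, h.lor_fderiv_self hy, h.lor_fderiv_normal hy,
      h.lor_fderiv_normal_self hy, lor_comm (fderiv ℝ G y v) (N y), h.normal y hy]
    ring
  have f3 : ∀ y ∈ W, ∀ v, lor (fderiv ℝ Q y v) (P y) = 0 := fun y hy v => by
    rw [dQ y hy]
    simp only [hP, lor_sub_left, lor_add_right, h.lor_fderiv_self hy, h.lor_fderiv_normal hy,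
      h.lor_fderiv_normal_self hy, lor_comm (fderiv ℝ G y v) (N y), h.normal y hy]
    ring
  have f4 : ∀ y ∈ W, ∀ v, lor (fderiv ℝ Q y v) (Q y) = 0 := fun y hy v => by
    rw [dQ y hy]
    simp only [hQ, lor_sub_left, lor_sub_right, h.lor_fderiv_self hy, h.lor_fderiv_normal hy,
      h.lor_fderiv_normal_self hy, lor_comm (fderiv ℝ G y v) (N y), h.normal y hy]
    ring
  have f5 : ∀ y ∈ W, ∀ v w, lor (fderiv ℝ P y v) (fderiv ℝ Q y w) = 0 := fun y hy v w => by
    obtain ⟨e₁, e₂, h₁, h₂, k₁, k₂⟩ := hker y hy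
    have h₁₂ := horth y hy e₁ e₂ k₁ k₂
    obtain ⟨a, b, rfl⟩ := hspan y hy e₁ e₂ h₁ h₂ h₁₂ v
    obtain ⟨a', b', rfl⟩ := hspan y hy e₁ e₂ h₁ h₂ h₁₂ w
    rw [dP y hy, dQ y hy]
    simp only [map_add, map_smul, k₁, k₂, lor_add_left, lor_add_right, lor_sub_right, lor_smul_left,
      lor_smul_right, lor_neg_left, lor_neg_right, h₁₂,
      lor_comm (fderiv ℝ G y e₂) (fderiv ℝ G y e₁)]
    ring
  -- Second-order identities.
  have g1 : ∀ y ∈ W, ∀ u v, lor (fderiv ℝ (fderiv ℝ P) y u v) (P y) =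
      -lor (fderiv ℝ P y v) (fderiv ℝ P y u) := fun y hy u v => by
    have := lor_fderiv_of_eventuallyEq ((sP y hy).differentiableAt_fderiv_apply v)
      ((sP y hy).differentiableAt (by simp)) (ev hy fun y hy => f1 y hy v) u
    rw [fderiv_fderiv_apply (sP y hy)] at this; linarith
  have g2 : ∀ y ∈ W, ∀ u v, lor (fderiv ℝ (fderiv ℝ P) y u v) (Q y) = 0 := fun y hy u v => by
    have := lor_fderiv_of_eventuallyEq ((sP y hy).differentiableAt_fderiv_apply v)
      ((sQ y hy).differentiableAt (by simp)) (ev hy fun y hy => f2 y hy v) u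
    rw [fderiv_fderiv_apply (sP y hy), f5 y hy] at this; linarith
  have g3 : ∀ y ∈ W, ∀ u v, lor (fderiv ℝ (fderiv ℝ Q) y u v) (P y) = 0 := fun y hy u v => by
    have := lor_fderiv_of_eventuallyEq ((sQ y hy).differentiableAt_fderiv_apply v)
      ((sP y hy).differentiableAt (by simp)) (ev hy fun y hy => f3 y hy v) u
    rw [fderiv_fderiv_apply (sQ y hy), lor_comm (fderiv ℝ Q y v), f5 y hy] at this; linarith
  have g4 : ∀ y ∈ W, ∀ u v, lor (fderiv ℝ (fderiv ℝ Q) y u v) (Q y) =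
      -lor (fderiv ℝ Q y v) (fderiv ℝ Q y u) := fun y hy u v => by
    have := lor_fderiv_of_eventuallyEq ((sQ y hy).differentiableAt_fderiv_apply v)
      ((sQ y hy).differentiableAt (by simp)) (ev hy fun y hy => f4 y hy v) u
    rw [fderiv_fderiv_apply (sQ y hy)] at this; linarith
  have g5 : ∀ y ∈ W, ∀ u v w, lor (fderiv ℝ P y v) (fderiv ℝ (fderiv ℝ Q) y u w) +
      lor (fderiv ℝ (fderiv ℝ P) y u v) (fderiv ℝ Q y w) = 0 := fun y hy u v w => by
    have := lor_fderiv_of_eventuallyEq ((sP y hy).differentiableAt_fderiv_apply v)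
      ((sQ y hy).differentiableAt_fderiv_apply w) (ev hy fun y hy => f5 y hy v w) u
    rwa [fderiv_fderiv_apply (sP y hy), fderiv_fderiv_apply (sQ y hy)] at this
  have g6 : ∀ y ∈ W, ∀ u v w, lor (fderiv ℝ (fderiv ℝ P) y u v) (fderiv ℝ Q y w) = 0 := by
    intro y hy u v w
    obtain ⟨e₁, e₂, h₁, h₂, k₁, k₂⟩ := hker y hy
    have h₁₂ := horth y hy e₁ e₂ k₁ k₂
    have dP₁ : fderiv ℝ P y e₁ = 0 := by rw [dP y hy, k₁, add_neg_cancel]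
    have dQ₂ : fderiv ℝ Q y e₂ = 0 := by rw [dQ y hy, k₂, sub_self]
    have i1 : ∀ u w, lor (fderiv ℝ (fderiv ℝ P) y u e₁) (fderiv ℝ Q y w) = 0 := fun u w => by
      have := g5 y hy u e₁ w
      rwa [dP₁, lor_zero_left, zero_add] at this
    have i2 : ∀ u v, lor (fderiv ℝ P y v) (fderiv ℝ (fderiv ℝ Q) y u e₂) = 0 := fun u v => by
      have := g5 y hy u v e₂
      rwa [dQ₂, lor_zero_right, add_zero] at this
    have i3 : lor (fderiv ℝ (fderiv ℝ P) y e₂ e₂) (fderiv ℝ Q y e₁) = 0 := by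
      have := g5 y hy e₂ e₂ e₁
      rwa [fderiv_fderiv_symm (sQ y hy), i2, zero_add] at this
    obtain ⟨a, b, rfl⟩ := hspan y hy e₁ e₂ h₁ h₂ h₁₂ v
    obtain ⟨a', b', rfl⟩ := hspan y hy e₁ e₂ h₁ h₂ h₁₂ u
    obtain ⟨a'', b'', rfl⟩ := hspan y hy e₁ e₂ h₁ h₂ h₁₂ w
    have i4 : lor (fderiv ℝ (fderiv ℝ P) y e₁ e₂) (fderiv ℝ Q y e₁) = 0 := by
      rw [fderiv_fderiv_symm (sP y hy)]; exact i1 _ _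
    simp only [map_add, map_smul, _root_.add_apply, _root_.smul_apply, lor_add_left, lor_add_right,
      lor_smul_left, lor_smul_right, i1, dQ₂, lor_zero_right, i3, i4]
    ring
  have g7 : ∀ y ∈ W, ∀ u v w, lor (fderiv ℝ (fderiv ℝ Q) y u w) (fderiv ℝ P y v) = 0 :=
    fun y hy u v w => by
      have := g5 y hy u v w
      rwa [g6 y hy, add_zero, lor_comm] at this
  -- The third-order identity, at `z` and with `u = e₁, e₂`, compares two second-order terms.
  have k3 : ∀ u v w t, lor (fderiv ℝ (fderiv ℝ P) z v w) (fderiv ℝ (fderiv ℝ Q) z u t) +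
      lor (fderiv ℝ (fderiv ℝ (fderiv ℝ P)) z u v w) (fderiv ℝ Q z t) = 0 := fun u v w t => by
    have := lor_fderiv_of_eventuallyEq ((sP z hz).differentiableAt_fderiv_fderiv_apply v w)
      ((sQ z hz).differentiableAt_fderiv_apply t) (ev hz fun y hy => g6 y hy v w t) u
    rwa [fderiv_fderiv_fderiv_apply (sP z hz), fderiv_fderiv_apply (sQ z hz)] at this
  obtain ⟨e₁, e₂, h₁, h₂, k₁, k₂⟩ := hker z hz
  have h₁₂ := horth z hz e₁ e₂ k₁ k₂
  have hfr := h.lor_eq hz h₁ h₂ h₁₂ (hspan z hz e₁ e₂ h₁ h₂ h₁₂)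
  have dP₁ : fderiv ℝ P z e₁ = 0 := by rw [dP z hz, k₁, add_neg_cancel]
  have dQ₂ : fderiv ℝ Q z e₂ = 0 := by rw [dQ z hz, k₂, sub_self]
  have dP₂ : fderiv ℝ P z e₂ = (2 : ℝ) • fderiv ℝ G z e₂ := by rw [dP z hz, k₂, two_smul]
  have dQ₁ : fderiv ℝ Q z e₁ = (2 : ℝ) • fderiv ℝ G z e₁ := by
    rw [dQ z hz, k₁, sub_neg_eq_add, two_smul]
  have key : lor (fderiv ℝ (fderiv ℝ P) z e₂ e₂) (fderiv ℝ (fderiv ℝ Q) z e₁ e₁) =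
      lor (fderiv ℝ (fderiv ℝ P) z e₁ e₂) (fderiv ℝ (fderiv ℝ Q) z e₂ e₁) := by
    have l1 := k3 e₁ e₂ e₂ e₁
    have l2 := k3 e₂ e₁ e₂ e₁
    rw [fderiv_fderiv_symm ((sP z hz).fderiv_right (m := ∞) (by simp))] at l1
    linarith
  -- Coordinates of the second derivatives in the frame `G`, `N`, `dG e₁`, `dG e₂`.
  have cG : ∀ Y, lor Y (G z) = (lor Y (P z) + lor Y (Q z)) / 2 := fun Y => by
    simp only [hP, hQ, lor_add_right, lor_sub_right]; ring
  have cN : ∀ Y, lor Y (N z) = (lor Y (P z) - lor Y (Q z)) / 2 := fun Y => by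
    simp only [hP, hQ, lor_add_right, lor_sub_right]; ring
  have c1 : ∀ u v, lor (fderiv ℝ (fderiv ℝ P) z u v) (fderiv ℝ G z e₁) = 0 := fun u v => by
    have := g6 z hz u v e₁
    rw [dQ₁, lor_smul_right] at this; linarith
  have c2 : ∀ u v, lor (fderiv ℝ (fderiv ℝ Q) z u v) (fderiv ℝ G z e₂) = 0 := fun u v => by
    have := g7 z hz u e₂ v
    rw [dP₂, lor_smul_right] at this; linarith
  rw [hfr, hfr (fderiv ℝ (fderiv ℝ P) z e₁ e₂)] at key
  simp only [cG, cN, c1, c2, g1 z hz, g2 z hz, g3 z hz, g4 z hz, dP₁, dQ₂, dP₂, dQ₁,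
    lor_zero_right, lor_smul_left, lor_smul_right] at key
  have p₁ := h.fderiv_pos hz h₁
  have p₂ := h.fderiv_pos hz h₂
  have p := mul_pos p₁ p₂
  simp only [zero_mul, mul_zero, zero_div, add_zero, neg_zero, sub_zero, zero_add, zero_sub] at key
  nlinarith

/-- A surface with principal curvatures in `[-1, 1]` has a point at which, with respect to one of
its sides, the principal curvatures are smaller than `1`. -/
lemma IsCurvParam.exists_strict {W : Set E2} {G N : E2 → Mink} {z : E2} (h : IsCurvParam W G N)
    (hz : z ∈ W) : ∃ y ∈ W, ∃ σ κ : ℝ, σ ^ 2 = 1 ∧ κ < 1 ∧ ∀ v ≠ 0,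
      0 < κ * lor (fderiv ℝ G y v) (fderiv ℝ G y v) +
        σ * lor (fderiv ℝ N y v) (fderiv ℝ G y v) := by
  by_contra! hcon
  refine h.toIsParam.not_curvature_one hz fun y hy => ?_
  obtain ⟨k, v, hv, hkv, hmax⟩ := exists_max_principal (A := fderiv ℝ N y) (h.mem y hy)
    (h.unit y hy) (h.orth y hy) (h.inj y hy) (h.lor_fderiv_self hy) (h.normal y hy)
    (h.lor_fderiv_normal hy) (h.lor_fderiv_normal_self hy) (h.fderiv_normal_symm hy)
  obtain ⟨k', v', hv', hkv', hmax'⟩ := exists_max_principal (A := -fderiv ℝ N y) (h.mem y hy)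
    (h.unit y hy) (h.orth y hy) (h.inj y hy) (h.lor_fderiv_self hy) (h.normal y hy)
    (fun v => by simp [lor_neg_left, h.lor_fderiv_normal hy])
    (fun v => by simp [lor_neg_left, h.lor_fderiv_normal_self hy])
    (fun v w => by simp [lor_neg_left, h.fderiv_normal_symm hy v w])
  simp only [_root_.neg_apply, lor_neg_left, neg_neg] at hmax' hkv'
  have hk : k = 1 := by
    refine le_antisymm ?_ (not_lt.1 fun hlt => ?_)
    · have := neg_le_of_abs_le (h.curv y hy v)
      rw [hkv, lor_neg_left, lor_smul_left] at this
      have hp := h.fderiv_pos hy hv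
      by_contra hc
      nlinarith
    · obtain ⟨w, hw, hle⟩ := hcon y hy 1 ((k + 1) / 2) (by norm_num) (by linarith)
      nlinarith [hmax w, h.fderiv_pos hy hw]
  have hk' : k' = 1 := by
    refine le_antisymm ?_ (not_lt.1 fun hlt => ?_)
    · have := le_of_abs_le (h.curv y hy v')
      rw [neg_inj.1 hkv', lor_smul_left] at this
      have hp := h.fderiv_pos hy hv'
      by_contra hc
      nlinarith
    · obtain ⟨w, hw, hle⟩ := hcon y hy (-1) ((k' + 1) / 2) (by norm_num) (by linarith)
      nlinarith [hmax' w, h.fderiv_pos hy hw]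
  rw [hk, one_smul] at hkv
  rw [hk', one_smul] at hkv'
  exact ⟨v, v', hv, hv', hkv, neg_inj.1 hkv'⟩

end Hyp3

namespace Hyp3
open Set Filter Topology

/-! ### Surfaces with smooth charts -/

/-- The tangential part of a constant vector field, in coordinates. -/
lemma IsParam.exists_field {W : Set E2} {G N : E2 → Mink} (h : IsParam W G N) (ξ : Mink) :
    ∃ V : E2 → E2, ContDiffOn ℝ ∞ V W ∧
      ∀ z ∈ W, fderiv ℝ G z (V z) = ξ + lor (G z) ξ • G z - lor (N z) ξ • N z := by
  let M : E2 → (E2 × ℝ × ℝ →L[ℝ] Mink) := fun z =>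
    (fderiv ℝ G z).comp (ContinuousLinearMap.fst ℝ E2 (ℝ × ℝ)) +
      (((ContinuousLinearMap.fst ℝ ℝ ℝ).comp (ContinuousLinearMap.snd ℝ E2 (ℝ × ℝ))).smulRight (G z)
      + ((ContinuousLinearMap.snd ℝ ℝ ℝ).comp
          (ContinuousLinearMap.snd ℝ E2 (ℝ × ℝ))).smulRight (N z))
  have hMapp : ∀ z v, M z v = fderiv ℝ G z v.1 + (v.2.1 • G z + v.2.2 • N z) := fun z v => rfl
  have hM : ContDiffOn ℝ ∞ M W :=
    (h.contDiffOn_fderiv.clm_comp contDiffOn_const).add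
      ((contDiffOn_const.smulRight h.smooth).add (contDiffOn_const.smulRight h.smooth_normal))
  have hsurj : ∀ z ∈ W, Function.Surjective (M z) := fun z hz w => by
    obtain ⟨c, d, v, hdec⟩ := exists_decomp (h.mem z hz).1 (h.unit z hz) (h.orth z hz) (h.inj z hz)
      (h.lor_fderiv_self hz) (h.normal z hz) w
    exact ⟨(v, c, d), by rw [hMapp, hdec]; abel⟩
  have hdim : Module.finrank ℝ (E2 × ℝ × ℝ) = Module.finrank ℝ Mink := by
    simp [Module.finrank_prod]
  have hequiv : ∀ z ∈ W, ∃ e : (E2 × ℝ × ℝ) ≃L[ℝ] Mink, (e : E2 × ℝ × ℝ →L[ℝ] Mink) = M z :=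
    fun z hz => by
      have hbij : Function.Bijective (M z).toLinearMap :=
        ⟨(LinearMap.injective_iff_surjective_of_finrank_eq_finrank hdim).2 (hsurj z hz),
          hsurj z hz⟩
      refine ⟨(LinearEquiv.ofBijective _ hbij).toContinuousLinearEquiv, ?_⟩
      ext v <;> rfl
  refine ⟨fun z => (ContinuousLinearMap.inverse (M z) ξ).1, fun z hz => ?_, fun z hz => ?_⟩
  · obtain ⟨e, he⟩ := hequiv z hz
    have h1 : ContDiffAt ℝ ∞ ContinuousLinearMap.inverse (M z) := he ▸ contDiffAt_map_inverse e
    have h2 := h1.comp_contDiffWithinAt z (hM z hz)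
    exact (h2.clm_apply contDiffWithinAt_const).fst
  · obtain ⟨e, he⟩ := hequiv z hz
    set v := ContinuousLinearMap.inverse (M z) ξ with hv
    have h1 : M z v = ξ := by
      rw [hv, ← he, ContinuousLinearMap.inverse_equiv]
      exact e.apply_symm_apply ξ
    rw [hMapp] at h1
    have hx := h.mem z hz
    have hc : lor (G z) ξ = -v.2.1 := by
      rw [lor_comm, ← h1]
      simp only [lor_add_left, lor_smul_left, hx.1, h.orth z hz, h.lor_fderiv_self hz]
      ring
    have hd : lor (N z) ξ = v.2.2 := by
      rw [← h1]
      simp only [lor_add_right, lor_smul_right, h.unit z hz, h.orth z hz, h.normal z hz]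
      ring
    rw [hc, hd]
    nth_rw 2 [← h1]
    module

/-- Solutions of an autonomous equation given by a smooth vector field exist for all time if the
equation is only required inside a ball. -/
lemma exists_integral_curve_in_ball {V : E2 → E2} {W : Set E2} (hW : IsOpen W)
    (hV : ContDiffOn ℝ ∞ V W) {z₀ : E2} {r : ℝ} (hr : 0 < r)
    (hball : Metric.closedBall z₀ (2 * r) ⊆ W) (z₁ : E2) {τ : ℝ} (hτ : 0 < τ) :
    ∃ c : ℝ → E2, c 0 = z₁ ∧ ContinuousOn c (Icc 0 τ) ∧
      ∀ t ∈ Ico 0 τ, c t ∈ Metric.closedBall z₀ r → HasDerivWithinAt c (V (c t)) (Ici t) t := by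
  let b : ContDiffBump z₀ := ⟨r, 2 * r, hr, by linarith⟩
  let V' : E2 → E2 := fun z => b z • V z
  have hsupp : ∀ z, z ∉ Metric.closedBall z₀ (2 * r) → V' z = 0 := fun z hz => by
    have : b z = 0 := by
      rw [b.zero_of_le_dist]
      exact (not_le.1 hz).le
    simp [V', this]
  have hV' : ContDiff ℝ 1 V' := by
    rw [contDiff_iff_contDiffAt]
    intro z
    by_cases hz : z ∈ Metric.closedBall z₀ (2 * r)
    · have h1 := (hV.contDiffAt (hW.mem_nhds (hball hz))).of_le (m := 1) (by simp)
      exact b.contDiffAt.smul h1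
    · refine (contDiffAt_const (c := (0 : E2))).congr_of_eventuallyEq ?_
      filter_upwards [Metric.isClosed_closedBall.isOpen_compl.mem_nhds hz] with y hy
      exact hsupp y hy
  have hcomp : HasCompactSupport V' :=
    HasCompactSupport.intro (isCompact_closedBall z₀ (2 * r)) hsupp
  obtain ⟨K, hK⟩ := ContDiff.lipschitzWith_of_hasCompactSupport hcomp hV' one_ne_zero
  obtain ⟨B, hB⟩ := hV'.continuous.bounded_above_of_compact_support hcomp
  have hPL : IsPicardLindelof (fun _ => V') (tmin := 0) (tmax := τ) ⟨0, le_rfl, hτ.le⟩ z₁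
      (B.toNNReal * τ.toNNReal) 0 B.toNNReal K :=
    IsPicardLindelof.of_time_independent (fun z _ => (hB z).trans (Real.le_coe_toNNReal B))
      hK.lipschitzOnWith (by simp [hτ.le])
  obtain ⟨c, hc0, hc⟩ := hPL.exists_eq_forall_mem_Icc_hasDerivWithinAt₀
  refine ⟨c, hc0, fun t ht => (hc t ht).continuousWithinAt, fun t ht hmem => ?_⟩
  have h1 := hc t ⟨ht.1, ht.2.le⟩
  have h2 : V' (c t) = V (c t) := by
    have : b (c t) = 1 := b.one_of_mem_closedBall hmem
    simp [V', this]
  rw [h2] at h1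
  exact h1.mono_of_mem_nhdsWithin (Icc_mem_nhdsGE_of_mem ht)

/-- A chart in which a map into the hyperboloid is a parametrized surface with principal curvatures
in `[-1, 1]`. -/
structure IsSurfChart {X : Type*} [TopologicalSpace X] (x : X → Mink)
    (φ : OpenPartialHomeomorph X E2) (G N : E2 → Mink) : Prop where
  param : IsCurvParam φ.target G N
  eq : ∀ z ∈ φ.target, x (φ.symm z) = G z

/-- A round disc in a chart that contains the marked point `y`, embedded by the position, whose
boundary circle is at chordal squared distance at least `ρ` from `y`. -/
structure IsDisc {X : Type*} [TopologicalSpace X] (x : X → Mink) (ρ : ℝ) (y : X)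
    (φ : OpenPartialHomeomorph X E2) (G N : E2 → Mink) (z₀ : E2) (r : ℝ) : Prop
    extends IsSurfChart x φ G N where
  mem_source : y ∈ φ.source
  pos : 0 < r
  subset : Metric.closedBall z₀ (2 * r) ⊆ φ.target
  mem_ball : φ y ∈ Metric.ball z₀ r
  injOn : InjOn G (Metric.closedBall z₀ r)
  sphere : ∀ z ∈ Metric.sphere z₀ r, ρ ≤ chord (x y) (G z)

lemma IsDisc.mono {X : Type*} [TopologicalSpace X] {x : X → Mink} {ρ ρ' : ℝ} {y : X}
    {φ : OpenPartialHomeomorph X E2} {G N : E2 → Mink} {z₀ : E2} {r : ℝ}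
    (h : IsDisc x ρ y φ G N z₀ r) (hρ : ρ' ≤ ρ) : IsDisc x ρ' y φ G N z₀ r :=
  { h with sphere := fun z hz => hρ.trans (h.sphere z hz) }

namespace CurvSurface

variable {X : Type*} [TopologicalSpace X] {S : CurvSurface X} {ξ : Mink}
  {φ : OpenPartialHomeomorph X E2} {G N : E2 → Mink}

variable (S φ G N) in
/-- A smooth chart of the surface, in which the position and the unit normal are `G` and `±N`. -/
structure IsChart : Prop extends IsSurfChart S.x φ G N where
  normal : ∀ z ∈ φ.target, S.ν (φ.symm z) = N z ∨ S.ν (φ.symm z) = -N z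

namespace IsChart

lemma neg_grad (h : S.IsChart φ G N) {z : E2} (hz : z ∈ φ.target) :
    -S.grad ξ (φ.symm z) = ξ + lor (G z) ξ • G z - lor (N z) ξ • N z := by
  rw [grad, u, n, h.eq z hz]
  rcases h.normal z hz with h1 | h1 <;> rw [h1]
  · module
  · rw [lor_neg_left]; module

lemma gsq_eq (h : S.IsChart φ G N) {z : E2} (hz : z ∈ φ.target) :
    S.gsq ξ (φ.symm z) = lor (G z) ξ ^ 2 - lor (N z) ξ ^ 2 := by
  rw [gsq, u, n, h.eq z hz]
  rcases h.normal z hz with h1 | h1 <;> rw [h1]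
  · ring
  · rw [lor_neg_left]; ring

lemma abs_n (h : S.IsChart φ G N) {z : E2} (hz : z ∈ φ.target) :
    |S.n ξ (φ.symm z)| = |lor (N z) ξ| := by
  rw [n]
  rcases h.normal z hz with h1 | h1 <;> rw [h1]
  · rw [abs_neg]
  · rw [lor_neg_left, neg_neg]

/-- Integral curves in coordinates are trajectories. -/
lemma isTraj (h : S.IsChart φ G N) (hξ : IsNull ξ) {V : E2 → E2}
    (hV : ∀ z ∈ φ.target, fderiv ℝ G z (V z) = ξ + lor (G z) ξ • G z - lor (N z) ξ • N z)
    {T : ℝ} {c : ℝ → E2} (hc : ContinuousOn c (Icc 0 T)) (hm : ∀ t ∈ Icc 0 T, c t ∈ φ.target)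
    (hd : ∀ t ∈ Ico 0 T, HasDerivWithinAt c (V (c t)) (Ici t) t) :
    S.IsTraj ξ T (fun t => φ.symm (c t)) where
  cont := φ.continuousOn_symm.comp hc hm
  deriv t ht := by
    have hmt := hm t ⟨ht.1, ht.2.le⟩
    have h1 := (h.param.differentiableAt hmt).hasFDerivAt.comp_hasDerivWithinAt t (hd t ht)
    rw [hV _ hmt, ← h.neg_grad hmt] at h1
    refine h1.congr_of_eventuallyEq ?_ (h.eq _ hmt)
    filter_upwards [Icc_mem_nhdsGE_of_mem ht] with s hs using h.eq _ (hm s hs)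
  gderiv t ht := by
    have hmt := hm t ⟨ht.1, ht.2.le⟩
    have h1 := (h.param.differentiableAt hmt).hasFDerivAt.comp_hasDerivWithinAt t (hd t ht)
    have h2 := (h.param.differentiableAt_normal hmt).hasFDerivAt.comp_hasDerivWithinAt t (hd t ht)
    have hT := hV _ hmt
    set z := c t with hz
    set a := V z with ha
    have k1 := (h1.lor (hasDerivWithinAt_const t (Ici t) ξ)).pow 2
    have k2 := (h2.lor (hasDerivWithinAt_const t (Ici t) ξ)).pow 2
    have hgrad : lor (fderiv ℝ G z a) ξ = S.gsq ξ (φ.symm z) := by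
      rw [hT, ← h.neg_grad hmt, lor_neg_left, lor_grad_null hξ, neg_neg]
    have hgg : lor (fderiv ℝ G z a) (fderiv ℝ G z a) = S.gsq ξ (φ.symm z) := by
      rw [hT, ← h.neg_grad hmt, lor_neg_left, lor_neg_right, lor_grad_grad hξ, neg_neg]
    have hn : lor (fderiv ℝ N z a) ξ = lor (fderiv ℝ N z a) (fderiv ℝ G z a) := by
      conv_rhs => rw [hT]
      rw [lor_sub_right, lor_add_right, lor_smul_right, lor_smul_right,
        h.param.lor_fderiv_normal hmt, h.param.lor_fderiv_normal_self hmt]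
      ring
    have hcurv := h.param.curv z hmt a
    rw [hgg] at hcurv
    refine ⟨_, ?_, ((k1.sub k2).congr_of_eventuallyEq ?_ (h.gsq_eq hmt))⟩
    · simp only [Function.comp_apply, lor_zero_right, zero_add, ← hz, hgrad, hn]
      rw [h.abs_n hmt, u, h.eq z hmt]
      have h3 : |lor (N z) ξ * lor (fderiv ℝ N z a) (fderiv ℝ G z a)| ≤
          |lor (N z) ξ| * S.gsq ξ (φ.symm z) := by
        rw [abs_mul]; gcongr
      have h4 := neg_le_of_abs_le h3
      norm_num
      nlinarith
    · filter_upwards [Icc_mem_nhdsGE_of_mem ht] with s hs using h.gsq_eq (hm s hs)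

end IsChart

section Disc

variable {ρ : ℝ} {y : X} {z₀ : E2} {r : ℝ}

lemma _root_.Hyp3.IsDisc.closedBall_subset (h : IsDisc S.x ρ y φ G N z₀ r) :
    Metric.closedBall z₀ r ⊆ φ.target :=
  (Metric.closedBall_subset_closedBall (by linarith [h.pos])).trans h.subset

lemma _root_.Hyp3.IsDisc.isPatch [T2Space X] (h : IsDisc S.x ρ y φ G N z₀ r) :
    S.IsPatch ρ y (φ.symm '' Metric.closedBall z₀ r) := by
  have hcomp : IsCompact (φ.symm '' Metric.closedBall z₀ r) :=
    (isCompact_closedBall z₀ r).image_of_continuousOn (φ.continuousOn_symm.mono h.closedBall_subset)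
  have hopen : IsOpen (φ.symm '' Metric.ball z₀ r) :=
    φ.symm.isOpen_image_of_subset_source Metric.isOpen_ball
      (Metric.ball_subset_closedBall.trans h.closedBall_subset)
  have hsub : φ.symm '' Metric.ball z₀ r ⊆ interior (φ.symm '' Metric.closedBall z₀ r) :=
    interior_maximal (image_mono Metric.ball_subset_closedBall) hopen
  refine ⟨hcomp, mem_interior_iff_mem_nhds.1 (hsub ⟨φ y, h.mem_ball, φ.left_inv h.mem_source⟩),
    ?_, ?_⟩
  · rintro _ ⟨a, ha, rfl⟩ _ ⟨b, hb, rfl⟩ hab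
    rw [h.eq a (h.closedBall_subset ha), h.eq b (h.closedBall_subset hb)] at hab
    rw [h.injOn ha hb hab]
  · intro k hk
    obtain ⟨a, ha, rfl⟩ := hcomp.isClosed.frontier_subset hk
    rw [h.eq a (h.closedBall_subset ha)]
    refine h.sphere a ?_
    by_contra hc
    have : a ∈ Metric.ball z₀ r := lt_of_le_of_ne ha hc
    exact hk.2 (hsub ⟨a, this, rfl⟩)

/-- Trajectories that start at the marked point of a disc exist as long as they cannot have reached
its boundary. -/
lemma IsChart.exists_traj (hS : S.IsChart φ G N) (h : IsDisc S.x ρ y φ G N z₀ r)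
    (hξ : IsNull ξ) {U τ : ℝ} (hU : 0 < U)
    (hu : S.u ξ y ≤ U) (hτ : 0 < τ) (h4 : 7 * U * τ ≤ 4) (hρ : 7 * U * τ < ρ) :
    ∃ c, S.IsTraj ξ τ c ∧ c 0 = y := by
  obtain ⟨V, hV, hVeq⟩ := h.param.exists_field ξ
  obtain ⟨c, hc0, hc, hd⟩ := exists_integral_curve_in_ball h.param.isOpen hV h.pos h.subset (φ y) hτ
  have hball : ∀ t ∈ Icc 0 τ, c t ∈ Metric.ball z₀ r := by
    by_contra! hcon
    obtain ⟨t, ht, hct, hlt⟩ := exists_first_exit hc Metric.isOpen_ball hcon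
    have hclos : c t ∈ Metric.closedBall z₀ r := by
      rcases ht.1.eq_or_lt with h0 | h0
      · rw [← h0, hc0]; exact Metric.ball_subset_closedBall h.mem_ball
      · have hcl : closure (Ico 0 t) = Icc 0 t := closure_Ico h0.ne
        have h1 : c '' closure (Ico 0 t) ⊆ closure (c '' Ico 0 t) :=
          ContinuousOn.image_closure (by rw [hcl]; exact hc.mono (Icc_subset_Icc_right ht.2))
        have h2 : c t ∈ closure (c '' Ico 0 t) := h1 ⟨t, by rw [hcl]; exact ⟨ht.1, le_rfl⟩, rfl⟩
        refine closure_minimal ?_ Metric.isClosed_closedBall h2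
        rintro _ ⟨s, hs, rfl⟩
        exact Metric.ball_subset_closedBall (hlt s hs)
    have hm : ∀ s ∈ Icc 0 t, c s ∈ φ.target := fun s hs => by
      rcases hs.2.eq_or_lt with rfl | h0
      · exact h.closedBall_subset hclos
      · exact h.closedBall_subset (Metric.ball_subset_closedBall (hlt s ⟨hs.1, h0⟩))
    have htr := hS.isTraj hξ hVeq (hc.mono (Icc_subset_Icc_right ht.2)) hm fun s hs =>
      hd s ⟨hs.1, hs.2.trans_le ht.2⟩ (Metric.ball_subset_closedBall (hlt s hs))
    have hy0 : φ.symm (c 0) = y := by rw [hc0, φ.left_inv h.mem_source]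
    have h7 : 7 * U * t ≤ 7 * U * τ := by
      have := ht.2
      gcongr
    have h1 := htr.chord_le hξ hU (by rw [hy0]; exact hu) (S.mem y)
      (by rw [hy0, chord_self]; linarith) ⟨ht.1, le_rfl⟩
    rw [hy0, chord_self, h.eq _ (hm t ⟨ht.1, le_rfl⟩), chord_comm] at h1
    have h2 := h.sphere (c t) (le_antisymm hclos (not_lt.1 hct))
    linarith
  refine ⟨fun t => φ.symm (c t), hS.isTraj hξ hVeq hc
    (fun t ht => h.closedBall_subset (Metric.ball_subset_closedBall (hball t ht)))
    fun t ht => hd t ht (Metric.ball_subset_closedBall (hball t ⟨ht.1, ht.2.le⟩)), ?_⟩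
  simp only [hc0, φ.left_inv h.mem_source]

lemma _root_.Hyp3.IsDisc.exists_segment (h : IsDisc S.x ρ y φ G N z₀ r) {L : ℝ} (hL : 0 < L) :
    ∃ O ∈ 𝓝 y, ∀ a ∈ O, ∀ b ∈ O, ∃ σ : ℝ → X, ContinuousOn σ (Icc 0 1) ∧
    σ 0 = a ∧ σ 1 = b ∧ ∀ s ∈ Icc (0 : ℝ) 1, ∀ s' ∈ Icc (0 : ℝ) 1,
      chord (S.x (σ s)) (S.x (σ s')) ≤ L ^ 2 * (s' - s) ^ 2 := by
  have hyt := φ.map_source h.mem_source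
  obtain ⟨K, t, ht, hK⟩ :=
    ((h.param.contDiffAt hyt).of_le (m := 1) (by simp)).exists_lipschitzOnWith
  have hpos : 0 < L / (2 * (K + 1)) := by positivity
  obtain ⟨δ, hδ, hball⟩ := Metric.mem_nhds_iff.1 (inter_mem ht (h.param.mem_nhds hyt))
  set δ' := min δ (L / (2 * (K + 1))) with hδ'
  have hδ'0 : 0 < δ' := lt_min hδ hpos
  refine ⟨φ.source ∩ φ ⁻¹' Metric.ball (φ y) δ', ?_, fun a ha b hb => ?_⟩
  · exact φ.continuousOn.isOpen_inter_preimage φ.open_source Metric.isOpen_ball |>.mem_nhds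
      ⟨h.mem_source, Metric.mem_ball_self hδ'0⟩
  have hseg : ∀ s ∈ Icc (0 : ℝ) 1, φ a + s • (φ b - φ a) ∈ t ∩ φ.target := fun s hs =>
    hball (Metric.ball_subset_ball (min_le_left _ _)
      ((convex_ball (φ y) δ').add_smul_sub_mem ha.2 hb.2 hs))
  have hnorm : ‖φ b - φ a‖ * K ≤ L := by
    have h1 : ‖φ b - φ a‖ ≤ δ' + δ' := by
      rw [← dist_eq_norm]
      exact (dist_triangle_right _ _ (φ y)).trans
        (add_le_add (Metric.mem_ball.1 hb.2).le (Metric.mem_ball.1 ha.2).le)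
    have h2 : ‖φ b - φ a‖ ≤ L / (K + 1) := by
      have h3 : δ' + δ' ≤ L / (2 * (K + 1)) + L / (2 * (K + 1)) :=
        add_le_add (min_le_right _ _) (min_le_right _ _)
      refine h1.trans (h3.trans (le_of_eq ?_))
      field_simp; norm_num
    calc ‖φ b - φ a‖ * K ≤ L / (K + 1) * (K + 1) := by
          gcongr
          linarith
      _ = L := by field_simp
  refine ⟨fun s => φ.symm (φ a + s • (φ b - φ a)), ?_, ?_, ?_, fun s hs s' hs' => ?_⟩
  · exact φ.continuousOn_symm.comp (by fun_prop) fun s hs => (hseg s hs).2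
  · simp [φ.left_inv ha.1]
  · simp [φ.left_inv hb.1]
  · rw [h.eq _ (hseg s hs).2, h.eq _ (hseg s' hs').2, chord_comm]
    have h1 := hK.dist_le_mul _ (hseg s' hs').1 _ (hseg s hs).1
    have h2 : φ a + s' • (φ b - φ a) - (φ a + s • (φ b - φ a)) = (s' - s) • (φ b - φ a) := by module
    rw [dist_eq_norm, dist_eq_norm, h2, norm_smul, Real.norm_eq_abs] at h1
    have h3 : ‖G (φ a + s' • (φ b - φ a)) - G (φ a + s • (φ b - φ a))‖ ≤ L * |s' - s| := by
      refine h1.trans ?_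
      have := mul_le_mul_of_nonneg_right hnorm (abs_nonneg (s' - s))
      linarith
    set w := G (φ a + s' • (φ b - φ a)) - G (φ a + s • (φ b - φ a)) with hw
    have h4 : lor w w ≤ ‖w‖ ^ 2 := by
      have e1 : lor w w = ‖w.1‖ ^ 2 - w.2 * w.2 := by rw [lor, real_inner_self_eq_norm_sq]
      have e2 : ‖w.1‖ ≤ ‖w‖ := norm_fst_le w
      rw [e1]
      nlinarith [norm_nonneg w.1, mul_self_nonneg w.2]
    calc chord (G (φ a + s' • (φ b - φ a))) (G (φ a + s • (φ b - φ a))) = lor w w := rfl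
      _ ≤ ‖w‖ ^ 2 := h4
      _ ≤ (L * |s' - s|) ^ 2 := by gcongr
      _ = L ^ 2 * (s' - s) ^ 2 := by rw [mul_pow, sq_abs]

end Disc

/-- A surface with discs of uniform size around all of its points is complete. -/
lemma isComplete_of_isDisc [T2Space X] {ρ : ℝ} (hρ : 0 < ρ)

    (h : ∀ y, ∃ φ G N z₀ r, IsDisc S.x ρ y φ G N z₀ r ∧ S.IsChart φ G N) : S.IsComplete where
  patch := ⟨ρ, hρ, fun y => by
    obtain ⟨φ, G, N, z₀, r, hd, hS⟩ := h y
    exact ⟨_, hd.isPatch⟩⟩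
  flow ξ hξ U hU := by
    have hm : 0 < min ρ 4 := lt_min hρ (by norm_num)
    refine ⟨min ρ 4 / (14 * U), by positivity, fun y hu => ?_⟩
    obtain ⟨φ, G, N, z₀, r, hd, hS⟩ := h y
    have h1 : 7 * U * (min ρ 4 / (14 * U)) = min ρ 4 / 2 := by field_simp; norm_num
    refine hS.exists_traj hd hξ hU hu (by positivity) ?_ ?_
    · rw [h1]; linarith [min_le_right ρ 4]
    · rw [h1]; linarith [min_le_left ρ 4]
  segment y L hL := by
    obtain ⟨φ, G, N, z₀, r, hd, hS⟩ := h y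
    exact hd.exists_segment hL

end CurvSurface

/-- A map into the hyperboloid that has charts with principal curvatures in `[-1, 1]` is a surface
in the sense of `CurvSurface`; the normals of the charts at a point agree up to sign. -/
lemma exists_curvSurface {X : Type*} [TopologicalSpace X] {x : X → Mink} (hx : Continuous x)
    (hm : ∀ a, x a ∈ hyperboloid) (h : ∀ y, ∃ φ G N, y ∈ φ.source ∧ IsSurfChart x φ G N) :
    ∃ S : CurvSurface X, S.x = x ∧ ∀ φ G N, IsSurfChart x φ G N → S.IsChart φ G N := by
  choose φ G N hy hc using h
  have hxG : ∀ {φ : OpenPartialHomeomorph X E2} {G N}, IsSurfChart x φ G N → ∀ a ∈ φ.source,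
      x a = G (φ a) := fun {φ G N} hφ a ha => by
    rw [← hφ.eq _ (φ.map_source ha), φ.left_inv ha]
  have htwo : ∀ {φ : OpenPartialHomeomorph X E2} {G N}, IsSurfChart x φ G N → ∀ y ∈ φ.source,
      ∀ ε > 0, ∀ᶠ q : X × X in 𝓝 (y, y), q.1 ∈ φ.source ∧ q.2 ∈ φ.source ∧
        |lor (x q.2 - x q.1) (N (φ q.1))| ≤ (1 + ε) / 2 * chord (x q.1) (x q.2) := by
    intro φ G N hφ y hy ε hε
    have h1 := hφ.param.eventually_abs_two_point (φ.map_source hy) hε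
    have h2 : Tendsto (Prod.map φ φ) (𝓝 (y, y)) (𝓝 (φ y, φ y)) :=
      (φ.continuousAt hy).prodMap (φ.continuousAt hy)
    have hs : φ.source ×ˢ φ.source ∈ 𝓝 (y, y) :=
      prod_mem_nhds (φ.open_source.mem_nhds hy) (φ.open_source.mem_nhds hy)
    filter_upwards [h2.eventually h1, hs] with q hq hqs
    refine ⟨hqs.1, hqs.2, ?_⟩
    rw [hxG hφ _ hqs.1, hxG hφ _ hqs.2]
    exact hq
  have huniq : ∀ {φ : OpenPartialHomeomorph X E2} {G N}, IsSurfChart x φ G N →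
      ∀ {φ' : OpenPartialHomeomorph X E2} {G' N'}, IsSurfChart x φ' G' N' →
      ∀ y ∈ φ.source, y ∈ φ'.source → N' (φ' y) = N (φ y) ∨ N' (φ' y) = -N (φ y) := by
    intro φ G N hφ φ' G' N' hφ' y hy hy'
    have hz := φ.map_source hy
    refine hφ.param.eq_or_eq_neg hz (hφ'.param.unit _ (φ'.map_source hy')) ?_ ?_
    · rw [← hxG hφ y hy, hxG hφ' y hy']
      exact hφ'.param.orth _ (φ'.map_source hy')
    · have h1 := htwo hφ' y hy' 1 one_pos
      rw [nhds_prod_eq] at h1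
      have h2 := (Filter.Eventually.curry h1).self_of_nhds
      have h3 := φ.tendsto_symm hy
      filter_upwards [h3.eventually h2, hφ.param.mem_nhds hz] with b hb hbt
      have h4 := hb.2.2
      rw [hφ.eq b hbt, hxG hφ y hy] at h4
      norm_num at h4
      exact h4
  refine ⟨⟨x, fun y => N y (φ y y), hx, hm, fun a => (hc a).param.unit _ ((φ a).map_source (hy a)),
    fun a => ?_, fun w => ?_, fun y ε hε => ?_⟩, rfl, fun φ' G' N' h' => ⟨h', ?_⟩⟩
  · rw [hxG (hc a) a (hy a)]
    exact (hc a).param.orth _ ((φ a).map_source (hy a))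
  · rw [continuous_iff_continuousAt]
    intro y
    have h1 : ContinuousAt (fun a => lor (N y (φ y a)) w ^ 2) y := by
      have h2 : ContinuousAt (fun a => N y (φ y a)) y :=
        ContinuousAt.comp (f := φ y) (g := N y)
          ((hc y).param.contDiffAt_normal ((φ y).map_source (hy y))).continuousAt
          ((φ y).continuousAt (hy y))
      have h3 : Continuous fun v : Mink => lor v w ^ 2 := (continuous_id.lor continuous_const).pow 2
      exact h3.continuousAt.comp h2
    refine h1.congr ?_
    filter_upwards [(φ y).open_source.mem_nhds (hy y)] with a ha
    rcases huniq (hc y) (hc a) a ha (hy a) with h3 | h3 <;> rw [h3]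
    rw [lor_neg_left, neg_sq]
  · filter_upwards [htwo (hc y) y (hy y) ε hε] with q hq
    refine le_trans (le_of_eq ?_) hq.2.2
    rcases huniq (hc y) (hc q.1) q.1 hq.1 (hy q.1) with h3 | h3 <;> rw [h3]
    rw [lor_neg_right, abs_neg]
  · intro z hz
    have h3 := φ'.map_target hz
    have := huniq h' (hc (φ'.symm z)) (φ'.symm z) h3 (hy _)
    rwa [φ'.right_inv hz] at this

end Hyp3

namespace Hyp3
open Set Filter Topology

/-! ### Unit normals and principal curvatures in charts -/

lemma lor_eq_coord (x y : Mink) :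
    lor x y = x.1 0 * y.1 0 + x.1 1 * y.1 1 + x.1 2 * y.1 2 - x.2 * y.2 := by
  simp only [lor, PiLp.inner_apply, Fin.sum_univ_three, RCLike.inner_apply, conj_trivial]
  ring

/-- The minor of the matrix with rows `a`, `b`, `c` whose columns are the coordinates `f`, `g`,
`h`. -/
noncomputable def minor (f g h : Mink → ℝ) (a b c : Mink) : ℝ :=
  f a * (g b * h c - h b * g c) - g a * (f b * h c - h b * f c) + h a * (f b * g c - g b * f c)

/-- The Lorentzian cross product of three vectors, dual to the determinant. -/
noncomputable def lorCross (a b c : Mink) : Mink :=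
  (WithLp.toLp 2 ![-minor (fun x => x.1 1) (fun x => x.1 2) (fun x => x.2) a b c,
    minor (fun x => x.1 0) (fun x => x.1 2) (fun x => x.2) a b c,
    -minor (fun x => x.1 0) (fun x => x.1 1) (fun x => x.2) a b c],
    -minor (fun x => x.1 0) (fun x => x.1 1) (fun x => x.1 2) a b c)

lemma lorCross_coord (a b c : Mink) :
    (lorCross a b c).1 0 = -minor (fun x => x.1 1) (fun x => x.1 2) (fun x => x.2) a b c ∧
    (lorCross a b c).1 1 = minor (fun x => x.1 0) (fun x => x.1 2) (fun x => x.2) a b c ∧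
    (lorCross a b c).1 2 = -minor (fun x => x.1 0) (fun x => x.1 1) (fun x => x.2) a b c ∧
    (lorCross a b c).2 = -minor (fun x => x.1 0) (fun x => x.1 1) (fun x => x.1 2) a b c :=
  ⟨rfl, rfl, rfl, rfl⟩

lemma lor_lorCross_left (a b c : Mink) : lor (lorCross a b c) a = 0 := by
  obtain ⟨h0, h1, h2, h3⟩ := lorCross_coord a b c
  rw [lor_eq_coord, h0, h1, h2, h3]; simp only [minor]; ring

lemma lor_lorCross_mid (a b c : Mink) : lor (lorCross a b c) b = 0 := by
  obtain ⟨h0, h1, h2, h3⟩ := lorCross_coord a b c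
  rw [lor_eq_coord, h0, h1, h2, h3]; simp only [minor]; ring

lemma lor_lorCross_right (a b c : Mink) : lor (lorCross a b c) c = 0 := by
  obtain ⟨h0, h1, h2, h3⟩ := lorCross_coord a b c
  rw [lor_eq_coord, h0, h1, h2, h3]; simp only [minor]; ring

/-- The squared length of the cross product is minus the Gram determinant. -/
lemma lor_lorCross_self (a b c : Mink) : lor (lorCross a b c) (lorCross a b c) =
    -(lor a a * (lor b b * lor c c - lor b c ^ 2)
      - lor a b * (lor a b * lor c c - lor b c * lor a c)
      + lor a c * (lor a b * lor b c - lor b b * lor a c)) := by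
  obtain ⟨h0, h1, h2, h3⟩ := lorCross_coord a b c
  rw [lor_eq_coord (lorCross a b c), h0, h1, h2, h3]; simp only [lor_eq_coord, minor]; ring

lemma _root_.ContDiffOn.lorCross {W : Set E2} {A B C : E2 → Mink} (hA : ContDiffOn ℝ ∞ A W)
    (hB : ContDiffOn ℝ ∞ B W) (hC : ContDiffOn ℝ ∞ C W) :
    ContDiffOn ℝ ∞ (fun z => lorCross (A z) (B z) (C z)) W := by
  have ha := contDiffOn_euclidean.1 hA.fst
  have hb := contDiffOn_euclidean.1 hB.fst
  have hc := contDiffOn_euclidean.1 hC.fst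
  have hm : ∀ {f g h : Mink → ℝ}, (∀ {D : E2 → Mink}, ContDiffOn ℝ ∞ D W →
      ContDiffOn ℝ ∞ (fun z => f (D z)) W) → (∀ {D : E2 → Mink}, ContDiffOn ℝ ∞ D W →
      ContDiffOn ℝ ∞ (fun z => g (D z)) W) → (∀ {D : E2 → Mink}, ContDiffOn ℝ ∞ D W →
      ContDiffOn ℝ ∞ (fun z => h (D z)) W) →
      ContDiffOn ℝ ∞ (fun z => minor f g h (A z) (B z) (C z)) W := fun hf hg hh =>
    (((hf hA).mul (((hg hB).mul (hh hC)).sub ((hh hB).mul (hg hC)))).sub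
      ((hg hA).mul (((hf hB).mul (hh hC)).sub ((hh hB).mul (hf hC))))).add
      ((hh hA).mul (((hf hB).mul (hg hC)).sub ((hg hB).mul (hf hC))))
  have hs : ∀ i : Fin 3, ∀ {D : E2 → Mink}, ContDiffOn ℝ ∞ D W →
      ContDiffOn ℝ ∞ (fun z => (D z).1 i) W := fun i D hD => contDiffOn_euclidean.1 hD.fst i
  have ht : ∀ {D : E2 → Mink}, ContDiffOn ℝ ∞ D W → ContDiffOn ℝ ∞ (fun z => (D z).2) W :=
    fun hD => hD.snd
  refine ContDiffOn.prodMk (contDiffOn_euclidean.2 fun i => ?_) ?_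
  · fin_cases i
    · exact (hm (f := fun x => x.1 1) (g := fun x => x.1 2) (h := fun x => x.2)
        (hs 1) (hs 2) ht).neg
    · exact hm (f := fun x => x.1 0) (g := fun x => x.1 2) (h := fun x => x.2) (hs 0) (hs 2) ht
    · exact (hm (f := fun x => x.1 0) (g := fun x => x.1 1) (h := fun x => x.2)
        (hs 0) (hs 1) ht).neg
  · exact (hm (f := fun x => x.1 0) (g := fun x => x.1 1) (h := fun x => x.1 2)
      (hs 0) (hs 1) (hs 2)).neg

/-- A parametrized surface in the hyperboloid has a smooth unit normal. -/
lemma exists_isParam {W : Set E2} {G : E2 → Mink} (hW : IsOpen W) (hG : ContDiffOn ℝ ∞ G W)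
    (hm : ∀ z ∈ W, G z ∈ hyperboloid) (hinj : ∀ z ∈ W, Function.Injective (fderiv ℝ G z)) :
    ∃ N, IsParam W G N := by
  let e : Fin 2 → E2 := fun i => EuclideanSpace.single i 1
  have hspan : ∀ v : E2, v = v 0 • e 0 + v 1 • e 1 := fun v => by
    ext i; fin_cases i <;> simp [e]
  have hdG : ContDiffOn ℝ ∞ (fderiv ℝ G) W := hG.fderiv_of_isOpen hW (by simp)
  let n : E2 → Mink := fun z => lorCross (fderiv ℝ G z (e 0)) (fderiv ℝ G z (e 1)) (G z)
  have hn : ContDiffOn ℝ ∞ n W := ContDiffOn.lorCross (hdG.clm_apply contDiffOn_const)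
    (hdG.clm_apply contDiffOn_const) hG
  have horth : ∀ z ∈ W, ∀ v, lor (fderiv ℝ G z v) (G z) = 0 := fun z hz v => by
    have hd := (hG.contDiffAt (hW.mem_nhds hz)).differentiableAt (by simp)
    have := lor_fderiv_of_eventuallyEq hd hd (c := -1)
      (by filter_upwards [hW.mem_nhds hz] with y hy using (hm y hy).1) v
    rw [lor_comm] at this; linarith
  have hpos : ∀ z ∈ W, 0 < lor (n z) (n z) := fun z hz => by
    have hp : ∀ v, v ≠ 0 → 0 < lor (fderiv ℝ G z v) (fderiv ℝ G z v) := fun v hv => by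
      refine lt_of_le_of_ne (lor_self_nonneg (hm z hz) (horth z hz v)) fun h0 => hv ?_
      exact hinj z hz (by
        rw [map_zero]; exact eq_zero_of_lor_self (hm z hz) (horth z hz v) h0.symm)
    have hne : ∀ s t : ℝ, s ≠ 0 ∨ t ≠ 0 → s • e 0 + t • e 1 ≠ 0 := fun s t hst h0 => by
      have h1 := congrArg (fun v : E2 => v 0) h0
      have h2 := congrArg (fun v : E2 => v 1) h0
      simp [e] at h1 h2
      simp [h1, h2] at hst
    have hb := hp (e 1) (by simpa using hne 0 1 (by simp))
    set a := fderiv ℝ G z (e 0) with ha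
    set b := fderiv ℝ G z (e 1) with hb'
    have hab := hp _ (hne (lor b b) (-lor a b) (Or.inl hb.ne'))
    simp only [map_add, map_smul, ← ha, ← hb', lor_add_left, lor_add_right, lor_smul_left,
      lor_smul_right, lor_comm b a] at hab
    have hab' : 0 < lor b b * (lor a a * lor b b - lor a b ^ 2) := by nlinarith
    have := pos_of_mul_pos_right hab' hb.le
    have hax : lor a (G z) = 0 := horth z hz _
    have hbx : lor b (G z) = 0 := horth z hz _
    simp only [n, lor_lorCross_self, (hm z hz).1, ← ha, ← hb', hax, hbx]
    linarith
  refine ⟨fun z => (√(lor (n z) (n z)))⁻¹ • n z, hW, hG, ?_, hm, fun z hz => ?_, fun z hz => ?_,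
    fun z hz v => ?_, hinj⟩
  · exact (((hn.lor hn).sqrt fun z hz => (hpos z hz).ne').inv fun z hz =>
      (Real.sqrt_pos.2 (hpos z hz)).ne').smul hn
  · have h1 := hpos z hz
    have h2 := Real.sq_sqrt h1.le
    have h3 := Real.sqrt_pos.2 h1
    simp only [lor_smul_left, lor_smul_right]
    field_simp
    exact h2.symm
  · rw [lor_smul_left, lor_lorCross_right, mul_zero]
  · rw [hspan v]
    simp only [map_add, map_smul, lor_smul_left, lor_add_right, lor_smul_right, n,
      lor_lorCross_left, lor_lorCross_mid, mul_zero, add_zero]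

section Chart

variable {S : Type*} [TopologicalSpace S] [ChartedSpace E2 S] [IsManifold (𝓡 2) ∞ S]
  {e : OpenPartialHomeomorph S E2}

/-- The differential of a chart turns the differential `diff` into the derivative in the chart. -/
lemma exists_tangent_equiv (he : e ∈ atlas E2 S) {y : S} (hy : y ∈ e.source) :
    ∃ L : TangentSpace (𝓡 2) y ≃L[ℝ] E2, ∀ (h : E2 → Mink) (H : S → Mink),
      DifferentiableAt ℝ h (e y) → H =ᶠ[𝓝 y] h ∘ e →
        ∀ v, diff H y v = fderiv ℝ h (e y) (L v) := by
  have : IsManifold (𝓡 2) 1 S := IsManifold.of_le (n := ∞) (by simp)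
  have hmd : e.MDifferentiable (𝓡 2) (𝓡 2) := mdifferentiable_of_mem_atlas he
  refine ⟨hmd.mfderiv hy, fun h H hh hH v => ?_⟩
  have h1 : MDifferentiableAt (𝓡 2) 𝓘(ℝ, Mink) h (e y) := hh.mdifferentiableAt
  rw [diff, hH.mfderiv_eq, mfderiv_comp y h1 (hmd.mdifferentiableAt hy), mfderiv_eq_fderiv]
  rfl

variable {Γ : Subgroup isomH3} {f : S → HypQuotient Γ} {U : Set S} {F : S → H3} {W : Set E2}

lemma IsImmersedLiftOn.contDiffOn (hF : IsImmersedLiftOn f U F) (he : e ∈ atlas E2 S)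
    (hWt : W ⊆ e.target) (hWU : ∀ z ∈ W, e.symm z ∈ U) :
    ContDiffOn ℝ ∞ (fun z => (F (e.symm z) : Mink)) W := by
  rw [← contMDiffOn_iff_contDiffOn]
  exact hF.smooth.comp ((contMDiffOn_symm_of_mem_maximalAtlas
    (IsManifold.subset_maximalAtlas he)).mono hWt) hWU

omit [ChartedSpace E2 S] [IsManifold (𝓡 2) ∞ S] in
lemma eventuallyEq_comp_chart (F : S → H3) {z : E2} (hz : z ∈ e.target) :
    (fun y => (F y : Mink)) =ᶠ[𝓝 (e.symm z)] (fun z => (F (e.symm z) : Mink)) ∘ e := by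
  filter_upwards [e.open_source.mem_nhds (e.map_target hz)] with y hy
  simp [e.left_inv hy]

lemma IsImmersedLiftOn.fderiv_injective (hF : IsImmersedLiftOn f U F) (he : e ∈ atlas E2 S)
    (hW : IsOpen W) (hWt : W ⊆ e.target) (hWU : ∀ z ∈ W, e.symm z ∈ U) {z : E2} (hz : z ∈ W) :
    Function.Injective (fderiv ℝ (fun z => (F (e.symm z) : Mink)) z) := by
  obtain ⟨L, hL⟩ := exists_tangent_equiv he (e.map_target (hWt hz))
  have hd := ((hF.contDiffOn he hWt hWU).contDiffAt (hW.mem_nhds hz)).differentiableAt (by simp)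
  have h1 := hL _ _ (by rw [e.right_inv (hWt hz)]; exact hd) (eventuallyEq_comp_chart F (hWt hz))
  rw [e.right_inv (hWt hz)] at h1
  intro v w hvw
  have h2 := hF.immersion _ (hWU z hz) (a₁ := L.symm v) (a₂ := L.symm w) (by
    rw [h1, h1, L.apply_symm_apply, L.apply_symm_apply, hvw])
  exact L.symm.injective h2

/-- In a chart, one of the principal curvatures bounds the second fundamental form from above. -/
lemma IsImmersedLiftOn.exists_isPrincipalCurvature (hF : IsImmersedLiftOn f U F)
    (he : e ∈ atlas E2 S) (hWt : W ⊆ e.target) (hWU : ∀ z ∈ W, e.symm z ∈ U) {N : E2 → Mink}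
    (h : IsParam W (fun z => (F (e.symm z) : Mink)) N) {z : E2} (hz : z ∈ W) :
    ∃ k, IsPrincipalCurvature f (e.symm z) k ∧ ∀ w,
      -lor (fderiv ℝ N z w) (fderiv ℝ (fun z => (F (e.symm z) : Mink)) z w) ≤
        k * lor (fderiv ℝ (fun z => (F (e.symm z) : Mink)) z w)
          (fderiv ℝ (fun z => (F (e.symm z) : Mink)) z w) := by
  set G : E2 → Mink := fun z => (F (e.symm z) : Mink) with hG
  obtain ⟨k, v, hv, hA, hk⟩ := exists_max_principal (h.mem z hz) (h.unit z hz) (h.orth z hz)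
    (h.inj z hz) (h.lor_fderiv_self hz) (h.normal z hz) (h.lor_fderiv_normal hz)
    (h.lor_fderiv_normal_self hz) (h.fderiv_normal_symm hz)
  refine ⟨k, ?_, hk⟩
  have hopen : IsOpen (e.source ∩ e ⁻¹' W) := e.isOpen_inter_preimage h.isOpen
  have hsub : e.source ∩ e ⁻¹' W ⊆ U := fun y hy => by
    have := hWU (e y) hy.2
    rwa [e.left_inv hy.1] at this
  have hF' : ∀ y ∈ e.source ∩ e ⁻¹' W,
      (fun y => (F y : Mink)) =ᶠ[𝓝 y] G ∘ e := fun y hy => by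
    have := eventuallyEq_comp_chart F (hWt hy.2)
    rwa [e.left_inv hy.1] at this
  have hmem : e.symm z ∈ e.source ∩ e ⁻¹' W :=
    ⟨e.map_target (hWt hz), by rw [mem_preimage, e.right_inv (hWt hz)]; exact hz⟩
  obtain ⟨L, hL⟩ := exists_tangent_equiv he hmem.1
  have hez := e.right_inv (hWt hz)
  refine ⟨e.source ∩ e ⁻¹' W, F, N ∘ e, hmem, ⟨hopen, fun y hy => hF.lift y (hsub hy),
    hF.smooth.mono hsub, fun y hy => hF.immersion y (hsub hy)⟩, ⟨?_, ?_, ?_, ?_⟩, L.symm v, ?_, ?_⟩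
  · exact (contMDiffOn_iff_contDiffOn.2 h.smooth_normal).comp
      ((contMDiffOn_of_mem_maximalAtlas (IsManifold.subset_maximalAtlas he)).mono
        inter_subset_left) inter_subset_right
  · intro y hy
    have := h.orth _ hy.2
    simpa [hG, e.left_inv hy.1] using this
  · exact fun y hy => h.unit _ hy.2
  · intro y hy w
    obtain ⟨L', hL'⟩ := exists_tangent_equiv he hy.1
    rw [hL' G _ (h.differentiableAt hy.2) (hF' y hy)]
    exact h.normal _ hy.2 _
  · simpa using hv
  · rw [hL N (N ∘ e) (by rw [hez]; exact h.differentiableAt_normal hz) (EventuallyEq.refl _ _),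
      hL G _ (by rw [hez]; exact h.differentiableAt hz) (hF' _ hmem), L.apply_symm_apply, hez]
    exact hA

lemma IsParam.neg {G N : E2 → Mink} (h : IsParam W G N) : IsParam W G (fun z => -N z) :=
  { h with
    smooth_normal := h.smooth_normal.neg
    unit := fun z hz => by rw [lor_neg_left, lor_neg_right, neg_neg, h.unit z hz]
    orth := fun z hz => by rw [lor_neg_left, h.orth z hz, neg_zero]
    normal := fun z hz v => by rw [lor_neg_left, h.normal z hz, neg_zero] }

lemma IsImmersedLiftOn.isCurvParam (hF : IsImmersedLiftOn f U F)
    (hk : ∀ (s : S) (k : ℝ), IsPrincipalCurvature f s k → k ∈ Icc (-1 : ℝ) 1)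
    (he : e ∈ atlas E2 S) (hWt : W ⊆ e.target) (hWU : ∀ z ∈ W, e.symm z ∈ U) {N : E2 → Mink}
    (h : IsParam W (fun z => (F (e.symm z) : Mink)) N) :
    IsCurvParam W (fun z => (F (e.symm z) : Mink)) N := by
  refine ⟨h, fun z hz v => ?_⟩
  obtain ⟨k, h1, h2⟩ := hF.exists_isPrincipalCurvature he hWt hWU h hz
  obtain ⟨k', h1', h2'⟩ := hF.exists_isPrincipalCurvature he hWt hWU h.neg hz
  have h3 := h2 v
  have h4 := h2' v
  have h5 := (hk _ _ h1).2
  have h6 := (hk _ _ h1').2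
  have h7 := lor_self_nonneg (h.mem z hz) (h.lor_fderiv_self hz v)
  rw [fderiv_fun_neg, _root_.neg_apply, lor_neg_left] at h4
  rw [abs_le]
  constructor <;> nlinarith

end Chart
end Hyp3

namespace Hyp3
open Set Filter Topology

/-! ### Discs on a covering surface -/

/-- A local section of a covering: a sheet over an evenly covered open set. -/
lemma exists_sheet {X Y I : Type*} [TopologicalSpace X] [TopologicalSpace Y] [TopologicalSpace I]
    {p : X → Y} {s : Y} (h : IsEvenlyCovered p s I) :
    ∃ V : Set Y, IsOpen V ∧ s ∈ V ∧ ∀ y, p y ∈ V → ∃ ψ : OpenPartialHomeomorph X Y,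
      y ∈ ψ.source ∧ ψ.target = V ∧ ∀ a, ψ a = p a := by
  obtain ⟨hI, V, hs, hV, hpV, H, hH⟩ := h
  refine ⟨V, hV, hs, fun y hy => ?_⟩
  have hcont : ContinuousOn p (p ⁻¹' V) := by
    rw [continuousOn_iff_continuous_domRestrict]
    exact (continuous_subtype_val.comp (continuous_fst.comp H.continuous)).congr fun a => hH a
  have hset : {a : X | ∃ ha : p a ∈ V, (H ⟨a, ha⟩).2 = (H ⟨y, hy⟩).2} =
      Subtype.val '' {a : p ⁻¹' V | (H a).2 = (H ⟨y, hy⟩).2} := by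
    ext a; simp
  have hopen : IsOpen {a : X | ∃ ha : p a ∈ V, (H ⟨a, ha⟩).2 = (H ⟨y, hy⟩).2} := by
    rw [hset]
    refine hpV.isOpenMap_subtype_val _ ?_
    exact (isOpen_discrete {(H ⟨y, hy⟩).2}).preimage (continuous_snd.comp H.continuous)
  classical
  refine ⟨{
    toFun := p
    invFun := fun v => if hv : v ∈ V then H.symm (⟨v, hv⟩, (H ⟨y, hy⟩).2) else y
    source := {a : X | ∃ ha : p a ∈ V, (H ⟨a, ha⟩).2 = (H ⟨y, hy⟩).2}
    target := V
    map_source' := fun a ha => ha.1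
    map_target' := fun v hv => by
      have h1 := (H.symm (⟨v, hv⟩, (H ⟨y, hy⟩).2)).2
      simp only [hv, dif_pos, mem_ofPred_eq]
      exact ⟨h1, by simp⟩
    left_inv' := fun a ⟨ha, hae⟩ => by
      rw [dif_pos ha, ← hae]
      have : ((⟨p a, ha⟩ : V), (H ⟨a, ha⟩).2) = H ⟨a, ha⟩ :=
        Prod.ext (Subtype.ext (hH ⟨a, ha⟩).symm) rfl
      rw [this, H.symm_apply_apply]
    right_inv' := fun v hv => by
      rw [dif_pos hv, ← hH, H.apply_symm_apply]
    open_source := hopen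
    open_target := hV
    continuousOn_toFun := hcont.mono fun a ha => ha.1
    continuousOn_invFun := by
      rw [continuousOn_iff_continuous_domRestrict]
      refine (continuous_subtype_val.comp (H.symm.continuous.comp
        (continuous_id.prodMk continuous_const))).congr (f := fun v : V =>
          (H.symm (v, (H ⟨y, hy⟩).2)).1) fun v => ?_
      simp }, ⟨hy, rfl⟩, rfl, fun _ => rfl⟩

instance : ContinuousConstSMul isomH3 H3 where
  continuous_const_smul g :=
    ((g : Mink ≃L[ℝ] Mink).continuous.comp continuous_subtype_val).subtype_mk _

/-- Two lifts of the same map to hyperbolic space differ by an element of the group. -/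
lemma exists_smul_eq_of_proj_eq {Γ : Subgroup isomH3} [ProperlyDiscontinuousSMul Γ H3]
    (hfree : ∀ g ∈ Γ, ∀ x : H3, g • x = x → g = 1) {Y : Type*} [TopologicalSpace Y]
    [PreconnectedSpace Y] [WeaklyLocallyCompactSpace Y] [Nonempty Y] {a b : Y → H3}
    (ha : Continuous a) (hb : Continuous b) (h : ∀ y, proj Γ (a y) = proj Γ (b y)) :
    ∃ g : isomH3, ∀ y, a y = g • b y := by
  have hex : ∀ y, ∃ g : Γ, g • b y = a y := fun y => Quotient.exact (h y)
  obtain ⟨y₀⟩ := ‹Nonempty Y›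
  obtain ⟨g₀, hg₀⟩ := hex y₀
  have hsmul : ∀ g : Γ, Continuous fun y => g • b y := fun g => hb.const_smul (g : isomH3)
  have huniq : ∀ (g g' : Γ) (x : H3), g • x = g' • x → g = g' := fun g g' x hx => by
    have h1 : (g'⁻¹ * g) • x = x := by rw [mul_smul, hx, inv_smul_smul]
    have h2 := hfree _ (g'⁻¹ * g).2 x h1
    exact (inv_mul_eq_one.1 (Subtype.ext h2 : g'⁻¹ * g = 1)).symm
  have hclopen : IsClopen {y | a y = g₀ • b y} := by
    refine ⟨isClosed_eq ha (hsmul g₀), isOpen_iff_mem_nhds.2 fun y hy => ?_⟩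
    obtain ⟨K, hK, hKy⟩ := exists_compact_mem_nhds y
    have hfin := ProperlyDiscontinuousSMul.finite_disjoint_inter_image (Γ := Γ) (hK.image hb)
      (hK.image ha)
    have hev : ∀ᶠ z in 𝓝 y, ∀ g ∈ {g : Γ | ((g • ·) '' (b '' K) ∩ a '' K).Nonempty} \ {g₀},
        a z ≠ g • b z := by
      refine (eventually_all_finite (hfin.subset sdiff_subset)).2 fun g hg => ?_
      refine (isOpen_ne_fun ha (hsmul g)).mem_nhds fun hc => hg.2 ?_
      exact huniq g g₀ (b y) (hc.symm.trans hy)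
    filter_upwards [hev, hKy] with z hz hzK
    obtain ⟨g, hg⟩ := hex z
    by_contra hc
    refine hz g ⟨⟨a z, ⟨b z, ⟨z, hzK, rfl⟩, hg⟩, ⟨z, hzK, rfl⟩⟩, fun hgg => ?_⟩ hg.symm
    exact hc (by rw [← mem_singleton_iff.1 hgg]; exact hg.symm)
  have huniv := hclopen.eq_univ ⟨y₀, hg₀.symm⟩
  exact ⟨g₀, fun y => by
    have : y ∈ {y | a y = g₀ • b y} := huniv ▸ mem_univ y
    exact this⟩

lemma chord_smul (g : isomH3) (v w : Mink) :
    chord ((g : Mink ≃L[ℝ] Mink) v) ((g : Mink ≃L[ℝ] Mink) w) = chord v w := by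
  rw [chord, ← map_sub, g.2.1]; rfl

/-- Isometries of hyperbolic space preserve the curvature bound. -/
lemma IsCurvParam.smul {W : Set E2} {G N : E2 → Mink} (h : IsCurvParam W G N) (g : isomH3) :
    IsCurvParam W (fun z => (g : Mink ≃L[ℝ] Mink) (G z)) fun z => (g : Mink ≃L[ℝ] Mink) (N z) := by
  have hd : ∀ (A : E2 → Mink) z v, fderiv ℝ (fun z => (g : Mink ≃L[ℝ] Mink) (A z)) z v =
      (g : Mink ≃L[ℝ] Mink) (fderiv ℝ A z v) := fun A z v => by
    have := (g : Mink ≃L[ℝ] Mink).comp_fderiv (f := A) (x := z)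
    exact congrArg (fun L : E2 →L[ℝ] Mink => L v) this
  refine ⟨⟨h.isOpen, ?_, ?_, fun z hz => (g.2.2 _).2 (h.mem z hz), fun z hz => ?_, fun z hz => ?_,
    fun z hz v => ?_, fun z hz v w hvw => ?_⟩, fun z hz v => ?_⟩
  · exact (g : Mink ≃L[ℝ] Mink).contDiff.comp_contDiffOn h.smooth
  · exact (g : Mink ≃L[ℝ] Mink).contDiff.comp_contDiffOn h.smooth_normal
  · rw [g.2.1, h.unit z hz]
  · rw [g.2.1, h.orth z hz]
  · rw [hd, g.2.1, h.normal z hz]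
  · rw [hd, hd] at hvw
    exact h.inj z hz ((g : Mink ≃L[ℝ] Mink).injective hvw)
  · rw [hd, hd, g.2.1, g.2.1]
    exact h.curv z hz v

lemma IsCurvParam.mono {W W' : Set E2} {G N : E2 → Mink} (h : IsCurvParam W G N)
    (hW' : IsOpen W') (hs : W' ⊆ W) : IsCurvParam W' G N where
  isOpen := hW'
  smooth := h.smooth.mono hs
  smooth_normal := h.smooth_normal.mono hs
  mem z hz := h.mem z (hs hz)
  unit z hz := h.unit z (hs hz)
  orth z hz := h.orth z (hs hz)
  normal z hz := h.normal z (hs hz)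
  inj z hz := h.inj z (hs hz)
  curv z hz := h.curv z (hs hz)

/-- An immersion is locally injective. -/
lemma exists_injOn_of_injective_fderiv {E F : Type*} [NormedAddCommGroup E] [NormedSpace ℝ E]
    [FiniteDimensional ℝ E] [NormedAddCommGroup F] [NormedSpace ℝ F] {G : E → F} {L : E →L[ℝ] F}
    {z : E} (hG : HasStrictFDerivAt G L z) (hL : Function.Injective L) :
    ∃ t ∈ 𝓝 z, InjOn G t := by
  obtain ⟨K, hK, hanti⟩ := L.toLinearMap.injective_iff_antilipschitz.1 hL
  have hc : (0 : NNReal) < (2 * K)⁻¹ := by positivity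
  obtain ⟨t, ht, happ⟩ := hG.approximates_deriv_on_nhds (Or.inr hc)
  refine ⟨t, ht, fun a ha b hb hab => ?_⟩
  have h1 := happ a ha b hb
  rw [hab, sub_self, zero_sub, norm_neg] at h1
  have h2 : ‖a - b‖ ≤ K * ‖L (a - b)‖ := by
    have := hanti.le_mul_dist a b
    rw [dist_eq_norm, dist_eq_norm, ← map_sub] at this
    exact this
  have h3 : (K : ℝ) * ‖L (a - b)‖ ≤ K * (((2 * K)⁻¹ : NNReal) * ‖a - b‖) := by gcongr
  have h4 : (K : ℝ) * (((2 * K)⁻¹ : NNReal) * ‖a - b‖) = ‖a - b‖ / 2 := by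
    have : (K : ℝ) ≠ 0 := by exact_mod_cast hK.ne'
    push_cast
    field_simp
  have h5 : ‖a - b‖ = 0 := by
    have := norm_nonneg (a - b)
    linarith
  exact sub_eq_zero.1 (norm_eq_zero.1 h5)

/-- A parametrized surface is embedded near every point, with boundary circles at a distance that
is locally bounded below. -/
lemma IsCurvParam.exists_radius {W : Set E2} {G N : E2 → Mink} (h : IsCurvParam W G N) {z₀ : E2}
    (hz₀ : z₀ ∈ W) : ∃ r > 0, ∃ ρ > 0, Metric.ball z₀ (3 * r) ⊆ W ∧
      InjOn G (Metric.closedBall z₀ r) ∧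
      ∀ᶠ z' in 𝓝 z₀, ∀ z ∈ Metric.sphere z₀ r, ρ ≤ chord (G z') (G z) := by
  obtain ⟨t, ht, hinj⟩ := exists_injOn_of_injective_fderiv
    ((h.contDiffAt hz₀).hasStrictFDerivAt (by simp)) (h.inj z₀ hz₀)
  obtain ⟨R, hR, hball⟩ := Metric.mem_nhds_iff.1 (inter_mem ht (h.mem_nhds hz₀))
  have hcl : Metric.closedBall z₀ (R / 3) ⊆ Metric.ball z₀ R :=
    Metric.closedBall_subset_ball (by linarith)
  have hI : InjOn G (Metric.closedBall z₀ (R / 3)) :=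
    hinj.mono fun z hz => (hball (hcl hz)).1
  have hWc : Metric.closedBall z₀ (R / 3) ⊆ W := fun z hz => (hball (hcl hz)).2
  have hGc : ContinuousOn G W := h.smooth.continuousOn
  have hcont : ContinuousOn (fun q : E2 × E2 => chord (G q.1) (G q.2)) (W ×ˢ W) := by
    have h1 : ContinuousOn (fun q : E2 × E2 => G q.1) (W ×ˢ W) :=
      hGc.comp continuousOn_fst fun q hq => hq.1
    have h2 : ContinuousOn (fun q : E2 × E2 => G q.2) (W ×ˢ W) :=
      hGc.comp continuousOn_snd fun q hq => hq.2
    exact (h1.sub h2).lor (h1.sub h2)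
  have hpos : ∀ z ∈ Metric.sphere z₀ (R / 3), 0 < chord (G z₀) (G z) := fun z hz => by
    have hzc := Metric.sphere_subset_closedBall hz
    refine lt_of_le_of_ne (chord_nonneg (h.mem z₀ hz₀) (h.mem z (hWc hzc))) fun h0 => ?_
    have h1 := hI (Metric.mem_closedBall_self (by linarith)) hzc
      (eq_of_chord_eq_zero (h.mem z₀ hz₀) (h.mem z (hWc hzc)) h0.symm)
    rw [← h1, Metric.mem_sphere, dist_self] at hz
    linarith
  have hsub : ContinuousOn (fun z => G z₀ - G z) (Metric.sphere z₀ (R / 3)) :=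
    continuousOn_const.sub (hGc.mono (Metric.sphere_subset_closedBall.trans hWc))
  obtain ⟨ρ, hρ, hρmin⟩ : ∃ ρ > 0, ∀ z ∈ Metric.sphere z₀ (R / 3), ρ < chord (G z₀) (G z) := by
    rcases (Metric.sphere z₀ (R / 3)).eq_empty_or_nonempty with he | hne
    · exact ⟨1, one_pos, by simp [he]⟩
    · obtain ⟨z, hz, hmin⟩ := (isCompact_sphere z₀ (R / 3)).exists_isMinOn hne
        (f := fun z => chord (G z₀) (G z))
        (hsub.lor hsub)
      exact ⟨chord (G z₀) (G z) / 2, half_pos (hpos z hz), fun w hw =>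
        (half_lt_self (hpos z hz)).trans_le (hmin hw)⟩
  refine ⟨R / 3, by linarith, ρ, hρ, fun z hz => (hball ?_).2, hI, ?_⟩
  · rwa [show 3 * (R / 3) = R by ring] at hz
  · refine ((isCompact_sphere z₀ (R / 3)).eventually_forall_of_forall_eventually (x₀ := z₀)
      (P := fun z' z => ρ < chord (G z') (G z)) fun z hz => ?_).mono
        fun z' hz' z hz => (hz' z hz).le
    have hzW := hWc (Metric.sphere_subset_closedBall hz)
    have h1 : ContinuousAt (fun q : E2 × E2 => chord (G q.1) (G q.2)) (z₀, z) :=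
      hcont.continuousAt (prod_mem_nhds (h.mem_nhds hz₀) (h.mem_nhds hzW))
    exact h1.eventually_const_lt (hρmin z hz)

section Covering

variable {Γ : Subgroup isomH3} [ProperlyDiscontinuousSMul Γ H3]
  {S : Type*} [TopologicalSpace S] [ChartedSpace E2 S] [IsManifold (𝓡 2) ∞ S]
  {f : S → HypQuotient Γ} {S' : Type*} [TopologicalSpace S'] {p : S' → S} {f' : S' → H3}

/-- Discs exist on a covering surface around all points over a neighbourhood, with a common
lower bound for the distance to the boundary. -/
lemma exists_isDisc_over_nhds (hfree : ∀ g ∈ Γ, ∀ x : H3, g • x = x → g = 1)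
    (hf : IsSmoothImmersion f)
    (hk : ∀ (s : S) (k : ℝ), IsPrincipalCurvature f s k → k ∈ Icc (-1 : ℝ) 1)
    (hp : IsCoveringMap p) (hf' : Continuous f') (hlift : ∀ y, proj Γ (f' y) = f (p y)) (s : S) :
    ∃ ρ > 0, ∀ᶠ s' in 𝓝 s, ∀ y, p y = s' →
      ∃ φ G N z₀ r, IsDisc (fun y => (f' y : Mink)) ρ y φ G N z₀ r := by
  obtain ⟨U, F, hsU, hF⟩ := hf s
  obtain ⟨V, hV, hsV, hsheet⟩ := exists_sheet (hp s)
  let e := chartAt E2 s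
  have he : e ∈ atlas E2 S := chart_mem_atlas E2 s
  have hs : s ∈ e.source := mem_chart_source E2 s
  have hW : IsOpen (e.target ∩ e.symm ⁻¹' (U ∩ V)) :=
    e.isOpen_inter_preimage_symm (hF.isOpen.inter hV)
  set W := e.target ∩ e.symm ⁻¹' (U ∩ V) with hWdef
  have hWt : W ⊆ e.target := inter_subset_left
  have hWU : ∀ z ∈ W, e.symm z ∈ U := fun z hz => hz.2.1
  set G : E2 → Mink := fun z => (F (e.symm z) : Mink) with hG
  obtain ⟨N, hN⟩ := exists_isParam hW (hF.contDiffOn he hWt hWU) (fun z _ => (F (e.symm z)).2)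
    fun z hz => hF.fderiv_injective he hW hWt hWU hz
  have hN' := hF.isCurvParam hk he hWt hWU hN
  have hes : e s ∈ W := ⟨e.map_source hs, by rw [mem_preimage, e.left_inv hs]; exact ⟨hsU, hsV⟩⟩
  obtain ⟨r, hr, ρ, hρ, hball, hinj, hev⟩ := hN'.exists_radius hes
  refine ⟨ρ, hρ, ?_⟩
  have hce := e.continuousAt hs
  filter_upwards [hV.mem_nhds hsV, e.open_source.mem_nhds hs, hce.eventually hev,
    hce.eventually (Metric.ball_mem_nhds (e s) hr)] with s' hs'V hs'e hs'ρ hs'r y hy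
  obtain ⟨ψ, hyψ, hψV, hψ⟩ := hsheet y (by rw [hy]; exact hs'V)
  set B := Metric.ball (e s) (3 * r) with hB
  let φ := (ψ.trans e).trans (OpenPartialHomeomorph.ofSet B Metric.isOpen_ball)
  have hφsymm : ∀ z, φ.symm z = ψ.symm (e.symm z) := fun z => rfl
  have hφ : ∀ a, φ a = e (p a) := fun a => congrArg e (hψ a)
  have htarget : φ.target = B := by
    ext z
    simp only [φ, OpenPartialHomeomorph.trans_target, OpenPartialHomeomorph.ofSet_target,
      OpenPartialHomeomorph.ofSet_symm, OpenPartialHomeomorph.ofSet_apply, mem_inter_iff,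
      mem_preimage, id_eq, hψV]
    exact ⟨fun h => h.1, fun h => ⟨h, (hball h).1, (hball h).2.2⟩⟩
  have hrB : e s' ∈ B := Metric.ball_subset_ball (by linarith) hs'r
  have hpφ : ∀ z ∈ B, p (φ.symm z) = e.symm z := fun z hz => by
    rw [hφsymm, ← hψ, ψ.right_inv (by rw [hψV]; exact (hball hz).2.2)]
  -- On the disc, the lift `f'` and the local lift `F` differ by an isometry.
  obtain ⟨g, hg⟩ : ∃ g : isomH3, ∀ z ∈ B, f' (φ.symm z) = g • F (e.symm z) := by
    have : PreconnectedSpace B :=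
      isPreconnected_iff_preconnectedSpace.1 (convex_ball _ _).isPreconnected
    have : LocallyCompactSpace B := Metric.isOpen_ball.locallyCompactSpace
    have : Nonempty B := ⟨⟨_, hrB⟩⟩
    have h1 : Continuous fun z : B => f' (φ.symm z) :=
      hf'.comp (continuousOn_iff_continuous_domRestrict.1 (htarget ▸ φ.continuousOn_symm))
    have h2 : Continuous fun z : B => F (e.symm z) := by
      refine continuous_induced_rng.2 ?_
      exact continuousOn_iff_continuous_domRestrict.1 (hN.smooth.continuousOn.mono hball)
    obtain ⟨g, hg⟩ := exists_smul_eq_of_proj_eq hfree h1 h2 fun z => by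
      rw [hlift, hpφ z z.2, hF.lift _ (hball z.2).2.1]
    exact ⟨g, fun z hz => hg ⟨z, hz⟩⟩
  have hgG : ∀ z ∈ B, (f' (φ.symm z) : Mink) = (g : Mink ≃L[ℝ] Mink) (G z) := fun z hz =>
    congrArg Subtype.val (hg z hz)
  have hyφ : y ∈ φ.source := by
    simp only [φ, OpenPartialHomeomorph.trans_source, OpenPartialHomeomorph.ofSet_source,
      mem_inter_iff, mem_preimage, OpenPartialHomeomorph.coe_trans, Function.comp_apply, hψ, hy]
    exact ⟨⟨hyψ, hs'e⟩, hrB⟩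
  have hφy : φ y = e s' := by rw [hφ, hy]
  have hcl : Metric.closedBall (e s) r ⊆ B := Metric.closedBall_subset_ball (by linarith)
  have hy' : (f' y : Mink) = (g : Mink ≃L[ℝ] Mink) (G (e s')) := by
    rw [← hgG _ hrB, ← hφy, φ.left_inv hyφ]
  refine ⟨φ, fun z => (g : Mink ≃L[ℝ] Mink) (G z), fun z => (g : Mink ≃L[ℝ] Mink) (N z), e s, r,
    ⟨?_, ?_⟩, hyφ, hr, ?_, ?_, ?_, ?_⟩
  · rw [htarget]
    exact (hN'.mono Metric.isOpen_ball hball).smul g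
  · rw [htarget]; exact hgG
  · rw [htarget]; exact Metric.closedBall_subset_ball (by linarith)
  · rw [hφy]; exact hs'r
  · exact fun z hz w hw hzw => hinj hz hw ((g : Mink ≃L[ℝ] Mink).injective hzw)
  · intro z hz
    simp only [hy', chord_smul]
    exact hs'ρ z hz

/-- Discs of uniform size exist around all points of a covering of a compact surface. -/
lemma exists_isDisc [CompactSpace S] (hfree : ∀ g ∈ Γ, ∀ x : H3, g • x = x → g = 1)
    (hf : IsSmoothImmersion f)
    (hk : ∀ (s : S) (k : ℝ), IsPrincipalCurvature f s k → k ∈ Icc (-1 : ℝ) 1)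
    (hp : IsCoveringMap p) (hf' : Continuous f') (hlift : ∀ y, proj Γ (f' y) = f (p y)) :
    ∃ ρ > 0, ∀ y, ∃ φ G N z₀ r, IsDisc (fun y => (f' y : Mink)) ρ y φ G N z₀ r := by
  have key : ∃ ρ > 0, ∀ y, p y ∈ univ →
      ∃ φ G N z₀ r, IsDisc (fun y => (f' y : Mink)) ρ y φ G N z₀ r := by
    refine isCompact_univ.induction_on (p := fun A : Set S => ∃ ρ > 0, ∀ y, p y ∈ A →
      ∃ φ G N z₀ r, IsDisc (fun y => (f' y : Mink)) ρ y φ G N z₀ r) ?_ ?_ ?_ ?_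
    · exact ⟨1, one_pos, fun y hy => hy.elim⟩
    · rintro A B hAB ⟨ρ, hρ, h⟩
      exact ⟨ρ, hρ, fun y hy => h y (hAB hy)⟩
    · rintro A B ⟨ρ, hρ, h⟩ ⟨ρ', hρ', h'⟩
      refine ⟨min ρ ρ', lt_min hρ hρ', fun y hy => ?_⟩
      rcases hy with hy | hy
      · obtain ⟨φ, G, N, z₀, r, hd⟩ := h y hy
        exact ⟨φ, G, N, z₀, r, hd.mono (min_le_left _ _)⟩
      · obtain ⟨φ, G, N, z₀, r, hd⟩ := h' y hy
        exact ⟨φ, G, N, z₀, r, hd.mono (min_le_right _ _)⟩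
    · intro s _
      obtain ⟨ρ, hρ, h⟩ := exists_isDisc_over_nhds hfree hf hk hp hf' hlift s
      exact ⟨_, mem_nhdsWithin_of_mem_nhds h, ρ, hρ, fun y hy => hy y rfl⟩
  obtain ⟨ρ, hρ, h⟩ := key
  exact ⟨ρ, hρ, fun y => h y (mem_univ _)⟩

end Covering
end Hyp3

namespace Hyp3
open Set Filter Topology

/-! ### The point at infinity that is not a limit point -/

/-- On a complete surface there is a point `e` and a null vector `ξ` such that the horospherical
height function of `ξ` bounds the distance from `e`. -/
lemma CurvSurface.IsComplete.exists_null_bound {X : Type*} [TopologicalSpace X] [T2Space X]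
    [PreconnectedSpace X] {S : CurvSurface X} (hS : S.IsComplete) {φ : OpenPartialHomeomorph X E2}
    {G N : E2 → Mink} (hc : S.IsChart φ G N) {z : E2} (hz : z ∈ φ.target) :
    ∃ ξ e K, IsNull ξ ∧ lor ξ e = -1 ∧ ∀ y, -lor (S.x y) e ≤ K * -lor (S.x y) ξ := by
  obtain ⟨y, hy, σ, κ, hσ, hκ, hpos⟩ := hc.param.exists_strict hz
  have h2 := hc.param.eventually_two_point hy hpos
  rw [nhds_prod_eq] at h2
  have h3 : ∀ᶠ b in 𝓝 y, σ * lor (G b - G y) (N y) ≤ κ / 2 * chord (G y) (G b) :=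
    (Filter.Eventually.curry h2).self_of_nhds
  have hp := φ.map_target hy
  have hφ := φ.continuousAt hp
  rw [ContinuousAt, φ.right_inv hy] at hφ
  have h4 : ∀ᶠ a in 𝓝 (φ.symm y), σ * lor (S.x a - S.x (φ.symm y)) (N y) ≤
      κ / 2 * chord (S.x (φ.symm y)) (S.x a) := by
    filter_upwards [hφ.eventually h3, φ.open_source.mem_nhds hp] with a ha has
    have hxa : S.x a = G (φ a) := by rw [← hc.eq _ (φ.map_source has), φ.left_inv has]
    rwa [hc.eq y hy, hxa]
  obtain ⟨σ', hσ', h5⟩ : ∃ σ' : ℝ, σ' ^ 2 = 1 ∧ ∀ᶠ a in 𝓝 (φ.symm y),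
      σ' * lor (S.x a - S.x (φ.symm y)) (S.ν (φ.symm y)) ≤
        κ / 2 * chord (S.x (φ.symm y)) (S.x a) := by
    rcases hc.normal y hy with h | h
    · exact ⟨σ, hσ, by rw [h]; exact h4⟩
    · refine ⟨-σ, by rw [neg_sq, hσ], ?_⟩
      rw [h]
      simpa only [lor_neg_right, neg_mul_neg] using h4
  obtain ⟨ρ, C, δ, η, hA⟩ := exists_isAttractor hS (φ.symm y) hσ' hκ h5
  have hξ := isNull_tangent (S := S) (φ.symm y) hσ'
  obtain ⟨K, hK⟩ := hA.exists_bound hS hξ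
  refine ⟨_, S.x (φ.symm y), K, hξ, ?_, hK⟩
  rw [lor_add_left, lor_smul_left, (S.mem _).1, S.orth]; ring

/-- If the horospherical height function of `ξ` bounds the distance from a point along a set, then
the point at infinity of `ξ` is not a limit point of the set. -/
lemma exists_notMem_limitSet {A : Set H3} {ξ e : Mink} {K : ℝ} (hξ : IsNull ξ)
    (he : lor ξ e = -1) (h : ∀ x ∈ A, -lor (x : Mink) e ≤ K * -lor (x : Mink) ξ) :
    ∃ u, u ∉ limitSet A := by
  have hpos := hξ.pos
  have hnorm : ‖ξ.1‖ = ξ.2 := by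
    have h1 := hξ.null
    rw [lor, real_inner_self_eq_norm_sq] at h1
    exact (sq_eq_sq₀ (norm_nonneg _) hpos.le).1 (by linarith)
  refine ⟨⟨ξ.2⁻¹ • ξ.1, ?_⟩, fun hu => ?_⟩
  · rw [mem_sphere_zero_iff_norm, norm_smul, norm_inv, Real.norm_of_nonneg hpos.le, hnorm,
      inv_mul_cancel₀ hpos.ne']
  have hclosed : IsClosed {w : E3 | 0 ≤ lor (w, 1) e - K * lor (w, 1) ξ} := by
    have h1 : Continuous fun w : E3 => ((w, 1) : Mink) := by fun_prop
    exact isClosed_le continuous_const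
      ((h1.lor continuous_const).sub (continuous_const.mul (h1.lor continuous_const)))
  have hscale : ∀ x : Mink, 0 < x.2 → ((x.2⁻¹ • x.1, 1) : Mink) = x.2⁻¹ • x := fun x hx =>
    Prod.ext rfl (inv_mul_cancel₀ hx.ne').symm
  have hmem := closure_minimal (t := {w : E3 | 0 ≤ lor (w, 1) e - K * lor (w, 1) ξ}) (by
    rintro _ ⟨x, hx, rfl⟩
    have h1 := h x hx
    have h2 : 0 < (x : Mink).2 := x.2.2
    simp only [mem_ofPred_eq, toBall]
    rw [hscale _ h2, lor_smul_left, lor_smul_left]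
    have : 0 ≤ (x : Mink).2⁻¹ * (lor (x : Mink) e - K * lor (x : Mink) ξ) :=
      mul_nonneg (inv_nonneg.2 h2.le) (by linarith)
    linarith) hclosed hu
  simp only [mem_ofPred_eq] at hmem
  rw [hscale _ hpos, lor_smul_left, lor_smul_left, he, hξ.null] at hmem
  have := inv_pos.2 hpos
  linarith

lemma _root_.IsCoveringMap.t2Space {X Y : Type*} [TopologicalSpace X] [TopologicalSpace Y]
    [T2Space Y] {p : X → Y} (hp : IsCoveringMap p) : T2Space X := by
  refine ⟨fun a b hab => ?_⟩
  by_cases h : p a = p b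
  · exact hp.isSeparatedMap a b h hab
  · exact separated_by_continuous hp.continuous h

end Hyp3

theorem lemma2
    -- the complete hyperbolic 3-manifold `M = H³/Γ`, without cusps
    (Γ : Subgroup Hyp3.isomH3) [ProperlyDiscontinuousSMul Γ Hyp3.H3]
    (hfree : ∀ g ∈ Γ, ∀ x : Hyp3.H3, g • x = x → g = 1)
    (hcusp : ∀ g ∈ Γ, ¬ Hyp3.IsParabolic g)
    -- the closed orientable surface `S`
    {S : Type*} [TopologicalSpace S] [T2Space S] [CompactSpace S] [ConnectedSpace S]
    [ChartedSpace (EuclideanSpace ℝ (Fin 2)) S] [IsManifold (𝓡 2) ∞ S]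
    (hor : Hyp3.IsOrientable S)
    -- the smooth immersion `f : S → M`
    (f : S → Hyp3.HypQuotient Γ) (hf : Hyp3.IsSmoothImmersion f)
    (hk : ∀ (s : S) (k : ℝ), Hyp3.IsPrincipalCurvature f s k → k ∈ Set.Icc (-1 : ℝ) 1)
    -- a connected covering `S'` of `S`, such as its universal cover, and a lift of `f` to `H³`
    {S' : Type*} [TopologicalSpace S'] [ConnectedSpace S']
    (p : S' → S) (hp : IsCoveringMap p)
    (f' : S' → Hyp3.H3) (hf' : Continuous f')
    (hlift : ∀ y : S', Hyp3.proj Γ (f' y) = f (p y)) :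
    Hyp3.limitSet (Set.range f') ⊂ (Set.univ : Set Hyp3.SphereAtInfinity) := by
  have : T2Space S' := hp.t2Space
  obtain ⟨ρ, hρ, hdisc⟩ := Hyp3.exists_isDisc hfree hf hk hp hf' hlift
  obtain ⟨X, hX, hchart⟩ := Hyp3.exists_curvSurface (x := fun y => (f' y : Hyp3.Mink))
    (continuous_subtype_val.comp hf') (fun y => (f' y).2) fun y => by
      obtain ⟨φ, G, N, z₀, r, hd⟩ := hdisc y
      exact ⟨φ, G, N, hd.mem_source, hd.toIsSurfChart⟩
  have hcomplete : X.IsComplete := Hyp3.CurvSurface.isComplete_of_isDisc hρ fun y => by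
    obtain ⟨φ, G, N, z₀, r, hd⟩ := hdisc y
    exact ⟨φ, G, N, z₀, r, hX ▸ hd, hchart φ G N hd.toIsSurfChart⟩
  obtain ⟨y⟩ : Nonempty S' := inferInstance
  obtain ⟨φ, G, N, z₀, r, hd⟩ := hdisc y
  obtain ⟨ξ, e, K, hξ, he, hK⟩ :=
    hcomplete.exists_null_bound (hchart φ G N hd.toIsSurfChart) (φ.map_source hd.mem_source)
  rw [Set.ssubset_univ_iff, Set.ne_univ_iff_exists_notMem]
  refine Hyp3.exists_notMem_limitSet (K := K) hξ he ?_
  rintro _ ⟨y, rfl⟩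
  simpa only [hX] using hK y
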